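/- All algorithms are deterministic and run on a random access machine with logarithmic cost (for the statements below this is interchangeable with a word RAM with words of logarithmic length in the running time). The PP-SETH is the following statement: for no $\varepsilon\in(0,2)$ is there an algorithm that takes as input a 3-CNF formula $\phi$ (every clause has at most three literals) and a path decomposition, of width $\mathrm{pw}$, of its primal graph (vertices: the variables; edges: pairs of distinct variables occurring in a common clause), and decides whether $\phi$ is satisfiable in time $O((2-\varepsilon)^{\mathrm{pw}}N^{O(1)})$, where $N$ is the number of variables plus the length of the input. An NFA with $n\ge 1$ states over a finite alphabet $\Sigma$ is given by its initial state, its set of accepting states, and the list (without repetitions) of its arcs labelled with elements of $\Sigma$. It is a DFA if every state has exactly one outgoing arc with each label. Theorem. The following statements are equivalent. 1. The PP-SETH is false. 2. There exist $\varepsilon>0$, an integer $k>1$, $c>0$ and an algorithm that takes as input $k$ DFAs with $n$ states over the alphabet $\{0,1\}$ and an integer $\ell\ge 1$ and decides in time $O(n^{k-\varepsilon}\ell^{c})$ whether there is a string of length at most $\ell$ that is accepted by all $k$ DFAs. 3. There exist $\varepsilon>0$, an integer $k_0>1$, $c>0$ and a single algorithm that, for every $k>k_0$, takes as input $k$ NFAs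 with $n$ states over the alphabet $\{0,1\}$ and an integer $\ell\ge 1$ and decides in time $O(n^{(1-\varepsilon)k}\ell^{c})$, where the implied constant may depend on $k$, whether there is a string of length at most $\ell$ that is accepted by all $k$ NFAs. 4. The same as 3 for NFAs over arbitrary finite alphabets: a single algorithm, with the same $\varepsilon$, $k_0$, $c$ for all alphabets $\Sigma$, where the implied constant may depend on $k$ and on $|\Sigma|$. -/

import Mathlib

namespace PathSETH

/-! ## Random access machines with logarithmic cost

A machine has registers holding natural numbers and unbounded arrays of natural numbers that
are accessed by indirect addressing. A program text names only finitely many registers and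
arrays (a single memory simulates finitely many arrays by interleaving, with constant-factor
overhead). Control flow is structured. The cost of an instruction is the total bit length of
the numbers it handles, i.e. the usual logarithmic cost criterion; up to logarithmic factors
this is the number of steps of a word RAM. -/

/-- The arithmetic operations. Subtraction is truncated, the quotient is rounded down. -/
inductive BinOp where
  | add | sub | mul | div

/-- The value of an arithmetic operation. -/
def BinOp.eval : BinOp → ℕ → ℕ → ℕ
  | .add, x, y => x + y
  | .sub, x, y => x - y
  | .mul, x, y => x * y
  | .div, x, y => x / y

/-- Programs of the machine. -/
inductive Program where
  /-- do nothing -/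
  | skip
  /-- `const r v`: register `r` := the constant `v` -/
  | const (r v : ℕ)
  /-- `arith o r x y`: register `r` := (register `x`) `o` (register `y`) -/
  | arith (o : BinOp) (r x y : ℕ)
  /-- `load r A i`: register `r` := the cell of array `A` whose address is in register `i` -/
  | load (r A i : ℕ)
  /-- `store A i x`: the cell of array `A` whose address is in register `i` := register `x` -/
  | store (A i x : ℕ)
  /-- `seq P Q`: first `P`, then `Q` -/
  | seq (P Q : Program)
  /-- `ite r P Q`: `P` if register `r` is nonzero, otherwise `Q` -/
  | ite (r : ℕ) (P Q : Program)
  /-- `loop r P`: repeat `P` while register `r` is nonzero -/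
  | loop (r : ℕ) (P : Program)

/-- A memory configuration: the registers, and the cells of the arrays. -/
structure Config where
  reg : ℕ → ℕ
  mem : ℕ → ℕ → ℕ

/-- The configuration in which register `r` is overwritten by `v`. -/
def Config.setReg (S : Config) (r v : ℕ) : Config :=
  { S with reg := Function.update S.reg r v }

/-- The configuration in which cell `i` of array `A` is overwritten by `v`. -/
def Config.setMem (S : Config) (A i v : ℕ) : Config :=
  { S with mem := Function.update S.mem A (Function.update (S.mem A) i v) }

/-- The number of binary digits of `x`, where `0` has one digit. -/
def bitLength (x : ℕ) : ℕ := Nat.log 2 x + 1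

/-- `Exec P S S' t`: started in the configuration `S`, the program `P` halts in the
configuration `S'`, and the run has total cost `t`. -/
inductive Exec : Program → Config → Config → ℕ → Prop where
  | skip (S : Config) : Exec .skip S S 1
  | const (S : Config) (r v : ℕ) : Exec (.const r v) S (S.setReg r v) (bitLength v)
  | arith (S : Config) (o : BinOp) (r x y : ℕ) :
      Exec (.arith o r x y) S (S.setReg r (o.eval (S.reg x) (S.reg y)))
        (bitLength (S.reg x) + bitLength (S.reg y))
  | load (S : Config) (r A i : ℕ) :
      Exec (.load r A i) S (S.setReg r (S.mem A (S.reg i)))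
        (bitLength (S.reg i) + bitLength (S.mem A (S.reg i)))
  | store (S : Config) (A i x : ℕ) :
      Exec (.store A i x) S (S.setMem A (S.reg i) (S.reg x))
        (bitLength (S.reg i) + bitLength (S.reg x))
  | seq {P Q : Program} {S S' S'' : Config} {t t' : ℕ} :
      Exec P S S' t → Exec Q S' S'' t' → Exec (.seq P Q) S S'' (t + t')
  | ite_true {r : ℕ} {P Q : Program} {S S' : Config} {t : ℕ} :
      S.reg r ≠ 0 → Exec P S S' t → Exec (.ite r P Q) S S' (bitLength (S.reg r) + t)
  | ite_false {r : ℕ} {P Q : Program} {S S' : Config} {t : ℕ} :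
      S.reg r = 0 → Exec Q S S' t → Exec (.ite r P Q) S S' (bitLength (S.reg r) + t)
  | loop_done {r : ℕ} {P : Program} {S : Config} :
      S.reg r = 0 → Exec (.loop r P) S S (bitLength (S.reg r))
  | loop_step {r : ℕ} {P : Program} {S S' S'' : Config} {t t' : ℕ} :
      S.reg r ≠ 0 → Exec P S S' t → Exec (.loop r P) S' S'' t' →
      Exec (.loop r P) S S'' (bitLength (S.reg r) + t + t')

/-- The initial configuration: the input word `w` stands in array `0`, its length in
register `0`, and everything else is zero. -/
def initial (w : List ℕ) : Config where
  reg := fun r => if r = 0 then w.length else 0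
  mem := fun A i => if A = 0 then w.getD i 0 else 0

/-- On the input `w` the program `P` halts within time `T` and answers correctly whether
`Yes` holds: register `0` finally contains `1` if it does and `0` if it does not. -/
def Program.DecidesWithin (P : Program) (w : List ℕ) (Yes : Prop) (T : ℝ) : Prop :=
  ∃ (S : Config) (t : ℕ), Exec P (initial w) S t ∧ (t : ℝ) ≤ T ∧
    ((Yes ∧ S.reg 0 = 1) ∨ (¬ Yes ∧ S.reg 0 = 0))

/-! ## Satisfiability and path decompositions -/

/-- CNF formulas on the variables `Fin n`: lists of clauses, which are lists of literals; the
literal `(x, b)` says that the variable `x` has the truth value `b`. -/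
abbrev CNF (n : ℕ) : Type := List (List (Fin n × Bool))

/-- Every clause has at most three literals. -/
def CNF.IsThreeCNF {n : ℕ} (φ : CNF n) : Prop := ∀ C ∈ φ, C.length ≤ 3

/-- Some assignment makes a literal of every clause true. -/
def CNF.Satisfiable {n : ℕ} (φ : CNF n) : Prop :=
  ∃ σ : Fin n → Bool, ∀ C ∈ φ, ∃ l ∈ C, σ l.1 = l.2

/-- The primal graph: two distinct variables are adjacent if they occur in a common clause. -/
def CNF.primalGraph {n : ℕ} (φ : CNF n) : SimpleGraph (Fin n) where
  Adj x y := x ≠ y ∧ ∃ C ∈ φ, (∃ l ∈ C, l.1 = x) ∧ (∃ l ∈ C, l.1 = y)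
  symm := ⟨fun _ _ h => ⟨h.1.symm, h.2.imp fun _ hC => ⟨hC.1, hC.2.2, hC.2.1⟩⟩⟩
  loopless := ⟨fun _ h => h.1 rfl⟩

/-- The sequence of bags `B` is a path decomposition of `G`: every vertex and every edge is
contained in some bag, and a vertex that lies in two bags lies in all bags between them. -/
def IsPathDecomposition {V : Type*} (G : SimpleGraph V) (B : List (Finset V)) : Prop :=
  (∀ x : V, ∃ X ∈ B, x ∈ X) ∧
  (∀ x y : V, G.Adj x y → ∃ X ∈ B, x ∈ X ∧ y ∈ X) ∧
  (∀ i j k : Fin B.length, i ≤ j → j ≤ k → ∀ x : V, x ∈ B.get i → x ∈ B.get k → x ∈ B.get j)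

/-- The width: the maximum size of a bag, minus one (`0` if there is no nonempty bag). -/
def width {V : Type*} (B : List (Finset V)) : ℕ := (B.map Finset.card).foldr max 0 - 1

/-- The input word for a formula and a sequence of bags: the numbers of variables and of
clauses, the clauses one after the other, the number of bags, the bags one after the other. -/
def encodeSAT {n : ℕ} (φ : CNF n) (B : List (List (Fin n))) : List ℕ :=
  [n, φ.length]
    ++ φ.flatMap (fun C => C.length :: C.flatMap (fun l => [l.1.val, if l.2 then 1 else 0]))
    ++ [B.length]
    ++ B.flatMap (fun X => X.length :: X.map Fin.val)

/-- The size of the instance: the number of variables plus the length of the input word. -/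
def sizeSAT {n : ℕ} (φ : CNF n) (B : List (List (Fin n))) : ℕ := n + (encodeSAT φ B).length

/-- The PP-SETH: for no `ε > 0` does an algorithm decide 3-SAT, given the formula together with
a path decomposition of its primal graph of width `pw`, in time `(2 - ε) ^ pw` times a
polynomial in the size of the instance. Each bag is listed without repetitions. The condition
`ε < 2` only says that the base is positive. -/
def PPSETH : Prop :=
  ∀ ε : ℝ, 0 < ε → ε < 2 →
    ¬ ∃ (P : Program) (K : ℝ) (c : ℕ),
      ∀ (n : ℕ) (φ : CNF n) (B : List (List (Fin n))),
        φ.IsThreeCNF → (∀ X ∈ B, X.Nodup) →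
        IsPathDecomposition φ.primalGraph (B.map List.toFinset) →
        P.DecidesWithin (encodeSAT φ B) φ.Satisfiable
          (K * (2 - ε) ^ width (B.map List.toFinset) * (sizeSAT φ B : ℝ) ^ c)

/-! ## Finite automata -/

/-- Descriptions of nondeterministic finite automata with states `Fin n` and alphabet `Fin s`:
an initial state, the accepting states, and a list of labelled arcs without repetitions. -/
structure FA (s n : ℕ) where
  start : Fin n
  accept : Fin n → Bool
  arcs : List (Fin n × Fin s × Fin n)
  nodup : arcs.Nodup

/-- The automaton that is described. -/
def FA.toNFA {s n : ℕ} (M : FA s n) : NFA (Fin s) (Fin n) where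
  step q a := {r | (q, a, r) ∈ M.arcs}
  start := {M.start}
  accept := {q | M.accept q = true}

/-- The automaton is deterministic: every state has exactly one outgoing arc with each label. -/
def FA.IsDFA {s n : ℕ} (M : FA s n) : Prop :=
  ∀ (q : Fin n) (a : Fin s), ∃! r : Fin n, (q, a, r) ∈ M.arcs

/-- Some string of length at most `ℓ` is accepted by all the automata. -/
def IntersectionNonempty {k s n : ℕ} (ℓ : ℕ) (M : Fin k → FA s n) : Prop :=
  ∃ w : List (Fin s), w.length ≤ ℓ ∧ ∀ i : Fin k, w ∈ (M i).toNFA.accepts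

/-- The word for one automaton: the initial state, for each state whether it is accepting, the
number of arcs, the arcs one after the other. -/
def FA.encode {s n : ℕ} (M : FA s n) : List ℕ :=
  [M.start.val]
    ++ List.ofFn (fun q => if M.accept q then 1 else 0)
    ++ [M.arcs.length]
    ++ M.arcs.flatMap (fun e => [e.1.val, e.2.1.val, e.2.2.val])

/-- The input word for `k` automata with `n` states and a length bound `ℓ`. -/
def encodeFAs {k s n : ℕ} (ℓ : ℕ) (M : Fin k → FA s n) : List ℕ :=
  [k, s, n, ℓ] ++ (List.ofFn M).flatMap FA.encode

end PathSETH

/-!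
Both problems are questions about a sequence of local constraints, read from left to right, in
which only a small amount of information is alive at any time: the values of the variables in the
present bag, which are about `pw` bits, or the present states of `k` automata, which are about
`k * log n` bits. The theorem holds because each problem can be translated into the other with
almost no loss in this amount, so that saving a constant fraction of the exponent is the same in
both.

From automata to satisfiability (`PathSETH.not_PPSETH_of_dfa`). Let a formula with a path
decomposition be given. Each variable lives in an interval of bags, and the intervals are
coloured with at most `pw + 1` colours such that variables of the same colour never live at the
same time. The colours are distributed evenly among `k` automata. A string is meant to contain
the value of each variable at the time when it begins to live and, for each clause, the claim
that certain of its literals are true. The automaton `i` counts the letters, remembers the values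
of the living variables with its colours, which are about `pw / k` bits, and rejects if a claim
about one of them is wrong or if no claim has been made for a clause
(`PathSETH.Plan.Valid.intersectionNonempty_iff`). So there are `k` deterministic automata with
`n = 2 ^ (pw / k)` states up to a polynomial factor, and time `n ^ (k - ε)` for them is time
`(2 ^ (1 - ε / k)) ^ pw` for the formula, again up to a polynomial factor. A polynomial factor is
allowed here since `k` is fixed.

From satisfiability to automata (`PathSETH.exists_nfa_of_not_PPSETH`). Padded with steps that
read nothing, a common run of `k` automata on a string of length at most `ℓ` consists of `ℓ + 1`
rounds, in which the automata move one after the other. The variables of the formula are the bits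
of all states, the letters in unary, and an indicator for each way in which an automaton can move
in a round. The requirement that one of these ways is picked is broken into clauses with three
literals by means of auxiliary variables; the other requirements have the form that a picked move
determines a bit (`PathSETH.FA.tableau_satisfiable_iff`). A bag holds the states of all automata
and one new state, which makes the width `(k + 1) * log n` up to a constant. Time
`(2 ^ (1 - δ)) ^ pw` times a polynomial thus becomes `n ^ ((1 - δ) * (k + 1))` times a polynomial
whose degree does not depend on `k` or on the alphabet. For large `k` this is at most
`n ^ ((1 - δ / 2) * k)` times a power of `ℓ`.

The remaining implications, between the statements about automata, are specializations: the
alphabet has two letters, `k` is fixed, and the automata are deterministic.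

Both translations have to be carried out by a machine whose cost is counted. The input word is
only ever inspected by expressions with bounded iteration (`PathSETH.Expr`), and the output word
is described by nested loops (`PathSETH.Emitter`). Every expression is evaluated in time
polynomial in the number `PathSETH.size w`, which is the length of the input word `w` plus the
sum of its entries (`PathSETH.Expr.exists_good`), and each loop writes an entry in every round.
Hence the output is written in time polynomial in this number times the length of the output, and
an algorithm for the output becomes an algorithm for the input (`PathSETH.Emitter.reduction`). It
matters that the first factor is a polynomial in `size w` and not in the length of the output,
which is exponential in `pw / k` in the first translation.
-/

namespace PathSETH

/-! ### Runs with a bound on the cost -/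

/-- Started in `S`, the program `P` halts at cost at most `T` in a configuration satisfying
`Q`. -/
def Runs (P : Program) (S : Config) (T : ℕ) (Q : Config → Prop) : Prop :=
  ∃ (S' : Config) (t : ℕ), Exec P S S' t ∧ t ≤ T ∧ Q S'

theorem Runs.mono {P : Program} {S : Config} {T T' : ℕ} {Q Q' : Config → Prop}
    (h : Runs P S T Q) (hT : T ≤ T') (hQ : ∀ S', Q S' → Q' S') : Runs P S T' Q' := by
  obtain ⟨S', t, h1, h2, h3⟩ := h
  exact ⟨S', t, h1, h2.trans hT, hQ _ h3⟩

theorem Runs.seq {P P' : Program} {S : Config} {T T' : ℕ} {Q R : Config → Prop}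
    (h : Runs P S T Q) (h' : ∀ S', Q S' → Runs P' S' T' R) : Runs (.seq P P') S (T + T') R := by
  obtain ⟨S', t, h1, h2, h3⟩ := h
  obtain ⟨S'', t', h1', h2', h3'⟩ := h' S' h3
  exact ⟨S'', t + t', .seq h1 h1', by omega, h3'⟩

theorem runs_skip {S : Config} {Q : Config → Prop} (h : Q S) : Runs .skip S 1 Q :=
  ⟨S, 1, .skip S, le_rfl, h⟩

theorem runs_const {S : Config} {r v : ℕ} {Q : Config → Prop} (h : Q (S.setReg r v)) :
    Runs (.const r v) S (bitLength v) Q :=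
  ⟨_, _, .const S r v, le_rfl, h⟩

theorem runs_arith {S : Config} {o : BinOp} {r x y T : ℕ} {Q : Config → Prop}
    (hT : bitLength (S.reg x) + bitLength (S.reg y) ≤ T)
    (h : Q (S.setReg r (o.eval (S.reg x) (S.reg y)))) :
    Runs (.arith o r x y) S T Q :=
  ⟨_, _, .arith S o r x y, hT, h⟩

theorem runs_load {S : Config} {r A i T : ℕ} {Q : Config → Prop}
    (hT : bitLength (S.reg i) + bitLength (S.mem A (S.reg i)) ≤ T)
    (h : Q (S.setReg r (S.mem A (S.reg i)))) :
    Runs (.load r A i) S T Q :=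
  ⟨_, _, .load S r A i, hT, h⟩

theorem runs_store {S : Config} {A i x T : ℕ} {Q : Config → Prop}
    (hT : bitLength (S.reg i) + bitLength (S.reg x) ≤ T)
    (h : Q (S.setMem A (S.reg i) (S.reg x))) :
    Runs (.store A i x) S T Q :=
  ⟨_, _, .store S A i x, hT, h⟩

theorem runs_ite {S : Config} {r T β : ℕ} {P P' : Program} {Q : Config → Prop}
    (hβ : bitLength (S.reg r) ≤ β)
    (h : S.reg r ≠ 0 → Runs P S T Q) (h' : S.reg r = 0 → Runs P' S T Q) :
    Runs (.ite r P P') S (β + T) Q := by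
  by_cases hr : S.reg r = 0
  · obtain ⟨S', t, h1, h2, h3⟩ := h' hr
    exact ⟨S', _, .ite_false hr h1, by omega, h3⟩
  · obtain ⟨S', t, h1, h2, h3⟩ := h hr
    exact ⟨S', _, .ite_true hr h1, by omega, h3⟩

/-- A loop that is run exactly `n` times, with invariant `I v` before round `v`; round `v` costs
at most `T v`. -/
theorem runs_loop {r : ℕ} {P : Program} (I : ℕ → Config → Prop) (T : ℕ → ℕ) (β n : ℕ)
    (hstep : ∀ v < n, ∀ S, I v S →
      S.reg r ≠ 0 ∧ bitLength (S.reg r) ≤ β ∧ Runs P S (T v) (I (v + 1)))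
    (hend : ∀ S, I n S → S.reg r = 0) (S : Config) (hS : I 0 S) :
    Runs (.loop r P) S (∑ v ∈ Finset.range n, (β + T v) + 1) (I n) := by
  have key : ∀ m ≤ n, ∀ S, I (n - m) S →
      Runs (.loop r P) S (∑ v ∈ Finset.Ico (n - m) n, (β + T v) + 1) (I n) := by
    intro m
    induction m with
    | zero =>
      intro _ S hS
      have h0 := hend S hS
      refine ⟨S, _, .loop_done h0, ?_, hS⟩
      simp [h0, bitLength]
    | succ m ih =>
      intro hm S hS
      obtain ⟨h1, h2, S', t, h3, h4, h5⟩ := hstep (n - (m + 1)) (by omega) S hS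
      have e : n - (m + 1) + 1 = n - m := by omega
      rw [e] at h5
      obtain ⟨S'', t', h6, h7, h8⟩ := ih (by omega) S' h5
      refine ⟨S'', _, .loop_step h1 h3 h6, ?_, h8⟩
      rw [Finset.sum_eq_sum_Ico_succ_bot (by omega), e]
      omega
  have := key n le_rfl S (by simpa using hS)
  simpa using this

/-! ### Bit lengths -/

theorem bitLength_mono {x y : ℕ} (h : x ≤ y) : bitLength x ≤ bitLength y :=
  Nat.succ_le_succ (Nat.log_mono_right h)

theorem bitLength_le_iff {x b : ℕ} (hb : 1 ≤ b) : bitLength x ≤ b ↔ x < 2 ^ b := by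
  unfold bitLength
  rcases Nat.eq_zero_or_pos x with rfl | hx
  · simp [hb]
  · rw [Nat.succ_le_iff, Nat.log_lt_iff_lt_pow (by norm_num) (by omega)]

theorem lt_two_pow_bitLength (x : ℕ) : x < 2 ^ bitLength x :=
  (bitLength_le_iff (Nat.succ_le_succ (Nat.zero_le _))).1 le_rfl

theorem one_le_bitLength (x : ℕ) : 1 ≤ bitLength x := Nat.succ_le_succ (Nat.zero_le _)

theorem bitLength_le_succ (x : ℕ) : bitLength x ≤ x + 1 :=
  Nat.succ_le_succ (Nat.log_le_self 2 x)

@[simp] theorem bitLength_zero : bitLength 0 = 1 := by simp [bitLength]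

@[simp] theorem bitLength_one : bitLength 1 = 1 := by simp [bitLength]

theorem bitLength_two_pow (n : ℕ) : bitLength (2 ^ n) = n + 1 := by
  simp [bitLength, Nat.log_pow]

theorem bitLength_mul (x y : ℕ) : bitLength (x * y) ≤ bitLength x + bitLength y := by
  rw [bitLength_le_iff (by have := one_le_bitLength x; omega), pow_add]
  exact Nat.mul_lt_mul'' (lt_two_pow_bitLength x) (lt_two_pow_bitLength y)

theorem bitLength_add (x y : ℕ) : bitLength (x + y) ≤ bitLength x + bitLength y := by
  rw [bitLength_le_iff (by have := one_le_bitLength x; omega), pow_add]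
  have hx := lt_two_pow_bitLength x
  have hy := lt_two_pow_bitLength y
  have : (x + 1) * (y + 1) ≤ 2 ^ bitLength x * 2 ^ bitLength y := Nat.mul_le_mul hx hy
  nlinarith [Nat.zero_le (x * y)]

theorem bitLength_eval (o : BinOp) (x y : ℕ) :
    bitLength (o.eval x y) ≤ bitLength x + bitLength y := by
  cases o with
  | add => exact bitLength_add x y
  | sub => exact (bitLength_mono (Nat.sub_le x y)).trans (Nat.le_add_right _ _)
  | mul => exact bitLength_mul x y
  | div => exact (bitLength_mono (Nat.div_le_self x y)).trans (Nat.le_add_right _ _)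

/-! ### A language of expressions over an input word -/

/-- The size of an input word, which bounds its length and its entries. -/
def size (w : List ℕ) : ℕ := w.length + w.sum

/-- Expressions that denote numbers, given an input word and a list of values of variables:
variables (numbered from the outermost one), constants, arithmetic, access to an entry of the
input word, case distinction, bounded iteration and calls. -/
inductive Expr where
  | var (i : ℕ)
  | const (c : ℕ)
  | op (o : BinOp) (a b : Expr)
  | inp (a : Expr)
  | ite (c a b : Expr)
  | fold (N init body : Expr)
  | call (m : ℕ) (args : Fin m → Expr) (f : Expr)

/-- `iter f a n` starts with `a` and replaces the current value `x` by `f v x` for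
`v = 0, …, n - 1`. -/
def iter (f : ℕ → ℕ → ℕ) (a : ℕ) : ℕ → ℕ
  | 0 => a
  | v + 1 => f v (iter f a v)

/-- The value of an expression. In an iteration the counter and the current value become new
variables. The number of rounds is cut off at `size w` and the iterated values at
`2 ^ size w`, so that every expression is evaluated in time polynomial in `size w` and in the
lengths of the values of its variables. -/
def Expr.eval (w : List ℕ) : Expr → List ℕ → ℕ
  | .var i, ρ => ρ.getD i 0
  | .const c, _ => c
  | .op o a b, ρ => o.eval (a.eval w ρ) (b.eval w ρ)
  | .inp a, ρ => w.getD (a.eval w ρ) 0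
  | .ite c a b, ρ => if c.eval w ρ ≠ 0 then a.eval w ρ else b.eval w ρ
  | .fold N a f, ρ =>
      iter (fun v x => min (f.eval w (ρ ++ [v, x])) (2 ^ size w)) (a.eval w ρ)
        (min (N.eval w ρ) (size w))
  | .call _ args f, ρ => f.eval w (List.ofFn fun i => (args i).eval w ρ)

/-- The program that evaluates an expression. The variables are in the registers `regs`, the
result appears in register `s`, and only the registers from `s` on are changed. Register `0`
contains the size of the input word, register `1` two to that power, registers `2` and `3` the
constants `1` and `0`. -/
def Expr.comp : Expr → List ℕ → ℕ → Program
  | .var i, regs, s => .arith .add s (regs.getD i 3) 3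
  | .const c, _, s => .const s c
  | .op o a b, regs, s =>
      .seq (a.comp regs s) (.seq (b.comp regs (s + 1)) (.arith o s s (s + 1)))
  | .inp a, regs, s => .seq (a.comp regs s) (.load s 0 s)
  | .ite c a b, regs, s => .seq (c.comp regs s) (.ite s (a.comp regs s) (b.comp regs s))
  | .fold N a f, regs, s =>
      .seq (a.comp regs s) <| .seq (N.comp regs (s + 1)) <|
      .seq (.arith .sub (s + 1) 0 (s + 1)) <| .seq (.arith .sub (s + 1) 0 (s + 1)) <|
      .seq (.const (s + 2) 0) <| .seq (.arith .sub (s + 3) (s + 1) (s + 2)) <|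
      .loop (s + 3) <|
        .seq (f.comp (regs ++ [s + 2, s]) (s + 3)) <|
        .seq (.arith .sub s 1 (s + 3)) <| .seq (.arith .sub s 1 s) <|
        .seq (.arith .add (s + 2) (s + 2) 2) (.arith .sub (s + 3) (s + 1) (s + 2))
  | .call m args f, regs, s =>
      .seq ((List.ofFn fun i : Fin m => (args i).comp regs (s + i)).foldr .seq .skip) <|
      .seq (f.comp (List.ofFn fun i : Fin m => s + i) (s + m)) (.arith .add s (s + m) 3)

/-- What the programs for expressions need about the configuration. -/
structure Base (w : List ℕ) (S : Config) : Prop where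
  reg0 : S.reg 0 = size w
  reg1 : S.reg 1 = 2 ^ size w
  reg2 : S.reg 2 = 1
  reg3 : S.reg 3 = 0
  mem0 : ∀ i, S.mem 0 i = w.getD i 0

/-- `S'` arises from `S` by putting `x` into register `s` and changing registers above `s`. -/
structure Sets (s x : ℕ) (S S' : Config) : Prop where
  val : S'.reg s = x
  frame : ∀ r < s, S'.reg r = S.reg r
  mem : S'.mem = S.mem

theorem Base.of_frame {w : List ℕ} {S S' : Config} {s : ℕ} (h : Base w S) (hs : 4 ≤ s)
    (hr : ∀ r < s, S'.reg r = S.reg r) (hm : S'.mem = S.mem) : Base w S' where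
  reg0 := by rw [hr 0 (by omega), h.reg0]
  reg1 := by rw [hr 1 (by omega), h.reg1]
  reg2 := by rw [hr 2 (by omega), h.reg2]
  reg3 := by rw [hr 3 (by omega), h.reg3]
  mem0 := by rw [hm]; exact h.mem0

@[simp] theorem setReg_mem (S : Config) (r v : ℕ) : (S.setReg r v).mem = S.mem := rfl

@[simp] theorem setReg_reg_self (S : Config) (r v : ℕ) : (S.setReg r v).reg r = v := by
  simp [Config.setReg]

theorem setReg_reg_ne (S : Config) {r r' : ℕ} (v : ℕ) (h : r' ≠ r) :
    (S.setReg r v).reg r' = S.reg r' := by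
  simp [Config.setReg, h]

theorem setReg_reg (S : Config) (r r' v : ℕ) :
    (S.setReg r v).reg r' = if r' = r then v else S.reg r' := by
  simp [Config.setReg, Function.update_apply]

@[simp] theorem setMem_reg (S : Config) (A i v : ℕ) : (S.setMem A i v).reg = S.reg := rfl

theorem map_reg_congr {S S' : Config} {regs : List ℕ} {s : ℕ} (hlt : ∀ r ∈ regs, r < s)
    (h : ∀ r < s, S'.reg r = S.reg r) : regs.map S'.reg = regs.map S.reg :=
  List.map_congr_left fun r hr => h r (hlt r hr)

/-- `β` bounds the size of the input word and the lengths of the values of the variables. -/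
structure Bounds (w ρ : List ℕ) (β : ℕ) : Prop where
  size_lt : size w < β
  vars : ∀ x ∈ ρ, bitLength x ≤ β

theorem le_size {w : List ℕ} {x : ℕ} (h : x ∈ w) : x ≤ size w :=
  (List.single_le_sum (fun _ _ => Nat.zero_le _) x h).trans (Nat.le_add_left _ _)

theorem getD_le_size (w : List ℕ) (i : ℕ) : w.getD i 0 ≤ size w := by
  rcases lt_or_ge i w.length with h | h
  · rw [List.getD_eq_getElem _ _ h]
    exact le_size (List.getElem_mem h)
  · rw [List.getD_eq_default _ _ h]
    exact Nat.zero_le _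

theorem Bounds.getD_le {w ρ : List ℕ} {β : ℕ} (h : Bounds w ρ β) (i : ℕ) :
    bitLength (ρ.getD i 0) ≤ β := by
  rcases lt_or_ge i ρ.length with hi | hi
  · rw [List.getD_eq_getElem _ _ hi]
    exact h.vars _ (List.getElem_mem hi)
  · rw [List.getD_eq_default _ _ hi]
    have := h.size_lt
    simp; omega

/-- The value of `e` has polynomial length, and the program for `e` computes it in
polynomial time. -/
def Expr.Good (e : Expr) (p q : Polynomial ℕ) : Prop :=
  ∀ (w ρ : List ℕ) (β : ℕ), Bounds w ρ β →
    bitLength (e.eval w ρ) ≤ q.eval β ∧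
    ∀ (regs : List ℕ) (s : ℕ) (S : Config), Base w S → 5 ≤ s → (∀ r ∈ regs, r < s) →
      regs.map S.reg = ρ → Runs (e.comp regs s) S (p.eval β) (Sets s (e.eval w ρ) S)

theorem iter_congr {f g : ℕ → ℕ → ℕ} {a n : ℕ}
    (h : ∀ v < n, f v (iter g a v) = g v (iter g a v)) : iter f a n = iter g a n := by
  induction n with
  | zero => rfl
  | succ n ih =>
    rw [iter, iter, ih fun v hv => h v (by omega), h n (by omega)]

theorem good_var (i : ℕ) : (Expr.var i).Good (2 * Polynomial.X) Polynomial.X := by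
  intro w ρ β hβ
  refine ⟨by simpa [Expr.eval] using hβ.getD_le i, ?_⟩
  intro regs s S hB hs hlt hρ
  have e : S.reg (regs.getD i 3) = ρ.getD i 0 := by
    have h3 := hB.reg3
    rw [← hρ, ← h3, List.getD_map]
  refine runs_arith ?_ ⟨?_, ?_, ?_⟩
  · rw [e, hB.reg3]
    have := hβ.getD_le i
    have h3 := hβ.size_lt
    simp only [Polynomial.eval_mul, Polynomial.eval_ofNat, Polynomial.eval_X, bitLength_zero]
    omega
  · rw [setReg_reg_self, e, hB.reg3]
    rfl
  · intro r hr
    rw [setReg_reg_ne _ _ (by omega)]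
  · rfl

theorem good_const (c : ℕ) :
    (Expr.const c).Good (Polynomial.C (bitLength c)) (Polynomial.C (bitLength c)) := by
  intro w ρ β hβ
  refine ⟨by simp [Expr.eval], ?_⟩
  intro regs s S hB hs hlt hρ
  refine (runs_const ⟨?_, ?_, ?_⟩).mono (by simp) fun _ h => h
  · simp [Expr.eval]
  · intro r hr
    rw [setReg_reg_ne _ _ (by omega)]
  · rfl

theorem good_op {o : BinOp} {a b : Expr} {p q p' q' : Polynomial ℕ} (ha : a.Good p q)
    (hb : b.Good p' q') : (Expr.op o a b).Good (p + (p' + (q + q'))) (q + q') := by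
  intro w ρ β hβ
  obtain ⟨qa, ca⟩ := ha w ρ β hβ
  obtain ⟨qb, cb⟩ := hb w ρ β hβ
  refine ⟨?_, ?_⟩
  · simp only [Expr.eval, Polynomial.eval_add]
    exact (bitLength_eval _ _ _).trans (by omega)
  intro regs s S hB hs hlt hρ
  simp only [Polynomial.eval_add]
  refine (ca regs s S hB hs hlt hρ).seq fun S1 h1 => ?_
  refine Runs.seq (cb regs (s + 1) S1 (hB.of_frame (by omega) h1.frame h1.mem) (by omega)
    (fun r hr => (hlt r hr).trans (by omega))
    (by rw [map_reg_congr hlt h1.frame, hρ])) fun S2 h2 => ?_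
  have e1 : S2.reg s = a.eval w ρ := by rw [h2.frame s (by omega), h1.val]
  refine runs_arith (by rw [e1, h2.val]; omega) ⟨?_, ?_, ?_⟩
  · simp [e1, h2.val, Expr.eval]
  · intro r hr
    rw [setReg_reg_ne _ _ (by omega), h2.frame r (by omega), h1.frame r hr]
  · simp [h2.mem, h1.mem]

theorem good_inp {a : Expr} {p q : Polynomial ℕ} (ha : a.Good p q) :
    (Expr.inp a).Good (p + (q + Polynomial.X)) Polynomial.X := by
  intro w ρ β hβ
  obtain ⟨qa, ca⟩ := ha w ρ β hβ
  have hv : bitLength ((Expr.inp a).eval w ρ) ≤ β :=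
    (bitLength_le_succ _).trans ((Nat.succ_le_succ (getD_le_size w _)).trans hβ.size_lt)
  refine ⟨by simpa using hv, ?_⟩
  intro regs s S hB hs hlt hρ
  simp only [Polynomial.eval_add, Polynomial.eval_X]
  refine (ca regs s S hB hs hlt hρ).seq fun S1 h1 => ?_
  have e : S1.mem 0 (S1.reg s) = (Expr.inp a).eval w ρ := by
    rw [h1.mem, h1.val, hB.mem0, Expr.eval]
  refine runs_load (by rw [e, h1.val]; omega) ⟨?_, ?_, ?_⟩
  · simp [e]
  · intro r hr
    rw [setReg_reg_ne _ _ (by omega), h1.frame r hr]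
  · simp [h1.mem]

theorem good_ite {c a b : Expr} {p q p' q' p'' q'' : Polynomial ℕ} (hc : c.Good p q)
    (ha : a.Good p' q') (hb : b.Good p'' q'') :
    (Expr.ite c a b).Good (p + (q + (p' + p''))) (q' + q'') := by
  intro w ρ β hβ
  obtain ⟨qc, cc⟩ := hc w ρ β hβ
  obtain ⟨qa, ca⟩ := ha w ρ β hβ
  obtain ⟨qb, cb⟩ := hb w ρ β hβ
  refine ⟨?_, ?_⟩
  · simp only [Expr.eval, Polynomial.eval_add]
    split <;> omega
  intro regs s S hB hs hlt hρ
  simp only [Polynomial.eval_add]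
  refine (cc regs s S hB hs hlt hρ).seq fun S1 h1 => ?_
  have hB1 := hB.of_frame (by omega) h1.frame h1.mem
  have hρ1 : regs.map S1.reg = ρ := by rw [map_reg_congr hlt h1.frame, hρ]
  have fin : ∀ {S2 x}, Sets s x S1 S2 → Sets s x S S2 := fun h2 =>
    ⟨h2.val, fun r hr => (h2.frame r hr).trans (h1.frame r hr), h2.mem.trans h1.mem⟩
  refine runs_ite (by rw [h1.val]; exact qc) (fun h => ?_) (fun h => ?_)
  · refine (ca regs s S1 hB1 hs hlt hρ1).mono (by omega) fun S2 h2 => ?_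
    rw [h1.val] at h
    simpa [Expr.eval, h] using fin h2
  · refine (cb regs s S1 hB1 hs hlt hρ1).mono (by omega) fun S2 h2 => ?_
    rw [h1.val] at h
    simpa [Expr.eval, h] using fin h2

theorem good_fold {N a f : Expr} {p q p' q' p'' q'' : Polynomial ℕ} (hN : N.Good p q)
    (ha : a.Good p' q') (hf : f.Good p'' q'') :
    (Expr.fold N a f).Good
      (p' + (p + ((Polynomial.X + q) + ((2 * Polynomial.X) + (1 + ((2 * Polynomial.X) +
        (Polynomial.X * (Polynomial.X + (p''.comp (Polynomial.X + q') +
          (Polynomial.X + q''.comp (Polynomial.X + q') + (2 * Polynomial.X +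
            (2 * Polynomial.X + 2 * Polynomial.X))))) + 1)))))))
      (Polynomial.X + q') := by
  intro w ρ β hβ
  obtain ⟨qN, cN⟩ := hN w ρ β hβ
  obtain ⟨qa, ca⟩ := ha w ρ β hβ
  have hsz := hβ.size_lt
  have smallbit : ∀ x ≤ size w, bitLength x ≤ β := fun x hx =>
    (bitLength_le_succ x).trans (by omega)
  have capbit : ∀ x ≤ 2 ^ size w, bitLength x ≤ β := fun x hx =>
    (bitLength_mono hx).trans (by rw [bitLength_two_pow]; omega)
  set n := min (N.eval w ρ) (size w) with hn
  set g : ℕ → ℕ → ℕ := fun v x => min (f.eval w (ρ ++ [v, x])) (2 ^ size w) with hg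
  set acc : ℕ → ℕ := iter g (a.eval w ρ) with hacc
  have haccb : ∀ v, bitLength (acc v) ≤ β + q'.eval β := by
    intro v
    cases v with
    | zero => exact qa.trans (by omega)
    | succ v => exact (capbit _ (min_le_right _ _)).trans (by omega)
  have hnsz : n ≤ size w := min_le_right _ _
  have hev : (Expr.fold N a f).eval w ρ = acc n := rfl
  refine ⟨by rw [hev]; simpa using haccb n, ?_⟩
  intro regs s S hB hs hlt hρ
  simp only [Polynomial.eval_add, Polynomial.eval_mul, Polynomial.eval_X, Polynomial.eval_comp,
    Polynomial.eval_one, Polynomial.eval_ofNat]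
  rw [hev]
  refine (ca regs s S hB hs hlt hρ).seq fun S1 h1 => ?_
  have hB1 := hB.of_frame (by omega) h1.frame h1.mem
  refine (cN regs (s + 1) S1 hB1 (by omega) (fun r hr => (hlt r hr).trans (by omega))
    (by rw [map_reg_congr hlt h1.frame, hρ])).seq fun S2 h2 => ?_
  have hB2 := hB1.of_frame (by omega) h2.frame h2.mem
  refine Runs.seq (Q := Sets (s + 1) (size w - N.eval w ρ) S2)
    (runs_arith (by rw [hB2.reg0, h2.val]; have := smallbit _ le_rfl; omega)
      ⟨by simp [hB2.reg0, h2.val, BinOp.eval],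
        fun r hr => setReg_reg_ne _ _ (by omega), rfl⟩) fun S3 h3 => ?_
  have hB3 := hB2.of_frame (by omega) h3.frame h3.mem
  refine Runs.seq (Q := Sets (s + 1) n S3)
    (runs_arith (by
        rw [hB3.reg0, h3.val]
        have := smallbit _ le_rfl
        have := smallbit (size w - N.eval w ρ) (by omega)
        omega)
      ⟨by simp [hB3.reg0, h3.val, BinOp.eval, hn]; omega,
        fun r hr => setReg_reg_ne _ _ (by omega), rfl⟩) fun S4 h4 => ?_
  refine Runs.seq (Q := Sets (s + 2) 0 S4) ((runs_const ⟨by simp,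
        fun r hr => setReg_reg_ne _ _ (by omega), rfl⟩).mono (by simp) fun _ h => h)
    fun S5 h5 => ?_
  have hS5s1 : S5.reg (s + 1) = n := by rw [h5.frame _ (by omega), h4.val]
  refine Runs.seq (Q := Sets (s + 3) n S5)
    (runs_arith (by
        rw [hS5s1, h5.val]
        have := smallbit n hnsz
        have := smallbit 0 (by omega)
        omega)
      ⟨by simp [hS5s1, h5.val, BinOp.eval],
        fun r hr => setReg_reg_ne _ _ (by omega), rfl⟩) fun S6 h6 => ?_
  -- the invariant of the loop
  let I : ℕ → Config → Prop := fun v S' =>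
    S'.reg s = acc v ∧ S'.reg (s + 1) = n ∧ S'.reg (s + 2) = v ∧ S'.reg (s + 3) = n - v ∧
      (∀ r < s, S'.reg r = S.reg r) ∧ S'.mem = S.mem
  have hI0 : I 0 S6 := by
    refine ⟨?_, ?_, ?_, ?_, ?_, ?_⟩
    · rw [h6.frame _ (by omega), h5.frame _ (by omega), h4.frame _ (by omega),
        h3.frame _ (by omega), h2.frame _ (by omega), h1.val]; rfl
    · rw [h6.frame _ (by omega), hS5s1]
    · rw [h6.frame _ (by omega), h5.val]
    · rw [h6.val]; rfl
    · intro r hr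
      rw [h6.frame _ (by omega), h5.frame _ (by omega), h4.frame _ (by omega),
        h3.frame _ (by omega), h2.frame _ (by omega), h1.frame _ hr]
    · rw [h6.mem, h5.mem, h4.mem, h3.mem, h2.mem, h1.mem]
  refine (runs_loop I (fun _ => Polynomial.eval (β + q'.eval β) p'' + (β +
    Polynomial.eval (β + q'.eval β) q'' + (2 * β + (2 * β + 2 * β)))) β n ?_ ?_ S6 hI0).mono
    ?_ ?_
  · rintro v hv T ⟨e0, e1, e2, e3, hfr, hm⟩
    refine ⟨by omega, by rw [e3]; exact smallbit _ (by omega), ?_⟩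
    have hBT := hB.of_frame (by omega) hfr hm
    have hb' : Bounds w (ρ ++ [v, acc v]) (β + q'.eval β) := by
      refine ⟨by omega, fun x hx => ?_⟩
      simp only [List.mem_append, List.mem_cons, List.not_mem_nil, or_false] at hx
      rcases hx with hx | rfl | rfl
      · exact (hβ.vars x hx).trans (by omega)
      · exact (smallbit _ (by omega)).trans (by omega)
      · exact haccb v
    obtain ⟨qf, cf⟩ := hf w _ _ hb'
    set y := f.eval w (ρ ++ [v, acc v]) with hy
    refine (cf (regs ++ [s + 2, s]) (s + 3) T hBT (by omega) ?_ ?_).seq fun T1 k1 => ?_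
    · intro r hr
      simp only [List.mem_append, List.mem_cons, List.not_mem_nil, or_false] at hr
      rcases hr with hr | rfl | rfl
      · exact (hlt r hr).trans (by omega)
      · omega
      · omega
    · rw [List.map_append, map_reg_congr hlt hfr, hρ]
      simp [e0, e2]
    have hB1' := hBT.of_frame (by omega) k1.frame k1.mem
    have hcap := capbit _ le_rfl
    refine Runs.seq (Q := fun T2 => T2 = T1.setReg s (2 ^ size w - y))
      (runs_arith (by rw [hB1'.reg1, k1.val]; omega) (by simp [hB1'.reg1, k1.val, BinOp.eval]))
      ?_
    rintro _ rfl
    have hr1 : (T1.setReg s (2 ^ size w - y)).reg 1 = 2 ^ size w := by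
      rw [setReg_reg_ne _ _ (by omega), hB1'.reg1]
    refine Runs.seq (Q := fun T2 => T2.reg s = acc (v + 1) ∧
        (∀ r, r ≠ s → T2.reg r = T1.reg r) ∧ T2.mem = T1.mem)
      (runs_arith (by
        rw [hr1, setReg_reg_self]
        have := capbit (2 ^ size w - y) (by omega)
        omega) ⟨?_, ?_, ?_⟩) ?_
    · rw [setReg_reg_self, hr1, setReg_reg_self]
      have : acc (v + 1) = min y (2 ^ size w) := rfl
      rw [this]; simp only [BinOp.eval]; omega
    · intro r hr
      rw [setReg_reg_ne _ _ hr, setReg_reg_ne _ _ hr]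
    · rfl
    rintro T2 ⟨k2, k2f, k2m⟩
    have f2 : T2.reg (s + 2) = v := by rw [k2f _ (by omega), k1.frame _ (by omega), e2]
    have f2' : T2.reg 2 = 1 := by rw [k2f _ (by omega), hB1'.reg2]
    refine Runs.seq (Q := fun T3 => T3 = T2.setReg (s + 2) (v + 1))
      (runs_arith (by
        rw [f2, f2']
        have := smallbit v (by omega)
        have := one_le_bitLength v
        simp; omega) (by simp [f2, f2', BinOp.eval])) ?_
    rintro _ rfl
    have g1 : (T2.setReg (s + 2) (v + 1)).reg (s + 1) = n := by
      rw [setReg_reg_ne _ _ (by omega), k2f _ (by omega), k1.frame _ (by omega), e1]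
    refine runs_arith (by
      rw [g1, setReg_reg_self]
      have := smallbit n hnsz
      have := smallbit (v + 1) (by omega)
      omega) ⟨?_, ?_, ?_, ?_, ?_, ?_⟩
    · rw [setReg_reg_ne _ _ (by omega), setReg_reg_ne _ _ (by omega), k2]
    · rw [setReg_reg_ne _ _ (by omega), g1]
    · rw [setReg_reg_ne _ _ (by omega), setReg_reg_self]
    · rw [setReg_reg_self, g1, setReg_reg_self]; rfl
    · intro r hr
      rw [setReg_reg_ne _ _ (by omega), setReg_reg_ne _ _ (by omega), k2f _ (by omega),
        k1.frame _ (by omega), hfr r hr]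
    · simp [k2m, k1.mem, hm]
  · rintro T ⟨-, -, -, e3, -⟩
    rw [e3]; omega
  · rw [Finset.sum_const, Finset.card_range, smul_eq_mul]
    have : n ≤ β := by omega
    gcongr
  · rintro T ⟨e0, -, -, -, hfr, hm⟩
    exact ⟨e0, hfr, hm⟩

/-- Evaluation of a list of expressions into consecutive registers. -/
theorem runs_args {w ρ : List ℕ} {β : ℕ} (hβ : Bounds w ρ β) (regs : List ℕ) (s : ℕ)
    (hs : 5 ≤ s) (hlt : ∀ r ∈ regs, r < s) :
    ∀ (m : ℕ) (args : Fin m → Expr) (p q : Fin m → Polynomial ℕ),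
      (∀ i, (args i).Good (p i) (q i)) → ∀ (d : ℕ) (S : Config), Base w S →
      regs.map S.reg = ρ →
      Runs ((List.ofFn fun i : Fin m => (args i).comp regs (s + d + i)).foldr .seq .skip) S
        (∑ i, (p i).eval β + 1)
        (fun S' => (∀ i : Fin m, S'.reg (s + d + i) = (args i).eval w ρ) ∧
          (∀ r < s + d, S'.reg r = S.reg r) ∧ S'.mem = S.mem) := by
  intro m
  induction m with
  | zero =>
    intro args p q _ d S _ _
    simpa using runs_skip (S := S) (Q := fun S' =>
      (∀ r < s + d, S'.reg r = S.reg r) ∧ S'.mem = S.mem) ⟨fun _ _ => rfl, rfl⟩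
  | succ m ih =>
    intro args p q hg d S hB hρ
    rw [List.ofFn_succ, List.foldr_cons, Fin.sum_univ_succ,
      add_assoc ((p 0).eval β)]
    obtain ⟨-, c0⟩ := hg 0 w ρ β hβ
    refine Runs.seq (c0 regs (s + d + (0 : Fin (m + 1))) S hB (by simp; omega)
      (fun r hr => by have := hlt r hr; simp; omega) hρ) fun S1 h1 => ?_
    have hfr : ∀ r < s + d, S1.reg r = S.reg r := fun r hr => h1.frame r (by simpa using hr)
    have hρ1 : regs.map S1.reg = ρ := by
      rw [map_reg_congr hlt fun r hr => hfr r (by omega), hρ]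
    have := ih (fun i => args i.succ) (fun i => p i.succ) (fun i => q i.succ)
      (fun i => hg i.succ) (d + 1) S1 (hB.of_frame (by omega) hfr h1.mem) hρ1
    have e : ∀ i : Fin m, s + (d + 1) + (i : ℕ) = s + d + (i.succ : Fin (m + 1)) := fun i => by
      simp; omega
    simp only [e] at this
    refine this.mono le_rfl ?_
    rintro S2 ⟨k1, k2, k3⟩
    refine ⟨fun i => ?_, fun r hr => by rw [k2 r (by omega), hfr r hr], k3.trans h1.mem⟩
    cases i using Fin.cases with
    | zero => rw [k2 _ (by simp), h1.val]
    | succ i => exact k1 i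

theorem good_call {m : ℕ} {args : Fin m → Expr} {f : Expr} {p q : Fin m → Polynomial ℕ}
    {p' q' : Polynomial ℕ} (hargs : ∀ i, (args i).Good (p i) (q i)) (hf : f.Good p' q') :
    (Expr.call m args f).Good
      ((∑ i, p i + 1) + (p'.comp (Polynomial.X + ∑ i, q i) +
        (q'.comp (Polynomial.X + ∑ i, q i) + 1)))
      (q'.comp (Polynomial.X + ∑ i, q i)) := by
  intro w ρ β hβ
  have hsum : ∀ i, (q i).eval β ≤ ∑ i, (q i).eval β := fun i =>
    Finset.single_le_sum (f := fun i => (q i).eval β) (fun _ _ => Nat.zero_le _)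
      (Finset.mem_univ i)
  have hb : Bounds w (List.ofFn fun i => (args i).eval w ρ) (β + ∑ i, (q i).eval β) := by
    refine ⟨by have := hβ.size_lt; omega, fun x hx => ?_⟩
    obtain ⟨i, rfl⟩ := List.mem_ofFn.1 hx
    have := (hargs i w ρ β hβ).1
    have := hsum i
    omega
  obtain ⟨qf, cf⟩ := hf w _ _ hb
  refine ⟨by simpa [Expr.eval, Polynomial.eval_finsetSum] using qf, ?_⟩
  intro regs s S hB hs hlt hρ
  simp only [Polynomial.eval_add, Polynomial.eval_X, Polynomial.eval_comp,
    Polynomial.eval_finsetSum, Polynomial.eval_one]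
  refine Runs.seq (runs_args hβ regs s hs hlt m args p q hargs 0 S hB hρ) ?_
  rintro S1 ⟨k1, k2, k3⟩
  simp only [add_zero] at k1 k2
  have hB1 := hB.of_frame (by omega) k2 k3
  refine Runs.seq (cf (List.ofFn fun i : Fin m => s + (i : ℕ)) (s + m) S1 hB1 (by omega) ?_ ?_)
    fun S2 h2 => ?_
  · intro r hr
    obtain ⟨i, rfl⟩ := List.mem_ofFn.1 hr
    have := i.2
    omega
  · rw [List.map_ofFn]
    congr 1
    funext i
    exact k1 i
  have hz : S2.reg 3 = 0 := by rw [h2.frame _ (by omega), hB1.reg3]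
  refine runs_arith (by rw [h2.val, hz]; simpa using qf) ⟨?_, ?_, ?_⟩
  · simp [h2.val, hz, BinOp.eval, Expr.eval]
  · intro r hr
    rw [setReg_reg_ne _ _ (by omega), h2.frame _ (by omega), k2 r hr]
  · simp [h2.mem, k3]

/-- Every expression is evaluated in polynomial time. -/
theorem Expr.exists_good (e : Expr) : ∃ p q, e.Good p q := by
  induction e with
  | var i => exact ⟨_, _, good_var i⟩
  | const c => exact ⟨_, _, good_const c⟩
  | op o a b iha ihb =>
    obtain ⟨_, _, ha⟩ := iha
    obtain ⟨_, _, hb⟩ := ihb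
    exact ⟨_, _, good_op ha hb⟩
  | inp a iha =>
    obtain ⟨_, _, ha⟩ := iha
    exact ⟨_, _, good_inp ha⟩
  | ite c a b ihc iha ihb =>
    obtain ⟨_, _, hc⟩ := ihc
    obtain ⟨_, _, ha⟩ := iha
    obtain ⟨_, _, hb⟩ := ihb
    exact ⟨_, _, good_ite hc ha hb⟩
  | fold N a f ihN iha ihf =>
    obtain ⟨_, _, hN⟩ := ihN
    obtain ⟨_, _, ha⟩ := iha
    obtain ⟨_, _, hf⟩ := ihf
    exact ⟨_, _, good_fold hN ha hf⟩
  | call m args f ihargs ihf =>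
    choose p q hargs using ihargs
    obtain ⟨_, _, hf⟩ := ihf
    exact ⟨_, _, good_call hargs hf⟩

/-! ### A language of programs that write a word -/

/-- Emitters describe words, given an input word and values of variables: the empty word, the
word with one entry, concatenation, and `loop N h b`, which for every `v < N` writes the value
of `h` and then the word of `b`, the number `v` being a new variable. That each round
writes an entry bounds the running time by the length of the output. -/
inductive Emitter where
  | nop
  | emit (e : Expr)
  | seq (a b : Emitter)
  | loop (N h : Expr) (b : Emitter)

/-- The word described by an emitter. -/
def Emitter.out (w : List ℕ) : Emitter → List ℕ → List ℕ
  | .nop, _ => []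
  | .emit e, ρ => [e.eval w ρ]
  | .seq a b, ρ => a.out w ρ ++ b.out w ρ
  | .loop N h b, ρ =>
      (List.range (N.eval w ρ)).flatMap fun v => h.eval w (ρ ++ [v]) :: b.out w (ρ ++ [v])

/-- Append register `s` to the output, which stands in array `1` and has its length in
register `4`. -/
def writeReg (s : ℕ) : Program := .seq (.store 1 4 s) (.arith .add 4 4 2)

/-- The program that writes the word described by an emitter. -/
def Emitter.comp : Emitter → List ℕ → ℕ → Program
  | .nop, _, _ => .skip
  | .emit e, regs, s => .seq (e.comp regs s) (writeReg s)
  | .seq a b, regs, s => .seq (a.comp regs s) (b.comp regs s)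
  | .loop N h b, regs, s =>
      .seq (N.comp regs s) <| .seq (.const (s + 1) 0) <| .seq (.arith .sub (s + 2) s (s + 1)) <|
      .loop (s + 2) <|
        .seq (h.comp (regs ++ [s + 1]) (s + 2)) <| .seq (writeReg (s + 2)) <|
        .seq (b.comp (regs ++ [s + 1]) (s + 2)) <|
        .seq (.arith .add (s + 1) (s + 1) 2) (.arith .sub (s + 2) s (s + 1))

/-- The word `o` has been written. -/
structure Written (o : List ℕ) (S : Config) : Prop where
  pos : S.reg 4 = o.length
  mem1 : ∀ i, S.mem 1 i = o.getD i 0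

/-- Nothing has changed but the output, the register for its length, and registers from `s`
on. -/
structure Frame (s : ℕ) (S S' : Config) : Prop where
  reg : ∀ r < s, r ≠ 4 → S'.reg r = S.reg r
  mem : ∀ A ≠ 1, S'.mem A = S.mem A

theorem Frame.refl (s : ℕ) (S : Config) : Frame s S S := ⟨fun _ _ _ => rfl, fun _ _ => rfl⟩

theorem Frame.trans {s s' : ℕ} {S S' S'' : Config} (h : Frame s S S') (h' : Frame s' S' S'')
    (hs : s ≤ s') : Frame s S S'' :=
  ⟨fun r hr h4 => (h'.reg r (by omega) h4).trans (h.reg r hr h4),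
    fun A hA => (h'.mem A hA).trans (h.mem A hA)⟩

theorem Frame.base {w : List ℕ} {s : ℕ} {S S' : Config} (h : Frame s S S') (hs : 5 ≤ s)
    (hB : Base w S) : Base w S' where
  reg0 := by rw [h.reg 0 (by omega) (by omega), hB.reg0]
  reg1 := by rw [h.reg 1 (by omega) (by omega), hB.reg1]
  reg2 := by rw [h.reg 2 (by omega) (by omega), hB.reg2]
  reg3 := by rw [h.reg 3 (by omega) (by omega), hB.reg3]
  mem0 := by rw [h.mem 0 (by omega)]; exact hB.mem0

theorem Frame.map_reg {s : ℕ} {S S' : Config} {regs : List ℕ} (h : Frame s S S')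
    (hlt : ∀ r ∈ regs, 5 ≤ r ∧ r < s) : regs.map S'.reg = regs.map S.reg :=
  List.map_congr_left fun r hr => h.reg r (hlt r hr).2 (by have := (hlt r hr).1; omega)

theorem Sets.frame' {s x : ℕ} {S S' : Config} (h : Sets s x S S') : Frame s S S' :=
  ⟨fun r hr _ => h.frame r hr, fun A _ => by rw [h.mem]⟩

theorem Sets.written {s x : ℕ} {S S' : Config} {o : List ℕ} (h : Sets s x S S') (hs : 5 ≤ s)
    (ho : Written o S) : Written o S' :=
  ⟨by rw [h.frame 4 (by omega), ho.pos], by rw [h.mem]; exact ho.mem1⟩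

theorem runs_writeReg {w o : List ℕ} {s β γ : ℕ} {S : Config} (hB : Base w S) (ho : Written o S)
    (hs : 5 ≤ s) (hpos : bitLength o.length ≤ β) (hx : bitLength (S.reg s) ≤ γ) :
    Runs (writeReg s) S ((β + γ) + (β + 1))
      (fun S' => Written (o ++ [S.reg s]) S' ∧ Frame s S S' ∧ S'.reg s = S.reg s) := by
  refine Runs.seq (Q := fun S' => S' = S.setMem 1 o.length (S.reg s))
    (runs_store (by rw [ho.pos]; omega) (by rw [ho.pos])) ?_
  rintro _ rfl
  refine runs_arith (by simp [ho.pos, hB.reg2, hpos]) ⟨⟨?_, ?_⟩, ⟨?_, ?_⟩, ?_⟩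
  · simp [ho.pos, hB.reg2, BinOp.eval]
  · intro i
    have := ho.mem1 i
    simp only [setReg_mem, Config.setMem, Function.update_self, Function.update_apply]
    rcases lt_trichotomy i o.length with h | h | h
    · rw [if_neg (by omega), this, List.getD_append _ _ _ _ h]
    · subst h; simp
    · rw [if_neg (by omega), this, List.getD_eq_default _ _ (by omega),
        List.getD_eq_default _ _ (by simp; omega)]
  · intro r _ h4
    rw [setReg_reg_ne _ _ h4, setMem_reg]
  · intro A hA
    simp [Config.setMem, hA]
  · rw [setReg_reg_ne _ _ (by omega), setMem_reg]

/-- The output has a length of polynomially many digits, and it is written in time polynomial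
in the input and linear in the length of the output. -/
def Emitter.Good (a : Emitter) (p q : Polynomial ℕ) : Prop :=
  ∀ (w ρ : List ℕ) (β : ℕ), Bounds w ρ β →
    bitLength (a.out w ρ).length ≤ q.eval β ∧
    ∀ (o regs : List ℕ) (s : ℕ) (S : Config), Base w S → Written o S → 5 ≤ s →
      (∀ r ∈ regs, 5 ≤ r ∧ r < s) → regs.map S.reg = ρ →
      bitLength (o.length + (a.out w ρ).length) ≤ β →
      Runs (a.comp regs s) S (p.eval β * (1 + (a.out w ρ).length))
        (fun S' => Written (o ++ a.out w ρ) S' ∧ Frame s S S')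

theorem Emitter.good_nop : Emitter.nop.Good 1 1 := by
  intro w ρ β hβ
  refine ⟨by simp [Emitter.out], ?_⟩
  intro o regs s S hB ho hs hlt hρ hpos
  simpa [Emitter.out, Emitter.comp] using runs_skip (S := S)
    (Q := fun S' => Written o S' ∧ Frame s S S') ⟨ho, Frame.refl s S⟩

theorem Emitter.good_emit {e : Expr} {p q : Polynomial ℕ} (he : e.Good p q) :
    (Emitter.emit e).Good (p + ((Polynomial.X + q) + (Polynomial.X + 1))) 1 := by
  intro w ρ β hβ
  obtain ⟨qe, ce⟩ := he w ρ β hβ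
  refine ⟨by simp [Emitter.out], ?_⟩
  intro o regs s S hB ho hs hlt hρ hpos
  refine Runs.mono (T := p.eval β + ((β + q.eval β) + (β + 1)))
    (Q := fun S' => Written (o ++ (Emitter.emit e).out w ρ) S' ∧ Frame s S S') ?_ ?_ fun _ h => h
  · refine (ce regs s S hB hs (fun r hr => (hlt r hr).2) hρ).seq fun S1 h1 => ?_
    refine (runs_writeReg (γ := q.eval β) (h1.frame'.base hs hB) (h1.written hs ho) hs
      ((bitLength_mono (Nat.le_add_right _ _)).trans hpos) (by rw [h1.val]; exact qe)).mono
      le_rfl ?_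
    rintro S2 ⟨h2, f2, -⟩
    rw [h1.val] at h2
    exact ⟨h2, h1.frame'.trans f2 le_rfl⟩
  · simp only [Emitter.out, Polynomial.eval_add, Polynomial.eval_X, Polynomial.eval_one,
      List.length_singleton]
    omega

theorem Emitter.good_seq {a b : Emitter} {p q p' q' : Polynomial ℕ} (ha : a.Good p q)
    (hb : b.Good p' q') : (Emitter.seq a b).Good (p + p') (q + q') := by
  intro w ρ β hβ
  obtain ⟨qa, ca⟩ := ha w ρ β hβ
  obtain ⟨qb, cb⟩ := hb w ρ β hβ
  have hlen : ((Emitter.seq a b).out w ρ).length = (a.out w ρ).length + (b.out w ρ).length := by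
    simp [Emitter.out]
  rw [hlen]
  refine ⟨?_, ?_⟩
  · simp only [Polynomial.eval_add]
    exact (bitLength_add _ _).trans (by omega)
  intro o regs s S hB ho hs hlt hρ hpos
  refine Runs.mono (T := p.eval β * (1 + (a.out w ρ).length) +
      p'.eval β * (1 + (b.out w ρ).length)) (Runs.seq
    (ca o regs s S hB ho hs hlt hρ ((bitLength_mono (by omega)).trans hpos))
    (R := fun S' => Written (o ++ (Emitter.seq a b).out w ρ) S' ∧ Frame s S S') ?_)
    ?_ fun S' h => h
  · rintro S1 ⟨h1, f1⟩
    refine (cb _ regs s S1 (f1.base hs hB) h1 hs hlt (by rw [f1.map_reg hlt, hρ]) ?_).mono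
      le_rfl ?_
    · simpa [add_assoc] using hpos
    · rintro S2 ⟨h2, f2⟩
      exact ⟨by simpa [Emitter.out] using h2, f1.trans f2 le_rfl⟩
  · simp only [Polynomial.eval_add]
    nlinarith [Nat.zero_le (p.eval β * (b.out w ρ).length),
      Nat.zero_le (p'.eval β * (a.out w ρ).length)]

theorem Emitter.good_loop {N h : Expr} {b : Emitter} {p q p' q' p'' q'' : Polynomial ℕ}
    (hN : N.Good p q) (hh : h.Good p' q') (hb : b.Good p'' q'') :
    (Emitter.loop N h b).Good
      (p + (1 + (q + 1)) + 1 + (3 * (Polynomial.X + q) + (p'.comp (Polynomial.X + q) + (((Polynomial.X + q) +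
        q'.comp (Polynomial.X + q)) + ((Polynomial.X + q) + 1)) + p''.comp (Polynomial.X + q) +
        (2 * (Polynomial.X + q) + 1))))
      (q + (q''.comp (Polynomial.X + q) + 1)) := by
  intro w ρ β hβ
  obtain ⟨qN, cN⟩ := hN w ρ β hβ
  set n := N.eval w ρ with hn
  set F : ℕ → List ℕ := fun v => h.eval w (ρ ++ [v]) :: b.out w (ρ ++ [v]) with hF
  set O : ℕ → List ℕ := fun v => (List.range v).flatMap F with hO
  have hout : (Emitter.loop N h b).out w ρ = O n := rfl
  have hOs : ∀ v, O (v + 1) = O v ++ F v := fun v => by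
    simp [hO, List.range_succ, List.flatMap_append]
  have hOlen : ∀ v, (O v).length = ∑ i ∈ Finset.range v, (1 + (b.out w (ρ ++ [i])).length) := by
    intro v
    induction v with
    | zero => simp [hO]
    | succ v ih => rw [hOs, List.length_append, ih, Finset.sum_range_succ]; simp [hF]; omega
  set γ := β + q.eval β with hγ
  have hbnd : ∀ v ≤ n, Bounds w (ρ ++ [v]) γ := by
    intro v hv
    refine ⟨by have := hβ.size_lt; omega, fun x hx => ?_⟩
    simp only [List.mem_append, List.mem_cons, List.not_mem_nil, or_false] at hx
    rcases hx with hx | rfl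
    · exact (hβ.vars x hx).trans (by omega)
    · exact (bitLength_mono hv).trans (by omega)
  rw [hout]
  refine ⟨?_, ?_⟩
  · have h1 : (O n).length ≤ n * 2 ^ (q''.eval γ) := by
      rw [hOlen]
      refine (Finset.sum_le_card_nsmul _ _ (2 ^ (q''.eval γ)) fun v hv => ?_).trans (by simp)
      have hv' := (hb w _ _ (hbnd v (Finset.mem_range.1 hv).le)).1
      have := lt_two_pow_bitLength (b.out w (ρ ++ [v])).length
      have h2 := Nat.pow_le_pow_right (n := 2) (by norm_num) hv'
      omega
    refine ((bitLength_mono h1).trans (bitLength_mul _ _)).trans ?_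
    rw [bitLength_two_pow]
    simp only [Polynomial.eval_add, Polynomial.eval_comp, Polynomial.eval_X,
      Polynomial.eval_one]
    rw [← hγ]
    omega
  intro o regs s S hB ho hs hlt hρ hpos
  have hlt' : ∀ r ∈ regs, r < s := fun r hr => (hlt r hr).2
  have hOmono : ∀ v ≤ n, (O v).length ≤ (O n).length := fun v hv => by
    rw [hOlen, hOlen]
    exact Finset.sum_le_sum_of_subset (Finset.range_mono hv)
  have hnb : ∀ v ≤ n, bitLength v ≤ γ := fun v hv => (bitLength_mono hv).trans (by omega)
  set A := p'.eval γ with hA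
  set B := q'.eval γ with hB'
  set D := p''.eval γ with hD
  -- the invariant of the loop
  let I : ℕ → Config → Prop := fun v S' =>
    Written (o ++ O v) S' ∧ Frame s S S' ∧ S'.reg s = n ∧ S'.reg (s + 1) = v ∧
      S'.reg (s + 2) = n - v
  refine Runs.mono (T := p.eval β + (1 + ((q.eval β + 1) + (∑ v ∈ Finset.range n, (γ + (A +
      (((γ + B) + (γ + 1)) + (D * (1 + (b.out w (ρ ++ [v])).length) + ((γ + 1) + (γ + γ)))))) +
      1)))) (Q := I n) ?_ ?_ ?_
  · refine (cN regs s S hB hs hlt' hρ).seq fun S1 h1 => ?_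
    refine Runs.seq (Q := Sets (s + 1) 0 S1) ((runs_const ⟨by simp,
        fun r hr => setReg_reg_ne _ _ (by omega), rfl⟩).mono (by simp) fun _ h => h)
      fun S2 h2 => ?_
    have e2 : S2.reg s = n := by rw [h2.frame _ (by omega), h1.val]
    refine Runs.seq (Q := Sets (s + 2) n S2) (runs_arith (by rw [e2, h2.val]; simpa using qN)
      ⟨by simp [e2, h2.val, BinOp.eval], fun r hr => setReg_reg_ne _ _ (by omega), rfl⟩)
      fun S3 h3 => ?_
    refine runs_loop I _ γ n ?_ ?_ S3 ?_
    · rintro v hv T ⟨hW, hfr, e0, e1, e2⟩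
      refine ⟨by omega, by rw [e2]; exact hnb _ (by omega), ?_⟩
      have hBT := hfr.base hs hB
      have hbv := hbnd v hv.le
      obtain ⟨qh, ch⟩ := hh w _ _ hbv
      obtain ⟨qb, cb⟩ := hb w _ _ hbv
      have hlt2 : ∀ r ∈ regs ++ [s + 1], 5 ≤ r ∧ r < s + 2 := by
        intro r hr
        simp only [List.mem_append, List.mem_cons, List.not_mem_nil, or_false] at hr
        rcases hr with hr | rfl
        · have := hlt r hr; omega
        · omega
      have hρT : (regs ++ [s + 1]).map T.reg = ρ ++ [v] := by
        rw [List.map_append, hfr.map_reg hlt, hρ]; simp [e1]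
      refine (ch (regs ++ [s + 1]) (s + 2) T hBT (by omega) (fun r hr => (hlt2 r hr).2)
        hρT).seq fun T1 k1 => ?_
      have hO1 := hOmono (v + 1) hv
      have hlen1 : (O (v + 1)).length = (O v).length + (1 + (b.out w (ρ ++ [v])).length) := by
        rw [hOs]; simp [hF]; omega
      refine Runs.seq (runs_writeReg (k1.frame'.base (by omega) hBT) (k1.written (by omega) hW)
        (by omega) (β := γ) (γ := B) ?_ (by rw [k1.val]; exact qh)) ?_
      · refine (bitLength_mono ?_).trans (hpos.trans (by omega : β ≤ γ))
        simp; omega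
      rintro T2 ⟨W2, f2, -⟩
      have f2' := k1.frame'.trans f2 le_rfl
      refine Runs.seq (cb _ (regs ++ [s + 1]) (s + 2) T2 (f2'.base (by omega) hBT) W2 (by omega)
        hlt2 (by rw [f2'.map_reg hlt2, hρT]) ?_) ?_
      · refine (bitLength_mono ?_).trans (hpos.trans (by omega : β ≤ γ))
        simp; omega
      rintro T3 ⟨W3, f3⟩
      have f3' := f2'.trans f3 le_rfl
      have hB3 := f3'.base (by omega) hBT
      have g1 : T3.reg (s + 1) = v := by rw [f3'.reg _ (by omega) (by omega), e1]
      refine Runs.seq (Q := Sets (s + 1) (v + 1) T3) (runs_arith (by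
        rw [g1, hB3.reg2]; have := hnb v hv.le; simpa) ⟨by simp [g1, hB3.reg2, BinOp.eval],
          fun r hr => setReg_reg_ne _ _ (by omega), rfl⟩) fun T4 h4 => ?_
      have g0 : T4.reg s = n := by
        rw [h4.frame _ (by omega), f3'.reg _ (by omega) (by omega), e0]
      have h5 : Sets (s + 2) (n - (v + 1)) T4 (T4.setReg (s + 2) (n - (v + 1))) :=
        ⟨by simp, fun r hr => setReg_reg_ne _ _ (by omega), rfl⟩
      refine runs_arith (by
        rw [g0, h4.val]
        have := hnb n le_rfl
        have := hnb (v + 1) hv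
        omega) ?_
      rw [g0, h4.val]
      refine ⟨?_, ?_, ?_, ?_, ?_⟩
      · have : o ++ O (v + 1) = o ++ O v ++ [T1.reg (s + 2)] ++ b.out w (ρ ++ [v]) := by
          rw [hOs, k1.val]; simp [hF]
        rw [this]
        exact h5.written (by omega) (h4.written (by omega) W3)
      · exact ((hfr.trans f3' (by omega)).trans h4.frame' (by omega)).trans h5.frame' (by omega)
      · exact (h5.frame s (by omega)).trans g0
      · exact (h5.frame (s + 1) (by omega)).trans h4.val
      · exact h5.val
    · rintro T ⟨-, -, -, -, e⟩
      rw [e]; omega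
    · refine ⟨?_, ?_, ?_, ?_, ?_⟩
      · have : o ++ O 0 = o := by simp [hO]
        rw [this]
        exact h3.written (by omega) (h2.written (by omega) (h1.written (by omega) ho))
      · exact (h1.frame'.trans h2.frame' (by omega)).trans h3.frame' (by omega)
      · rw [h3.frame _ (by omega), e2]
      · rw [h3.frame _ (by omega), h2.val]
      · rw [h3.val]; rfl
  · have hsum : ∑ v ∈ Finset.range n, (γ + (A +
      (((γ + B) + (γ + 1)) + (D * (1 + (b.out w (ρ ++ [v])).length) + ((γ + 1) + (γ + γ)))))) ≤
        (3 * γ + (A + ((γ + B) + (γ + 1)) + D + (2 * γ + 1))) * (O n).length := by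
      rw [hOlen, Finset.mul_sum]
      refine Finset.sum_le_sum fun v _ => ?_
      generalize (b.out w (ρ ++ [v])).length = l
      nlinarith [Nat.zero_le (γ * l), Nat.zero_le (A * l), Nat.zero_le (B * l)]
    simp only [Polynomial.eval_add, Polynomial.eval_mul, Polynomial.eval_comp,
      Polynomial.eval_X, Polynomial.eval_one, Polynomial.eval_ofNat]
    rw [← hγ, ← hA, ← hB', ← hD]
    generalize (O n).length = l at hsum ⊢
    generalize p.eval β = x, q.eval β = y at *
    refine (Nat.add_le_add_left (Nat.add_le_add_left (Nat.add_le_add_left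
      (Nat.add_le_add_right hsum 1) _) _) _).trans ?_
    generalize 3 * γ + (A + ((γ + B) + (γ + 1)) + D + (2 * γ + 1)) = z
    nlinarith [Nat.zero_le (x * l), Nat.zero_le (y * l)]
  · rintro T ⟨h1, h2, -⟩
    exact ⟨h1, h2⟩

/-- Every emitter is executed in polynomial time per entry of the output. -/
theorem Emitter.exists_good (a : Emitter) : ∃ p q, a.Good p q := by
  induction a with
  | nop => exact ⟨_, _, good_nop⟩
  | emit e =>
    obtain ⟨_, _, he⟩ := e.exists_good
    exact ⟨_, _, good_emit he⟩
  | seq a b iha ihb =>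
    obtain ⟨_, _, ha⟩ := iha
    obtain ⟨_, _, hb⟩ := ihb
    exact ⟨_, _, good_seq ha hb⟩
  | loop N h b ihb =>
    obtain ⟨_, _, hN⟩ := N.exists_good
    obtain ⟨_, _, hh⟩ := h.exists_good
    obtain ⟨_, _, hb⟩ := ihb
    exact ⟨_, _, good_loop hN hh hb⟩

/-! ### Reductions -/

/-- The program with its registers and arrays renamed. -/
def Program.rename (f g : ℕ → ℕ) : Program → Program
  | .skip => .skip
  | .const r v => .const (f r) v
  | .arith o r x y => .arith o (f r) (f x) (f y)
  | .load r A i => .load (f r) (g A) (f i)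
  | .store A i x => .store (g A) (f i) (f x)
  | .seq P Q => .seq (P.rename f g) (Q.rename f g)
  | .ite r P Q => .ite (f r) (P.rename f g) (Q.rename f g)
  | .loop r P => .loop (f r) (P.rename f g)

/-- `T` contains the configuration `S` in its renamed registers and arrays. -/
structure Embeds (f g : ℕ → ℕ) (S T : Config) : Prop where
  reg : ∀ r, T.reg (f r) = S.reg r
  mem : ∀ A i, T.mem (g A) i = S.mem A i

theorem Embeds.setReg {f g : ℕ → ℕ} (hf : f.Injective) {S T : Config} (h : Embeds f g S T)
    (r v : ℕ) : Embeds f g (S.setReg r v) (T.setReg (f r) v) where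
  reg r' := by simp [setReg_reg, hf.eq_iff, h.reg]
  mem := h.mem

theorem Embeds.setMem {f g : ℕ → ℕ} (hg : g.Injective) {S T : Config} (h : Embeds f g S T)
    (A i v : ℕ) : Embeds f g (S.setMem A i v) (T.setMem (g A) i v) where
  reg := h.reg
  mem A' i' := by
    simp only [Config.setMem, Function.update_apply, hg.eq_iff]
    split
    · simp only [Function.update_apply, h.mem]
    · exact h.mem _ _

/-- A renamed program does the same at the same cost, and leaves the other registers alone. -/
theorem Exec.rename {f g : ℕ → ℕ} (hf : f.Injective) (hg : g.Injective) {P : Program}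
    {S S' : Config} {t : ℕ} (h : Exec P S S' t) : ∀ T, Embeds f g S T →
    ∃ T', Exec (P.rename f g) T T' t ∧ Embeds f g S' T' ∧
      ∀ r, (∀ r', f r' ≠ r) → T'.reg r = T.reg r := by
  induction h with
  | skip S => exact fun T hT => ⟨T, .skip T, hT, fun _ _ => rfl⟩
  | const S r v =>
    exact fun T hT => ⟨_, .const T _ v, hT.setReg hf r v,
      fun r' hr => setReg_reg_ne _ _ (hr r).symm⟩
  | arith S o r x y =>
    intro T hT
    have := Exec.arith T o (f r) (f x) (f y)
    rw [hT.reg, hT.reg] at this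
    exact ⟨_, this, hT.setReg hf r _, fun r' hr => setReg_reg_ne _ _ (hr r).symm⟩
  | load S r A i =>
    intro T hT
    have := Exec.load T (f r) (g A) (f i)
    rw [hT.reg, hT.mem] at this
    exact ⟨_, this, hT.setReg hf r _, fun r' hr => setReg_reg_ne _ _ (hr r).symm⟩
  | store S A i x =>
    intro T hT
    have := Exec.store T (g A) (f i) (f x)
    rw [hT.reg, hT.reg] at this
    exact ⟨_, this, hT.setMem hg A _ _, fun _ _ => rfl⟩
  | seq _ _ ih ih' =>
    intro T hT
    obtain ⟨T', h1, h2, h3⟩ := ih T hT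
    obtain ⟨T'', h1', h2', h3'⟩ := ih' T' h2
    exact ⟨T'', .seq h1 h1', h2', fun r hr => (h3' r hr).trans (h3 r hr)⟩
  | ite_true hr _ ih =>
    intro T hT
    obtain ⟨T', h1, h2, h3⟩ := ih T hT
    rw [← hT.reg] at hr ⊢
    exact ⟨T', .ite_true hr h1, h2, h3⟩
  | ite_false hr _ ih =>
    intro T hT
    obtain ⟨T', h1, h2, h3⟩ := ih T hT
    rw [← hT.reg] at hr ⊢
    exact ⟨T', .ite_false hr h1, h2, h3⟩
  | loop_done hr =>
    intro T hT
    rw [← hT.reg] at hr ⊢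
    exact ⟨T, .loop_done hr, hT, fun _ _ => rfl⟩
  | loop_step hr _ _ ih ih' =>
    intro T hT
    obtain ⟨T', h1, h2, h3⟩ := ih T hT
    obtain ⟨T'', h1', h2', h3'⟩ := ih' T' h2
    rw [← hT.reg] at hr ⊢
    exact ⟨T'', .loop_step hr h1 h1', h2', fun r hr => (h3' r hr).trans (h3 r hr)⟩

/-- The program that computes the size `M` of the input word into register `0`, `2 ^ M` into
register `1`, and the constant `1` into register `2`. -/
def preamble : Program :=
  .seq (.const 2 1) <|
  .seq (.loop 0 <| .seq (.arith .sub 0 0 2) <| .seq (.load 6 0 0) <|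
    .seq (.arith .add 5 5 6) (.arith .add 5 5 2)) <|
  .seq (.arith .add 0 5 3) <| .seq (.const 1 1) <|
  .loop 5 <| .seq (.arith .add 1 1 1) (.arith .sub 5 5 2)

theorem runs_preamble (w : List ℕ) :
    Runs preamble (initial w) (20 * (size w + 2) ^ 2)
      (fun S => Base w S ∧ Written [] S ∧ S.mem = (initial w).mem) := by
  set M := size w with hM
  have hlen : w.length ≤ M := Nat.le_add_right _ _
  have hb : ∀ x ≤ M, bitLength x ≤ M + 1 := fun x hx => (bitLength_le_succ x).trans (by omega)
  have hc : ∀ x ≤ M, bitLength (2 ^ x) ≤ M + 1 := fun x hx => by rw [bitLength_two_pow]; omega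
  have hs : ∀ v, (w.drop v).sum ≤ w.sum := fun v => by
    conv_rhs => rw [← List.take_append_drop v w, List.sum_append]
    omega
  have hMd : M = w.length + w.sum := rfl
  let I : ℕ → Config → Prop := fun v S =>
    S.reg 0 = w.length - v ∧ S.reg 5 = v + (w.drop (w.length - v)).sum ∧ S.reg 2 = 1 ∧
      S.reg 3 = 0 ∧ S.reg 4 = 0 ∧ S.mem = (initial w).mem
  let J : ℕ → Config → Prop := fun v S =>
    S.reg 0 = M ∧ S.reg 1 = 2 ^ v ∧ S.reg 5 = M - v ∧ S.reg 2 = 1 ∧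
      S.reg 3 = 0 ∧ S.reg 4 = 0 ∧ S.mem = (initial w).mem
  refine Runs.mono (T := 1 + ((∑ v ∈ Finset.range w.length, ((M + 1) + ((M + 2) + ((2 * (M + 1)) +
    ((2 * (M + 1)) + (M + 2))))) + 1) + ((M + 2) + (1 + (∑ v ∈ Finset.range M, ((M + 1) +
    ((2 * (M + 1)) + (M + 2))) + 1))))) (Q := J M) ?_ ?_ ?_
  · refine Runs.seq (Q := I 0) ((runs_const ?_).mono (by simp) fun _ h => h) fun S1 h1 => ?_
    · simp [I, setReg_reg, initial]
    refine Runs.seq (Q := I w.length) (runs_loop I _ (M + 1) w.length ?_ ?_ S1 h1) ?_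
    · rintro v hv S ⟨e0, e5, e2, e3, e4, em⟩
      refine ⟨by omega, by rw [e0]; exact hb _ (by omega), ?_⟩
      refine Runs.seq (Q := fun T => T = S.setReg 0 (w.length - (v + 1))) (runs_arith (by
        rw [e0, e2]; have := hb (w.length - v) (by omega); simp; omega)
        (by rw [e0, e2]; rfl)) ?_
      rintro _ rfl
      have hi : w.length - (v + 1) < w.length := by omega
      set x := w[w.length - (v + 1)] with hx
      have hxM : x ≤ w.sum := List.single_le_sum (fun _ _ => Nat.zero_le _) x (List.getElem_mem hi)
      have hm : (S.setReg 0 (w.length - (v + 1))).mem 0 (w.length - (v + 1)) = x := by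
        rw [setReg_mem, em]
        simp [initial, hx, hi]
      have hdrop : w.drop (w.length - (v + 1)) = x :: w.drop (w.length - v) := by
        rw [List.drop_eq_getElem_cons hi]
        congr 2
        omega
      have hds : (w.drop (w.length - (v + 1))).sum = x + (w.drop (w.length - v)).sum := by
        rw [hdrop, List.sum_cons]
      have hd1 := hs (w.length - (v + 1))
      refine Runs.seq (Q := fun T => T = (S.setReg 0 (w.length - (v + 1))).setReg 6 x)
        (runs_load (by
          rw [setReg_reg_self, hm]
          have := hb (w.length - (v + 1)) (by omega)
          have := hb x (by omega)
          omega) (by rw [setReg_reg_self, hm])) ?_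
      rintro _ rfl
      refine Runs.seq (Q := fun T => T = ((S.setReg 0 (w.length - (v + 1))).setReg 6 x).setReg 5
        (v + (w.drop (w.length - (v + 1))).sum)) (runs_arith (by
          simp only [setReg_reg, e5]
          have := hb (v + (w.drop (w.length - v)).sum) (by omega)
          have := hb x (by omega)
          simp; omega) (by
          simp only [setReg_reg, e5, BinOp.eval]
          congr 1
          simp; omega)) ?_
      rintro _ rfl
      refine runs_arith (by
          simp only [setReg_reg, e2]
          have := hb (v + (w.drop (w.length - (v + 1))).sum) (by omega)
          simp; omega) ?_
      refine ⟨?_, ?_, ?_, ?_, ?_, ?_⟩ <;> simp [setReg_reg, e2, e3, e4, em, BinOp.eval]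
      omega
    · rintro S ⟨e, -⟩
      rw [e]; omega
    rintro S2 ⟨e0, e5, e2, e3, e4, em⟩
    have e5' : S2.reg 5 = M := by rw [e5]; simp [hMd]
    refine Runs.seq (Q := fun T => T = S2.setReg 0 M) (runs_arith (by
      rw [e5', e3]; have := hb M le_rfl; simp; omega) (by rw [e5', e3]; rfl)) ?_
    rintro _ rfl
    refine Runs.seq (Q := J 0) ((runs_const ?_).mono (by simp) fun _ h => h) fun S3 h3 => ?_
    · refine ⟨?_, ?_, ?_, ?_, ?_, ?_, ?_⟩ <;> simp [setReg_reg, e5', e2, e3, e4, em]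
    refine runs_loop J _ (M + 1) M ?_ ?_ S3 h3
    · rintro v hv S ⟨e0, e1, e5, e2, e3, e4, em⟩
      refine ⟨by omega, by rw [e5]; exact hb _ (by omega), ?_⟩
      refine Runs.seq (Q := fun T => T = S.setReg 1 (2 ^ (v + 1))) (runs_arith (by
        rw [e1]; have := hc v (by omega); omega) (by
          rw [e1]; simp only [BinOp.eval]; congr 1; rw [pow_succ]; omega)) ?_
      rintro _ rfl
      refine runs_arith (by
          simp only [setReg_reg, e2, e5]
          have := hb (M - v) (by omega)
          simp; omega) ?_
      refine ⟨?_, ?_, ?_, ?_, ?_, ?_, ?_⟩ <;>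
        simp [setReg_reg, e0, e2, e3, e4, e5, em, BinOp.eval]
      omega
    · rintro S ⟨-, -, e, -⟩
      rw [e]; omega
  · simp only [Finset.sum_const, Finset.card_range, smul_eq_mul]
    nlinarith
  · rintro S ⟨e0, e1, e5, e2, e3, e4, em⟩
    exact ⟨⟨e0, e1, e2, e3, fun i => by rw [em]; simp [initial]⟩,
      ⟨by simp [e4], fun i => by rw [em]; simp [initial]⟩, em⟩

/-- If an emitter translates instances of one problem into equivalent instances of another
problem, then an algorithm for the latter yields one for the former; the additional time is
polynomial in the size of the input word, per entry of the translated word. -/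
theorem Emitter.reduction (a : Emitter) : ∃ p : Polynomial ℕ, ∀ P : Program, ∃ R : Program,
    ∀ (w : List ℕ) (Yes : Prop) (T : ℝ), P.DecidesWithin (a.out w []) Yes T →
      R.DecidesWithin w Yes (T + p.eval (size w) * (1 + (a.out w []).length)) := by
  obtain ⟨p, q, hpq⟩ := a.exists_good
  refine ⟨20 * (Polynomial.X + 2) ^ 2 +
      (p.comp (Polynomial.X + 1 + q.comp (Polynomial.X + 1)) +
        (Polynomial.X + 1 + q.comp (Polynomial.X + 1) + 1) + 2), fun P => ?_⟩
  refine ⟨.seq ((Program.seq preamble (a.comp [] 5)).rename (fun r => 2 * r) id) <|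
    .seq (.arith .add 1 8 6) <| .seq (P.rename (fun r => 2 * r + 1) (fun A => A + 1))
      (.arith .add 0 1 6), ?_⟩
  rintro w Yes T ⟨S', t', hP, ht', hyes⟩
  set M := size w with hM
  set β := M + 1 + q.eval (M + 1) with hβ
  have hbnd1 : Bounds w [] (M + 1) := ⟨by omega, by simp⟩
  have hbnd : Bounds w [] β := ⟨by omega, by simp⟩
  have hq := (hpq w [] _ hbnd1).1
  have hrun : Runs (Program.seq preamble (a.comp [] 5)) (initial w)
      (20 * (M + 2) ^ 2 + p.eval β * (1 + (a.out w []).length))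
      (fun S => Base w S ∧ Written (a.out w []) S ∧ ∀ A ≠ 0, A ≠ 1 → S.mem A = fun _ => 0) := by
    refine (runs_preamble w).seq ?_
    rintro S1 ⟨hB, hW, hm⟩
    refine ((hpq w [] β hbnd).2 [] [] 5 S1 hB hW le_rfl (by simp) rfl
      (by simpa using hq.trans (by omega))).mono le_rfl ?_
    rintro S2 ⟨hW2, hfr⟩
    refine ⟨hfr.base le_rfl hB, by simpa using hW2, fun A hA0 hA1 => ?_⟩
    rw [hfr.mem A hA1, hm]
    funext i
    simp [initial, hA0]
  obtain ⟨S1, t1, hex1, ht1, hB1, hW1, hmem1⟩ := hrun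
  have hf2 : Function.Injective (fun r : ℕ => 2 * r) := fun a b h => by simpa using h
  have hf3 : Function.Injective (fun r : ℕ => 2 * r + 1) := fun a b h => by simpa using h
  have hg3 : Function.Injective (fun r : ℕ => r + 1) := fun a b h => by simpa using h
  have hemb : Embeds (fun r => 2 * r) id (initial w) (initial w) :=
    ⟨fun r => by simp [initial], fun _ _ => rfl⟩
  obtain ⟨T1, hex2, hemb1, hfr1⟩ := hex1.rename hf2 Function.injective_id _ hemb
  have e8 : T1.reg 8 = (a.out w []).length := by rw [← hW1.pos]; exact hemb1.reg 4
  have e6 : T1.reg 6 = 0 := by rw [← hB1.reg3]; exact hemb1.reg 3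
  have hex3 := Exec.arith T1 .add 1 8 6
  rw [e8, e6] at hex3
  set T2 := T1.setReg 1 (BinOp.add.eval (a.out w []).length 0) with hT2
  have hemb2 : Embeds (fun r => 2 * r + 1) (fun A => A + 1) (initial (a.out w [])) T2 := by
    refine ⟨fun r => ?_, fun A i => ?_⟩
    · rcases Nat.eq_zero_or_pos r with rfl | hr
      · simp [hT2, BinOp.eval, initial]
      · rw [hT2, setReg_reg_ne _ _ (by omega), hfr1 _ (fun r' => by omega)]
        simp [initial, hr.ne']
    · have h1 := hemb1.mem (A + 1) i
      simp only [id] at h1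
      rw [hT2, setReg_mem, h1]
      rcases Nat.eq_zero_or_pos A with rfl | hA
      · simp [initial, hW1.mem1]
      · simp [initial, hA.ne', hmem1 (A + 1) (by omega) (by omega)]
  obtain ⟨T3, hex4, hemb3, hfr3⟩ := hP.rename hf3 hg3 _ hemb2
  have e1 : T3.reg 1 = S'.reg 0 := hemb3.reg 0
  have e6' : T3.reg 6 = 0 := by
    rw [hfr3 6 (fun r' => by omega), hT2, setReg_reg_ne _ _ (by omega), e6]
  have hex5 := Exec.arith T3 .add 0 1 6
  rw [e1, e6'] at hex5
  have hbit : bitLength (S'.reg 0) = 1 := by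
    rcases hyes with h | h <;> simp [h.2]
  refine ⟨_, _, .seq hex2 (.seq hex3 (.seq hex4 hex5)), ?_, ?_⟩
  · have hlenb : bitLength (a.out w []).length ≤ β := hq.trans (by omega)
    have key : t1 + (bitLength (a.out w []).length + bitLength 0 +
        (bitLength (S'.reg 0) + bitLength 0)) ≤
        (20 * (M + 2) ^ 2 + (p.eval β + (β + 1) + 2)) * (1 + (a.out w []).length) := by
      rw [hbit, bitLength_zero]
      nlinarith [Nat.zero_le ((20 * (M + 2) ^ 2 + β) * (a.out w []).length)]
    have key' : ((t1 + (bitLength (a.out w []).length + bitLength 0 +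
        (bitLength (S'.reg 0) + bitLength 0)) : ℕ) : ℝ) ≤
        (((20 * (M + 2) ^ 2 + (p.eval β + (β + 1) + 2)) * (1 + (a.out w []).length) : ℕ) : ℝ) :=
      Nat.cast_le.2 key
    simp only [Polynomial.eval_add, Polynomial.eval_mul, Polynomial.eval_pow, Polynomial.eval_comp,
      Polynomial.eval_X, Polynomial.eval_one, Polynomial.eval_ofNat]
    rw [← hβ]
    push_cast at key' ⊢
    linarith
  · simpa [BinOp.eval, setReg_reg] using hyes

open Classical in
/-- The least `v < n` with `p v`, or `n` if there is none. -/
noncomputable def search (p : ℕ → Prop) (n : ℕ) : ℕ :=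
  iter (fun _ x => if p x then x else x + 1) 0 n

theorem search_spec (p : ℕ → Prop) (n : ℕ) :
    (∀ v < search p n, ¬ p v) ∧ (search p n = n ∨ (search p n < n ∧ p (search p n))) := by
  classical
  induction n with
  | zero => exact ⟨fun v hv => absurd hv (Nat.not_lt_zero v), Or.inl rfl⟩
  | succ n ih =>
    obtain ⟨h1, h2⟩ := ih
    have e : search p (n + 1) = if p (search p n) then search p n else search p n + 1 := rfl
    by_cases hp : p (search p n)
    · rw [e, if_pos hp]
      refine ⟨h1, Or.inr ⟨?_, hp⟩⟩
      rcases h2 with h2 | h2 <;> omega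
    · rw [e, if_neg hp]
      refine ⟨fun v hv => ?_, Or.inl ?_⟩
      · rcases Nat.lt_succ_iff_lt_or_eq.1 hv with h | rfl
        · exact h1 v h
        · exact hp
      · rcases h2 with h2 | h2
        · omega
        · exact absurd h2.2 hp

theorem search_le (p : ℕ → Prop) (n : ℕ) : search p n ≤ n := by
  rcases (search_spec p n).2 with h | h <;> omega

theorem search_le_of {p : ℕ → Prop} {n v : ℕ} (hp : p v) : search p n ≤ v := by
  by_contra h
  exact (search_spec p n).1 v (by omega) hp

theorem search_found {p : ℕ → Prop} {n v : ℕ} (hv : v < n) (hp : p v) :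
    search p n < n ∧ p (search p n) := by
  rcases (search_spec p n).2 with h | h
  · have := search_le_of (n := n) hp
    omega
  · exact h

/-! ### Colouring of intervals -/

/-- The rank of `x` among the numbers below `n` when they are ordered by `f`, ties being broken
by the numbers themselves. -/
noncomputable def rank (n : ℕ) (f : ℕ → ℕ) (x : ℕ) : ℕ :=
  Nat.count (fun y => f y * n + y < f x * n + x) n

section Rank

variable {n : ℕ} {f : ℕ → ℕ}

theorem key_lt_of_lt {x y : ℕ} (hx : x < n) (h : f x < f y) : f x * n + x < f y * n + y := by
  have : (f x + 1) * n ≤ f y * n := Nat.mul_le_mul_right n h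
  nlinarith

theorem le_of_key_lt {x y : ℕ} (hy : y < n) (h : f x * n + x < f y * n + y) : f x ≤ f y := by
  by_contra h'
  have := key_lt_of_lt (f := f) hy (not_le.1 h')
  omega

theorem key_inj {x y : ℕ} (hx : x < n) (hy : y < n) (h : f x * n + x = f y * n + y) : x = y := by
  rcases lt_trichotomy (f x) (f y) with h' | h' | h'
  · have := key_lt_of_lt (n := n) hx h'; omega
  · rw [h'] at h; omega
  · have := key_lt_of_lt (n := n) hy h'; omega

theorem rank_lt_rank {x y : ℕ} (hx : x < n) (h : f x * n + x < f y * n + y) :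
    rank n f x < rank n f y := by
  unfold rank
  rw [Nat.count_eq_card_filter_range, Nat.count_eq_card_filter_range]
  refine Finset.card_lt_card ⟨?_, fun hs => ?_⟩
  · intro z hz
    simp only [Finset.mem_filter] at hz ⊢
    exact ⟨hz.1, by omega⟩
  · have := hs (Finset.mem_filter.2 ⟨Finset.mem_range.2 hx, h⟩)
    simp at this

theorem rank_inj {x y : ℕ} (hx : x < n) (hy : y < n) (h : rank n f x = rank n f y) : x = y := by
  rcases lt_trichotomy (f x * n + x) (f y * n + y) with h' | h' | h'
  · have := rank_lt_rank hx h'; omega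
  · exact key_inj hx hy h'
  · have := rank_lt_rank hy h'; omega

theorem key_lt_of_rank_lt {x y : ℕ} (hy : y < n) (h : rank n f x < rank n f y) :
    f x * n + x < f y * n + y := by
  rcases lt_trichotomy (f x * n + x) (f y * n + y) with h' | h' | h'
  · exact h'
  · unfold rank at h; rw [h'] at h; omega
  · have := rank_lt_rank hy h'; omega

theorem rank_lt {x : ℕ} (hx : x < n) : rank n f x < n := by
  unfold rank
  rw [Nat.count_eq_card_filter_range]
  refine (Finset.card_lt_card (t := Finset.range n) ⟨Finset.filter_subset _ _, fun hs => ?_⟩).trans_eq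
    (Finset.card_range n)
  have := hs (Finset.mem_range.2 hx)
  simp at this

theorem exists_rank_eq {r : ℕ} (hr : r < n) : ∃ y < n, rank n f y = r := by
  have h := Finset.surj_on_of_inj_on_of_card_le (s := Finset.range n) (t := Finset.range n)
    (fun x _ => rank n f x) (fun x hx => Finset.mem_range.2 (rank_lt (Finset.mem_range.1 hx)))
    (fun x y hx hy h => rank_inj (Finset.mem_range.1 hx) (Finset.mem_range.1 hy) h) le_rfl r
    (Finset.mem_range.2 hr)
  obtain ⟨y, hy, h⟩ := h
  exact ⟨y, Finset.mem_range.1 hy, h.symm⟩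

end Rank

/-- Each of the numbers `x < n` stands for the interval from `left x` to `last x`. The intervals
are coloured greedily from left to right, and the colours that become free are reused in the order
in which they become free: if `x` is not among the first `W` intervals, then it inherits its
colour from the interval `y` whose rank by right ends is the rank of `x` by left ends minus `W`.
This function maps `x` to `y`. -/
noncomputable def ancestor (n W : ℕ) (left last : ℕ → ℕ) (x : ℕ) : ℕ :=
  if rank n left x < W then x else search (fun y => rank n last y = rank n left x - W) n

/-- The colour of an interval. -/
noncomputable def slot (n W : ℕ) (left last : ℕ → ℕ) (x : ℕ) : ℕ :=
  rank n left (iter (fun _ z => ancestor n W left last z) x n)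

section Slot

variable {n W : ℕ} {left last : ℕ → ℕ}

/-- The intervals are nonempty, and at most `W` of them meet in the left end of one of them. -/
structure Thin (n W : ℕ) (left last : ℕ → ℕ) : Prop where
  le : ∀ x < n, left x ≤ last x
  card : ∀ x < n, ((Finset.range n).filter fun y => left y ≤ left x ∧ left x ≤ last y).card ≤ W

theorem Thin.exists_ancestor (h : Thin n W left last) {x : ℕ} (hx : x < n)
    (hW : W ≤ rank n left x) :
    ∃ y < n, rank n last y = rank n left x - W ∧ last y < left x := by
  obtain ⟨y, hy, hr⟩ := exists_rank_eq (f := last) (r := rank n left x - W)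
    ((Nat.sub_le _ _).trans_lt (rank_lt hx))
  refine ⟨y, hy, hr, ?_⟩
  by_contra hc
  -- the intervals that end before `x` begins are among those of smaller rank than `y`
  have h1 : ((Finset.range n).filter fun z => last z < left x).card ≤ rank n last y := by
    unfold rank
    rw [Nat.count_eq_card_filter_range]
    refine Finset.card_le_card fun z hz => ?_
    simp only [Finset.mem_filter, Finset.mem_range] at hz ⊢
    exact ⟨hz.1, key_lt_of_lt hz.1 (by omega)⟩
  -- those that begin before `x` end before `x` begins, or they meet the left end of `x`
  have h2 : ((Finset.range n).filter fun z => left z * n + z < left x * n + x) ⊆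
      ((Finset.range n).filter fun z => last z < left x) ∪
      (((Finset.range n).filter fun z => left z ≤ left x ∧ left x ≤ last z).erase x) := by
    intro z hz
    simp only [Finset.mem_filter, Finset.mem_range, Finset.mem_union, Finset.mem_erase] at hz ⊢
    by_cases hzx : last z < left x
    · exact Or.inl ⟨hz.1, hzx⟩
    · refine Or.inr ⟨?_, hz.1, le_of_key_lt hx hz.2, by omega⟩
      rintro rfl
      omega
  have h3 := (Finset.card_le_card h2).trans (Finset.card_union_le _ _)
  have hmem : x ∈ (Finset.range n).filter fun z => left z ≤ left x ∧ left x ≤ last z :=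
    Finset.mem_filter.2 ⟨Finset.mem_range.2 hx, le_rfl, h.le x hx⟩
  rw [Finset.card_erase_of_mem hmem] at h3
  have h4 := h.card x hx
  have h5 : 0 < ((Finset.range n).filter fun z => left z ≤ left x ∧ left x ≤ last z).card :=
    Finset.card_pos.2 ⟨x, hmem⟩
  have h6 : rank n left x =
      ((Finset.range n).filter fun z => left z * n + z < left x * n + x).card :=
    Nat.count_eq_card_filter_range _ _
  omega

theorem Thin.ancestor_spec (h : Thin n W left last) {x : ℕ} (hx : x < n)
    (hW : W ≤ rank n left x) : ancestor n W left last x < n ∧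
      rank n last (ancestor n W left last x) = rank n left x - W ∧
      last (ancestor n W left last x) < left x ∧
      rank n left (ancestor n W left last x) < rank n left x := by
  obtain ⟨y, hy, hr, hl⟩ := h.exists_ancestor hx hW
  have e : ancestor n W left last x = y := by
    rw [ancestor, if_neg (by omega)]
    obtain ⟨h1, h2⟩ := search_found (p := fun y => rank n last y = rank n left x - W) hy hr
    exact rank_inj h1 hy (h2.trans hr.symm)
  rw [e]
  exact ⟨hy, hr, hl, rank_lt_rank hy (key_lt_of_lt hy ((h.le y hy).trans_lt hl))⟩

theorem iter_succ_left (g : ℕ → ℕ) (x m : ℕ) :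
    iter (fun _ z => g z) x (m + 1) = iter (fun _ z => g z) (g x) m := by
  induction m with
  | zero => rfl
  | succ m ih => rw [iter, ih, iter]

theorem ancestor_of_lt {x : ℕ} (hW : rank n left x < W) : ancestor n W left last x = x :=
  if_pos hW

theorem iter_ancestor_of_lt {x : ℕ} (hW : rank n left x < W) (m : ℕ) :
    iter (fun _ z => ancestor n W left last z) x m = x := by
  induction m with
  | zero => rfl
  | succ m ih => rw [iter_succ_left, ancestor_of_lt hW, ih]

theorem Thin.iter_lt (h : Thin n W left last) (m : ℕ) : ∀ x < n, rank n left x < W + m →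
    iter (fun _ z => ancestor n W left last z) x m < n ∧
    rank n left (iter (fun _ z => ancestor n W left last z) x m) < W := by
  induction m with
  | zero => exact fun x hx hr => ⟨hx, hr⟩
  | succ m ih =>
    intro x hx hr
    rw [iter_succ_left]
    by_cases hW : rank n left x < W
    · rw [ancestor_of_lt hW]
      exact ih x hx (by omega)
    · obtain ⟨h1, -, -, h4⟩ := h.ancestor_spec hx (not_lt.1 hW)
      exact ih _ h1 (by omega)

theorem Thin.slot_lt (h : Thin n W left last) {x : ℕ} (hx : x < n) :
    slot n W left last x < W :=
  (h.iter_lt n x hx (by have := rank_lt (f := left) hx; omega)).2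

theorem slot_of_lt {x : ℕ} (hW : rank n left x < W) : slot n W left last x = rank n left x := by
  rw [slot, iter_ancestor_of_lt hW]

theorem Thin.slot_ancestor (h : Thin n W left last) {x : ℕ} (hx : x < n)
    (hW : W ≤ rank n left x) :
    slot n W left last (ancestor n W left last x) = slot n W left last x := by
  obtain ⟨h1, -, -, h4⟩ := h.ancestor_spec hx hW
  have hfix := (h.iter_lt n _ h1 (by have := rank_lt (f := left) h1; omega)).2
  unfold slot
  conv_rhs => rw [← ancestor_of_lt (n := n) (W := W) (left := left) (last := last)
    (x := iter (fun _ z => ancestor n W left last z) x n)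
    (h.iter_lt n x hx (by have := rank_lt (f := left) hx; omega)).2]
  rw [← iter_succ_left]
  rfl

/-- Of two intervals of the same colour the one that begins earlier also ends before the other
begins, and it does not begin later than the ancestor of the other. -/
theorem Thin.slot_aux (h : Thin n W left last) (r : ℕ) : ∀ x < n, rank n left x = r →
    ∀ y < n, rank n left y < rank n left x → slot n W left last y = slot n W left last x →
      last y < left x ∧ W ≤ rank n left x ∧
        rank n left y ≤ rank n left (ancestor n W left last x) := by
  induction r using Nat.strong_induction_on with
  | _ r ih =>
    intro x hx hr y hy hyx hs
    have hxW : W ≤ rank n left x := by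
      by_contra hc
      rw [slot_of_lt (by omega), slot_of_lt (by omega)] at hs
      omega
    obtain ⟨h1, h2, h3, h4⟩ := h.ancestor_spec hx hxW
    have h5 := h.slot_ancestor hx hxW
    set z := ancestor n W left last x with hz
    have hyz : rank n left y ≤ rank n left z := by
      by_contra hc
      have hc' := not_le.1 hc
      obtain ⟨-, hyW, h6⟩ := ih (rank n left y) (by omega) y hy rfl z h1 hc' (by rw [h5, hs])
      obtain ⟨g1, g2, g3, g4⟩ := h.ancestor_spec hy hyW
      have g5 := h.slot_ancestor hy hyW
      set z' := ancestor n W left last y with hz'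
      have hF : rank n last z' < rank n last z := by omega
      have hne : z ≠ z' := fun e => by rw [e] at hF; omega
      have hlt : rank n left z < rank n left z' :=
        lt_of_le_of_ne h6 fun e => hne (rank_inj h1 g1 e)
      obtain ⟨k1, -, -⟩ := ih (rank n left z') (by omega) z' g1 rfl z h1 hlt (by rw [h5, g5, hs])
      have := le_of_key_lt h1 (key_lt_of_rank_lt h1 hF)
      have := h.le z' g1
      omega
    refine ⟨?_, hxW, hyz⟩
    rcases hyz.lt_or_eq with hlt | heq
    · obtain ⟨k1, -, -⟩ := ih (rank n left z) (by omega) z h1 rfl y hy hlt (by rw [h5, hs])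
      have := h.le z h1
      omega
    · rw [rank_inj hy h1 heq]
      exact h3

/-- Two intervals of the same colour are disjoint. -/
theorem Thin.disjoint (h : Thin n W left last) {x y : ℕ} (hx : x < n) (hy : y < n) (hne : x ≠ y)
    (hs : slot n W left last x = slot n W left last y) : last x < left y ∨ last y < left x := by
  rcases lt_trichotomy (rank n left x) (rank n left y) with h' | h' | h'
  · exact Or.inl (h.slot_aux _ y hy rfl x hx h' hs).1
  · exact absurd (rank_inj hx hy h') hne
  · exact Or.inr (h.slot_aux _ x hx rfl y hy h' hs.symm).1

end Slot

/-! ### Deterministic automata given by a transition function -/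

/-- The deterministic automaton with states below `N` whose transition function is `δ`. -/
def detFA (N start : ℕ) (hs : start < N) (acc : ℕ → Bool) (δ : ℕ → ℕ → ℕ)
    (hδ : ∀ q < N, ∀ a < 2, δ q a < N) : FA 2 N where
  start := ⟨start, hs⟩
  accept q := acc q
  arcs := (List.finRange N).flatMap fun q =>
    [(q, 0, ⟨δ q 0, hδ q q.2 0 (by norm_num)⟩), (q, 1, ⟨δ q 1, hδ q q.2 1 (by norm_num)⟩)]
  nodup := by
    rw [List.nodup_flatMap]
    refine ⟨fun q _ => by simp, (List.nodup_finRange N).pairwise_of_forall_ne ?_⟩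
    intro q _ q' _ hne
    simp only [Function.onFun, List.disjoint_left]
    intro x hx hx'
    simp only [List.mem_cons, List.not_mem_nil, or_false] at hx hx'
    rcases hx with rfl | rfl <;> rcases hx' with h | h <;> simp_all

section Det

variable {N start : ℕ} {hs : start < N} {acc : ℕ → Bool} {δ : ℕ → ℕ → ℕ}
  {hδ : ∀ q < N, ∀ a < 2, δ q a < N}

theorem mem_detFA_arcs (q r : Fin N) (a : Fin 2) :
    (q, a, r) ∈ (detFA N start hs acc δ hδ).arcs ↔ r.val = δ q a := by
  simp only [detFA, List.mem_flatMap, List.mem_finRange, true_and, List.mem_cons, Prod.mk.injEq,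
    List.not_mem_nil, or_false]
  constructor
  · rintro ⟨q', ⟨rfl, rfl, rfl⟩ | ⟨rfl, rfl, rfl⟩⟩ <;> rfl
  · intro h
    refine ⟨q, ?_⟩
    match a, h with
    | 0, h => exact Or.inl ⟨rfl, rfl, Fin.ext h⟩
    | 1, h => exact Or.inr ⟨rfl, rfl, Fin.ext h⟩

theorem detFA_isDFA : (detFA N start hs acc δ hδ).IsDFA := by
  intro q a
  refine ⟨⟨δ q a, hδ q q.2 a a.2⟩, (mem_detFA_arcs _ _ _).2 rfl, fun r hr => ?_⟩
  exact Fin.ext ((mem_detFA_arcs _ _ _).1 hr)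

theorem detFA_evalFrom (w : List (Fin 2)) (q : Fin N) (r : Fin N) :
    r ∈ (detFA N start hs acc δ hδ).toNFA.evalFrom {q} w ↔
      r.val = (w.map Fin.val).foldl δ q := by
  induction w generalizing q with
  | nil => simp [Fin.ext_iff]
  | cons a w ih =>
    have h : (detFA N start hs acc δ hδ).toNFA.stepSet {q} a =
        {(⟨δ q a, hδ q q.2 a a.2⟩ : Fin N)} := by
      ext r
      rw [NFA.stepSet_singleton]
      change (q, a, r) ∈ (detFA N start hs acc δ hδ).arcs ↔ _
      rw [mem_detFA_arcs]
      simp [Fin.ext_iff]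
    rw [NFA.evalFrom_cons, h, ih]
    simp

theorem mem_accepts_detFA (w : List (Fin 2)) :
    w ∈ (detFA N start hs acc δ hδ).toNFA.accepts ↔
      acc ((w.map Fin.val).foldl δ start) = true := by
  rw [NFA.mem_accepts]
  change (∃ r, (detFA N start hs acc δ hδ).accept r = true ∧
    r ∈ (detFA N start hs acc δ hδ).toNFA.evalFrom {⟨start, hs⟩} w) ↔ _
  simp only [detFA_evalFrom]
  constructor
  · rintro ⟨r, hr, h⟩
    rw [← h]
    exact hr
  · intro h
    have hlt : ∀ (u : List (Fin 2)) (q : ℕ), q < N → (u.map Fin.val).foldl δ q < N := by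
      intro u
      induction u with
      | nil => exact fun q hq => hq
      | cons a u ih => exact fun q hq => ih _ (hδ q hq a a.2)
    exact ⟨⟨_, hlt w start hs⟩, h, rfl⟩

end Det

/-! ### The automata of a formula with an interval representation -/

/-- Replace the binary digit number `b` of `x` by `a`. -/
def setBit (x b a : ℕ) : ℕ := x / 2 ^ (b + 1) * 2 ^ (b + 1) + a * 2 ^ b + x % 2 ^ b

theorem setBit_lt {x b a g : ℕ} (hx : x < 2 ^ g) (hb : b < g) (ha : a < 2) :
    setBit x b a < 2 ^ g := by
  obtain ⟨d, rfl⟩ : ∃ d, g = (b + 1) + d := ⟨g - (b + 1), by omega⟩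
  have h1 : x / 2 ^ (b + 1) < 2 ^ d := Nat.div_lt_of_lt_mul (by rwa [← pow_add])
  have h2 : x % 2 ^ b < 2 ^ b := Nat.mod_lt _ (by positivity)
  have h3 : (x / 2 ^ (b + 1) + 1) * 2 ^ (b + 1) ≤ 2 ^ d * 2 ^ (b + 1) :=
    Nat.mul_le_mul_right _ h1
  have h4 : 2 ^ (b + 1) = 2 * 2 ^ b := by rw [pow_succ]; ring
  have h5 : a * 2 ^ b ≤ 1 * 2 ^ b := Nat.mul_le_mul_right _ (by omega)
  unfold setBit
  rw [pow_add 2 (b + 1) d, mul_comm (2 ^ (b + 1)) (2 ^ d)]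
  nlinarith

theorem digit_setBit (x b a b' : ℕ) (ha : a < 2) :
    setBit x b a / 2 ^ b' % 2 = if b' = b then a else x / 2 ^ b' % 2 := by
  have key : ∀ y c : ℕ, y / 2 ^ c % 2 = (y.testBit c).toNat := fun y c => by
    rw [Nat.toNat_testBit]
  have h2 : x % 2 ^ b < 2 ^ b := Nat.mod_lt _ (by positivity)
  have e : setBit x b a = 2 ^ b * (2 * (x / 2 ^ (b + 1)) + a) + x % 2 ^ b := by
    unfold setBit; rw [pow_succ]; ring
  rw [key, key, e, Nat.testBit_two_pow_mul_add _ h2]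
  rcases lt_trichotomy b' b with h | rfl | h
  · rw [if_pos h, if_neg (by omega), Nat.testBit_mod_two_pow]
    simp [h]
  · rw [if_neg (by omega), if_pos rfl, Nat.sub_self, Nat.toNat_testBit]
    simp; omega
  · rw [if_neg (by omega), if_neg (by omega)]
    obtain ⟨d, rfl⟩ : ∃ d, b' = b + 1 + d := ⟨b' - (b + 1), by omega⟩
    have : b + 1 + d - b = d + 1 := by omega
    rw [this, Nat.testBit_add_one]
    have h3 : (2 * (x / 2 ^ (b + 1)) + a) / 2 = x / 2 ^ (b + 1) := by omega
    rw [h3, Nat.testBit_div_two_pow, add_comm d]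

/-- A formula whose variables are assigned to intervals of times below `J`, with the colours of
the intervals: clause `c < m` has `len c` literals, the literal number `l` being
`lvar c l = sgn c l`, and all its variables are alive at time `time c`. -/
structure Plan where
  (n m J : ℕ)
  (left last slot time len : ℕ → ℕ)
  (lvar sgn : ℕ → ℕ → ℕ)

namespace Plan

variable (P : Plan) (k g : ℕ)

/-- The number of letters read per time: one for each variable, then three for each clause. -/
def W : ℕ := P.n + 3 * P.m

/-- The number of letters read altogether. -/
def L : ℕ := P.J * P.W

/-- The state after reading `p` letters with the memory `mem` and the flag `fl`. -/
def enc (p mem fl : ℕ) : ℕ := (p * 2 ^ g + mem) * 2 + fl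

/-- The rejecting state, which comes after all other states. -/
def dead : ℕ := (P.L + 1) * 2 ^ g * 2

open Classical in
/-- The transition function of the automaton number `i` out of `k`. This automaton remembers the
values of those living variables whose colour is `i` modulo `k`. A letter read for a variable at the
time when it begins to live is its value. A letter `1` read for a literal claims that this
literal is true; the automaton that remembers the variable checks the claim. The flag
records whether such a claim has been made for the present clause. -/
noncomputable def step (i q a : ℕ) : ℕ :=
  if P.L ≤ q / 2 / 2 ^ g then P.dead g
  else if q / 2 / 2 ^ g % P.W < P.n then
    enc g (q / 2 / 2 ^ g + 1)
      (if P.left (q / 2 / 2 ^ g % P.W) = q / 2 / 2 ^ g / P.W ∧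
          P.slot (q / 2 / 2 ^ g % P.W) % k = i then
        setBit (q / 2 % 2 ^ g) (P.slot (q / 2 / 2 ^ g % P.W) / k) a
      else q / 2 % 2 ^ g) (q % 2)
  else
    let c := (q / 2 / 2 ^ g % P.W - P.n) / 3
    let l := (q / 2 / 2 ^ g % P.W - P.n) % 3
    let fl := if P.time c = q / 2 / 2 ^ g / P.W ∧ l < P.len c ∧ a = 1 then 1
      else if l = 0 then 0 else q % 2
    if (P.time c = q / 2 / 2 ^ g / P.W ∧ l < P.len c ∧ a = 1 ∧ P.slot (P.lvar c l) % k = i ∧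
        q / 2 % 2 ^ g / 2 ^ (P.slot (P.lvar c l) / k) % 2 ≠ P.sgn c l) ∨
      (P.time c = q / 2 / 2 ^ g / P.W ∧ l = 2 ∧ fl = 0) then P.dead g
    else enc g (q / 2 / 2 ^ g + 1) (q / 2 % 2 ^ g) fl

/-- The conditions under which the automata work as intended. -/
structure Valid : Prop where
  kpos : 0 < k
  left_lt : ∀ x < P.n, P.left x < P.J
  slot_lt : ∀ x < P.n, P.slot x / k < g
  disj : ∀ x < P.n, ∀ y < P.n, x ≠ y → P.slot x = P.slot y →
    P.last x < P.left y ∨ P.last y < P.left x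
  le : ∀ x < P.n, P.left x ≤ P.last x
  time_lt : ∀ c < P.m, P.time c < P.J
  len_le : ∀ c < P.m, P.len c ≤ 3
  lvar_lt : ∀ c < P.m, ∀ l < P.len c, P.lvar c l < P.n
  left_le : ∀ c < P.m, ∀ l < P.len c, P.left (P.lvar c l) ≤ P.time c
  le_last : ∀ c < P.m, ∀ l < P.len c, P.time c ≤ P.last (P.lvar c l)

variable {P k g}

theorem enc_div {p mem fl : ℕ} (hm : mem < 2 ^ g) (hf : fl < 2) :
    enc g p mem fl / 2 / 2 ^ g = p := by
  have h1 : enc g p mem fl / 2 = p * 2 ^ g + mem := by unfold enc; omega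
  rw [h1, mul_comm, Nat.mul_add_div (by positivity), Nat.div_eq_of_lt hm, add_zero]

theorem enc_mem {p mem fl : ℕ} (hm : mem < 2 ^ g) (hf : fl < 2) :
    enc g p mem fl / 2 % 2 ^ g = mem := by
  have h1 : enc g p mem fl / 2 = p * 2 ^ g + mem := by unfold enc; omega
  rw [h1, mul_comm, Nat.mul_add_mod, Nat.mod_eq_of_lt hm]

theorem enc_flag {p mem fl : ℕ} (hf : fl < 2) : enc g p mem fl % 2 = fl := by
  unfold enc; omega

theorem enc_lt_dead {p mem fl : ℕ} (hp : p ≤ P.L) (hm : mem < 2 ^ g) (hf : fl < 2) :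
    enc g p mem fl < P.dead g := by
  unfold enc dead
  have : (p + 1) * 2 ^ g ≤ (P.L + 1) * 2 ^ g := Nat.mul_le_mul_right _ (by omega)
  nlinarith

theorem dead_div : P.dead g / 2 / 2 ^ g = P.L + 1 := by
  unfold dead
  rw [Nat.mul_div_cancel _ (by norm_num), Nat.mul_div_cancel _ (by positivity)]

theorem step_dead (i a : ℕ) : P.step k g i (P.dead g) a = P.dead g := by
  rw [step, if_pos (by rw [dead_div]; omega)]

theorem pos_inj {W a b x y : ℕ} (hx : x < W) (hy : y < W) (h : a * W + x = b * W + y) :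
    a = b ∧ x = y := by
  have h1 : (a * W + x) / W = a := by
    rw [mul_comm, Nat.mul_add_div (by omega), Nat.div_eq_of_lt hx, add_zero]
  have h2 : (b * W + y) / W = b := by
    rw [mul_comm, Nat.mul_add_div (by omega), Nat.div_eq_of_lt hy, add_zero]
  have h3 : a = b := by rw [← h1, h, h2]
  subst h3
  exact ⟨rfl, by omega⟩

variable (P k g)

/-- The position of the letter for the literal number `l` of clause `c`. -/
def litPos (c l : ℕ) : ℕ := P.time c * P.W + (P.n + 3 * c + l)

/-- The position of the letter for the value of variable `x`. -/
def varPos (x : ℕ) : ℕ := P.left x * P.W + x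

/-- In the string `b`, the letter number `t` makes the automaton `i` reject: it is a claim about a
literal that is false, or it is the last letter for a clause and no claim has been made. -/
def Bad (i : ℕ) (b : ℕ → ℕ) (t : ℕ) : Prop :=
  ∃ c < P.m, ∃ l < 3, t = P.litPos c l ∧
    ((l < P.len c ∧ b t = 1 ∧ P.slot (P.lvar c l) % k = i ∧
        b (P.varPos (P.lvar c l)) ≠ P.sgn c l) ∨
      (l = 2 ∧ ¬ ∃ l' < 3, l' < P.len c ∧ b (P.litPos c l') = 1))

/-- The state of the automaton `i` after `t` letters of the string `b`, none of which made it
reject. -/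
def Inv (i : ℕ) (b : ℕ → ℕ) (t q : ℕ) : Prop :=
  ∃ mem fl, q = enc g t mem fl ∧ mem < 2 ^ g ∧ fl < 2 ∧
    (∀ x < P.n, P.slot x % k = i → P.varPos x < t → t ≤ (P.last x + 1) * P.W →
      mem / 2 ^ (P.slot x / k) % 2 = b (P.varPos x)) ∧
    (∀ c < P.m, ∀ l < 3, 0 < l → t = P.litPos c l →
      (fl = 1 ↔ ∃ l' < l, l' < P.len c ∧ b (P.litPos c l') = 1))

variable {P k g}

theorem Valid.step_spec (hP : P.Valid k g) {i t q : ℕ} {b : ℕ → ℕ} (hb : ∀ t, b t < 2)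
    (ht : t < P.L) (hq : P.Inv k g i b t q) :
    (P.Bad k i b t ∧ P.step k g i q (b t) = P.dead g) ∨
      (¬ P.Bad k i b t ∧ P.Inv k g i b (t + 1) (P.step k g i q (b t))) := by
  obtain ⟨mem, fl, rfl, hm, hf, hI, hF⟩ := hq
  have hWpos : 0 < P.W := by
    by_contra h
    have h0 : P.W = 0 := by omega
    simp [L, h0] at ht
  have hWdef : P.W = P.n + 3 * P.m := rfl
  set j := t / P.W with hj
  set r := t % P.W with hr
  have hrW : r < P.W := Nat.mod_lt _ hWpos
  have htj : t = j * P.W + r := by rw [mul_comm]; exact (Nat.div_add_mod t P.W).symm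
  unfold step
  rw [enc_div hm hf, enc_mem hm hf, enc_flag hf, ← hj, ← hr, if_neg (not_le.2 ht)]
  by_cases hrn : r < P.n
  · right
    rw [if_pos hrn]
    have hnl : ∀ c < P.m, ∀ l < 3, t ≠ P.litPos c l := by
      intro c hc l hl h
      have := (pos_inj hrW (by omega) (htj.symm.trans h)).2
      omega
    refine ⟨fun ⟨c, hc, l, hl, h, _⟩ => hnl c hc l hl h, ?_⟩
    have hF' : ∀ c < P.m, ∀ l < 3, 0 < l → t + 1 = P.litPos c l →
        (fl = 1 ↔ ∃ l' < l, l' < P.len c ∧ b (P.litPos c l') = 1) := by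
      intro c hc l hl hl0 h
      refine absurd (a := t = P.litPos c (l - 1)) ?_ (hnl c hc (l - 1) (by omega))
      unfold litPos at h ⊢
      omega
    by_cases hc : P.left r = j ∧ P.slot r % k = i
    · rw [if_pos hc]
      have hvr : P.varPos r = t := by rw [varPos, hc.1]; exact htj.symm
      refine ⟨_, _, rfl, setBit_lt hm (hP.slot_lt r hrn) (hb t), hf, ?_, hF'⟩
      intro x hx hxi hxt hxl
      rw [digit_setBit _ _ _ _ (hb t)]
      by_cases hxr : x = r
      · subst hxr
        rw [if_pos rfl, hvr]
      · have hxt' : P.varPos x ≠ t := fun h =>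
          hxr (pos_inj (W := P.W) (by omega) hrW (h.trans htj)).2
        rw [if_neg]
        · exact hI x hx hxi (by omega) (by omega)
        · intro h
          have hs : P.slot x = P.slot r := by
            rw [← Nat.div_add_mod (P.slot x) k, ← Nat.div_add_mod (P.slot r) k, h, hxi, hc.2]
          rcases hP.disj x hx r hrn hxr hs with h' | h'
          · have : (P.last x + 1) * P.W ≤ j * P.W := Nat.mul_le_mul_right _ (by omega)
            omega
          · have h1 := hP.le r hrn
            have : (j + 1) * P.W ≤ P.left x * P.W := Nat.mul_le_mul_right _ (by omega)
            unfold varPos at hxt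
            rw [add_mul] at this
            omega
    · rw [if_neg hc]
      refine ⟨_, _, rfl, hm, hf, ?_, hF'⟩
      intro x hx hxi hxt hxl
      have hxt' : P.varPos x ≠ t := by
        intro h
        obtain ⟨h1, h2⟩ := pos_inj (W := P.W) (by omega) hrW (h.trans htj)
        subst h2
        exact hc ⟨h1, hxi⟩
      exact hI x hx hxi (by omega) (by omega)
  · rw [if_neg hrn]
    obtain ⟨c, l, hl, hrc⟩ : ∃ c l, l < 3 ∧ r = P.n + 3 * c + l :=
      ⟨(r - P.n) / 3, (r - P.n) % 3, by omega, by omega⟩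
    have hcm : c < P.m := by omega
    have e1 : (r - P.n) / 3 = c := by omega
    have e2 : (r - P.n) % 3 = l := by omega
    rw [e1, e2]
    simp only
    have hnv : ∀ x < P.n, P.varPos x ≠ t := by
      intro x hx h
      have := (pos_inj (W := P.W) (by omega) hrW (h.trans htj)).2
      omega
    have huniq : ∀ c' < P.m, ∀ l' < 3, t = P.litPos c' l' → c' = c ∧ l' = l ∧ P.time c = j := by
      intro c' hc' l' hl' h
      obtain ⟨h1, h2⟩ := pos_inj hrW (by omega) (htj.symm.trans h)
      have : c' = c := by omega
      subst this
      exact ⟨rfl, by omega, h1.symm⟩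
    have hI' : ∀ x < P.n, P.slot x % k = i → P.varPos x < t + 1 → t + 1 ≤ (P.last x + 1) * P.W →
        mem / 2 ^ (P.slot x / k) % 2 = b (P.varPos x) := by
      intro x hx hxi hxt hxl
      have := hnv x hx
      exact hI x hx hxi (by omega) (by omega)
    by_cases htime : P.time c = j
    · have htl : t = P.litPos c l := by rw [litPos, htime, ← hrc]; exact htj
      have hprev : ∀ l', P.litPos c l' = t - l + l' := fun l' => by
        rw [htl]; unfold litPos; omega
      set fl' := (if P.time c = j ∧ l < P.len c ∧ b t = 1 then 1
        else if l = 0 then 0 else fl) with hfl'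
      have hfl'2 : fl' < 2 := by
        rw [hfl']; split
        · norm_num
        · split <;> omega
      have hiff : fl' = 1 ↔ ∃ l' < l + 1, l' < P.len c ∧ b (P.litPos c l') = 1 := by
        have hsplit : (∃ l' < l + 1, l' < P.len c ∧ b (P.litPos c l') = 1) ↔
            (∃ l' < l, l' < P.len c ∧ b (P.litPos c l') = 1) ∨ (l < P.len c ∧ b t = 1) := by
          constructor
          · rintro ⟨l', h1, h2, h3⟩
            rcases Nat.lt_succ_iff_lt_or_eq.1 h1 with h | rfl
            · exact Or.inl ⟨l', h, h2, h3⟩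
            · exact Or.inr ⟨h2, by rw [htl]; exact h3⟩
          · rintro (⟨l', h1, h2, h3⟩ | ⟨h2, h3⟩)
            · exact ⟨l', by omega, h2, h3⟩
            · exact ⟨l, by omega, h2, by rw [← htl]; exact h3⟩
        rw [hsplit, hfl']
        by_cases h1 : l < P.len c ∧ b t = 1
        · rw [if_pos ⟨htime, h1⟩]
          exact ⟨fun _ => Or.inr h1, fun _ => rfl⟩
        · rw [if_neg fun h => h1 h.2]
          rcases Nat.eq_zero_or_pos l with h0 | h0
          · rw [if_pos h0]
            constructor
            · intro h; omega
            · rintro (⟨l', h2, -⟩ | h)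
              · omega
              · exact absurd h h1
          · rw [if_neg (by omega), hF c hcm l hl h0 htl]
            exact ⟨Or.inl, fun h => h.resolve_right h1⟩
      -- the stored value of the variable of the literal is the announced one
      have hval : ∀ _ : l < P.len c, P.slot (P.lvar c l) % k = i →
          mem / 2 ^ (P.slot (P.lvar c l) / k) % 2 = b (P.varPos (P.lvar c l)) := by
        intro hlen hi
        have hx := hP.lvar_lt c hcm l hlen
        have hl1 := hP.left_le c hcm l hlen
        have hl2 := hP.le_last c hcm l hlen
        rw [htime] at hl1 hl2
        refine hI _ hx hi ?_ ?_
        · have : P.left (P.lvar c l) * P.W ≤ j * P.W := Nat.mul_le_mul_right _ hl1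
          unfold varPos
          omega
        · have : (j + 1) * P.W ≤ (P.last (P.lvar c l) + 1) * P.W :=
            Nat.mul_le_mul_right _ (by omega)
          rw [add_mul] at this
          omega
      have hbad : P.Bad k i b t ↔ ((P.time c = j ∧ l < P.len c ∧ b t = 1 ∧
          P.slot (P.lvar c l) % k = i ∧
          mem / 2 ^ (P.slot (P.lvar c l) / k) % 2 ≠ P.sgn c l) ∨
          (P.time c = j ∧ l = 2 ∧ fl' = 0)) := by
        constructor
        · rintro ⟨c', hc', l', hl', h, h'⟩
          obtain ⟨rfl, rfl, -⟩ := huniq c' hc' l' hl' h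
          rcases h' with ⟨h1, h2, h3, h4⟩ | ⟨h1, h2⟩
          · exact Or.inl ⟨htime, h1, h2, h3, by rw [hval h1 h3]; exact h4⟩
          · refine Or.inr ⟨htime, h1, ?_⟩
            subst h1
            have := mt hiff.1 h2
            omega
        · rintro (⟨-, h1, h2, h3, h4⟩ | ⟨-, h1, h2⟩)
          · exact ⟨c, hcm, l, hl, htl, Or.inl ⟨h1, h2, h3, by rw [← hval h1 h3]; exact h4⟩⟩
          · subst h1
            exact ⟨c, hcm, 2, hl, htl, Or.inr ⟨rfl, fun h => by have := hiff.2 h; omega⟩⟩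
      by_cases hB : P.Bad k i b t
      · exact Or.inl ⟨hB, if_pos (hbad.1 hB)⟩
      · refine Or.inr ⟨hB, ?_⟩
        rw [if_neg fun h => hB (hbad.2 h)]
        refine ⟨mem, fl', rfl, hm, hfl'2, hI', ?_⟩
        intro c' hc' l' hl' hl0 h
        have h' : t = P.litPos c' (l' - 1) := by
          unfold litPos at h ⊢; omega
        obtain ⟨rfl, h2, -⟩ := huniq c' hc' (l' - 1) (by omega) h'
        have : l' = l + 1 := by omega
        subst this
        exact hiff
    · right
      have hnl : ∀ c' < P.m, ∀ l' < 3, t ≠ P.litPos c' l' := fun c' hc' l' hl' h =>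
        htime (huniq c' hc' l' hl' h).2.2
      refine ⟨fun ⟨c', hc', l', hl', h, _⟩ => hnl c' hc' l' hl' h, ?_⟩
      rw [if_neg (by rintro (⟨h, -⟩ | ⟨h, -⟩) <;> exact htime h), if_neg fun h => htime h.1]
      refine ⟨_, _, rfl, hm, ?_, hI', ?_⟩
      · split <;> omega
      · intro c' hc' l' hl' hl0 h
        refine absurd (a := t = P.litPos c' (l' - 1)) ?_ (hnl c' hc' (l' - 1) (by omega))
        unfold litPos at h ⊢
        omega

/-- The state of the automaton `i` after `t` letters of the string `b`. -/
noncomputable def run (P : Plan) (k g i : ℕ) (b : ℕ → ℕ) : ℕ → ℕ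
  | 0 => 0
  | t + 1 => P.step k g i (run P k g i b t) (b t)

theorem Valid.run_spec (hP : P.Valid k g) (i : ℕ) {b : ℕ → ℕ} (hb : ∀ t, b t < 2) {t : ℕ}
    (ht : t ≤ P.L) : ((∃ t' < t, P.Bad k i b t') ∧ P.run k g i b t = P.dead g) ∨
      ((∀ t' < t, ¬ P.Bad k i b t') ∧ P.Inv k g i b t (P.run k g i b t)) := by
  induction t with
  | zero =>
    refine Or.inr ⟨fun t' h => absurd h (Nat.not_lt_zero _), 0, 0, by simp [run, enc],
      by positivity, by norm_num, fun x _ _ h => absurd h (Nat.not_lt_zero _), ?_⟩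
    intro c _ l _ hl h
    unfold litPos at h
    omega
  | succ t ih =>
    rcases ih (by omega) with ⟨⟨t', h1, h2⟩, h3⟩ | ⟨h1, h2⟩
    · exact Or.inl ⟨⟨t', by omega, h2⟩, by rw [run, h3, step_dead]⟩
    · rcases hP.step_spec hb ht h2 with ⟨h3, h4⟩ | ⟨h3, h4⟩
      · exact Or.inl ⟨⟨t, by omega, h3⟩, h4⟩
      · refine Or.inr ⟨fun t' ht' => ?_, h4⟩
        rcases Nat.lt_succ_iff_lt_or_eq.1 ht' with h | rfl
        · exact h1 t' h
        · exact h3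

/-- The automaton `i` accepts exactly the strings of length `L` without a bad letter. -/
theorem Valid.accept_iff (hP : P.Valid k g) (i : ℕ) {b : ℕ → ℕ} (hb : ∀ t, b t < 2) (t : ℕ) :
    P.run k g i b t / 2 / 2 ^ g = P.L ↔ t = P.L ∧ ∀ t' < P.L, ¬ P.Bad k i b t' := by
  rcases lt_trichotomy t P.L with h | rfl | h
  · rcases hP.run_spec i hb h.le with ⟨-, h2⟩ | ⟨-, mem, fl, h2, h3, h4, -⟩
    · rw [h2, dead_div]; omega
    · rw [h2, enc_div h3 h4]; omega
  · rcases hP.run_spec i hb le_rfl with ⟨⟨t', h1, h1'⟩, h2⟩ | ⟨h1, mem, fl, h2, h3, h4, -⟩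
    · rw [h2, dead_div]
      exact ⟨fun h => by omega, fun h => absurd h1' (h.2 t' h1)⟩
    · rw [h2, enc_div h3 h4]
      exact ⟨fun _ => ⟨rfl, h1⟩, fun _ => rfl⟩
  · have hd : ∀ d, P.run k g i b (P.L + d + 1) = P.dead g := by
      intro d
      induction d with
      | zero =>
        rw [run, step, if_pos]
        rcases hP.run_spec i hb le_rfl with ⟨-, h2⟩ | ⟨-, mem, fl, h2, h3, h4, -⟩
        · rw [h2, dead_div]; omega
        · rw [h2, enc_div h3 h4]
      | succ d ih => rw [run, ← add_assoc, ih, step_dead]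
    obtain ⟨d, rfl⟩ : ∃ d, t = P.L + d + 1 := ⟨t - P.L - 1, by omega⟩
    rw [hd, dead_div]; omega

/-- The formula is satisfied by an assignment. -/
def Sat (P : Plan) : Prop :=
  ∃ σ : ℕ → ℕ, (∀ x, σ x < 2) ∧ ∀ c < P.m, ∃ l < P.len c, σ (P.lvar c l) = P.sgn c l

theorem Valid.sat_iff (hP : P.Valid k g) :
    (∃ b : ℕ → ℕ, (∀ t, b t < 2) ∧ ∀ i < k, ∀ t < P.L, ¬ P.Bad k i b t) ↔ P.Sat := by
  classical
  have hWdef : P.W = P.n + 3 * P.m := rfl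
  have hlp : ∀ c < P.m, ∀ l < 3, P.litPos c l < P.L := by
    intro c hc l hl
    have h1 : (P.time c + 1) * P.W ≤ P.J * P.W := Nat.mul_le_mul_right _ (hP.time_lt c hc)
    have : P.L = P.J * P.W := rfl
    rw [add_mul] at h1
    unfold litPos
    omega
  constructor
  · rintro ⟨b, hb, h⟩
    refine ⟨fun x => b (P.varPos x), fun x => hb _, fun c hc => ?_⟩
    obtain ⟨l, hl, hlen, h1⟩ : ∃ l < 3, l < P.len c ∧ b (P.litPos c l) = 1 := by
      by_contra hcon
      exact h 0 hP.kpos _ (hlp c hc 2 (by norm_num))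
        ⟨c, hc, 2, by norm_num, rfl, Or.inr ⟨rfl, hcon⟩⟩
    refine ⟨l, hlen, ?_⟩
    by_contra hne
    exact h _ (Nat.mod_lt (P.slot (P.lvar c l)) hP.kpos) _ (hlp c hc l hl)
      ⟨c, hc, l, hl, rfl, Or.inl ⟨hlen, h1, rfl, hne⟩⟩
  · rintro ⟨σ, hσ, h⟩
    -- announce the values of the variables, and claim all the true literals
    let b : ℕ → ℕ := fun t =>
      if t % P.W < P.n then σ (t % P.W)
      else if σ (P.lvar ((t % P.W - P.n) / 3) ((t % P.W - P.n) % 3)) =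
        P.sgn ((t % P.W - P.n) / 3) ((t % P.W - P.n) % 3) then 1 else 0
    have hbv : ∀ x < P.n, b (P.varPos x) = σ x := by
      intro x hx
      have : P.varPos x % P.W = x := by
        unfold varPos
        rw [mul_comm, Nat.mul_add_mod, Nat.mod_eq_of_lt (by omega)]
      simp only [b, this, if_pos hx]
    have hbl : ∀ c < P.m, ∀ l < 3, (b (P.litPos c l) = 1 ↔ σ (P.lvar c l) = P.sgn c l) := by
      intro c hc l hl
      have : P.litPos c l % P.W = P.n + 3 * c + l := by
        unfold litPos
        rw [mul_comm, Nat.mul_add_mod, Nat.mod_eq_of_lt (by omega)]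
      have e1 : (P.n + 3 * c + l - P.n) / 3 = c := by omega
      have e2 : (P.n + 3 * c + l - P.n) % 3 = l := by omega
      simp only [b, this, e1, e2]
      rw [if_neg (by omega)]
      simp
    refine ⟨b, fun t => ?_, ?_⟩
    · simp only [b]
      split
      · exact hσ _
      · split <;> norm_num
    · rintro i hi t ht ⟨c, hc, l, hl, rfl, ⟨hlen, h1, -, h2⟩ | ⟨-, h1⟩⟩
      · rw [hbl c hc l hl] at h1
        rw [hbv _ (hP.lvar_lt c hc l hlen)] at h2
        exact h2 h1
      · obtain ⟨l', hl', h2⟩ := h c hc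
        have := hP.len_le c hc
        exact h1 ⟨l', by omega, hl', (hbl c hc l' (by omega)).2 h2⟩

theorem Valid.step_lt (hP : P.Valid k g) {i q a : ℕ} (ha : a < 2) :
    P.step k g i q a < P.dead g + 1 := by
  have hm : q / 2 % 2 ^ g < 2 ^ g := Nat.mod_lt _ (by positivity)
  have hf : q % 2 < 2 := Nat.mod_lt _ (by norm_num)
  have henc : ∀ mem fl, ¬ P.L ≤ q / 2 / 2 ^ g → mem < 2 ^ g → fl < 2 →
      enc g (q / 2 / 2 ^ g + 1) mem fl < P.dead g + 1 := fun mem fl h h1 h2 =>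
    (enc_lt_dead (P := P) (by omega) h1 h2).trans (Nat.lt_succ_self _)
  unfold step
  by_cases h : P.L ≤ q / 2 / 2 ^ g
  · rw [if_pos h]
    exact Nat.lt_succ_self _
  · rw [if_neg h]
    by_cases h' : q / 2 / 2 ^ g % P.W < P.n
    · rw [if_pos h']
      refine henc _ _ h ?_ hf
      split
      · exact setBit_lt hm (hP.slot_lt _ h') ha
      · exact hm
    · rw [if_neg h']
      simp only
      refine lt_of_le_of_lt (ite_le_sup _ _ _) (max_lt (Nat.lt_succ_self _) (henc _ _ h hm ?_))
      refine lt_of_le_of_lt (ite_le_sup _ _ _) (max_lt (by norm_num) ?_)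
      exact lt_of_le_of_lt (ite_le_sup _ _ _) (max_lt (by norm_num) hf)

open Classical in
/-- The automaton number `i`. -/
noncomputable def Valid.fa (hP : P.Valid k g) (i : ℕ) : FA 2 (P.dead g + 1) :=
  detFA (P.dead g + 1) 0 (Nat.succ_pos _) (fun q => decide (q / 2 / 2 ^ g = P.L)) (P.step k g i)
    (fun _ _ _ ha => hP.step_lt ha)

theorem foldl_step (i : ℕ) (u : List ℕ) :
    u.foldl (P.step k g i) 0 = P.run k g i (fun t => u.getD t 0) u.length := by
  induction u using List.reverseRecOn with
  | nil => rfl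
  | append_singleton u a ih =>
    have hcongr : ∀ (b b' : ℕ → ℕ) (m : ℕ), (∀ t < m, b t = b' t) →
        P.run k g i b m = P.run k g i b' m := by
      intro b b' m
      induction m with
      | zero => exact fun _ => rfl
      | succ m ih => exact fun h => by rw [run, run, ih fun t ht => h t (by omega), h m (by omega)]
    rw [List.foldl_append, ih, List.length_append]
    simp only [List.foldl_cons, List.foldl_nil, List.length_singleton, run]
    congr 1
    · exact hcongr _ _ _ fun t ht => by rw [List.getD_append _ _ _ _ ht]
    · simp

theorem Valid.intersectionNonempty_iff (hP : P.Valid k g) :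
    IntersectionNonempty (P.L + 1) (fun i : Fin k => hP.fa i) ↔ P.Sat := by
  classical
  rw [← hP.sat_iff]
  unfold IntersectionNonempty Valid.fa
  simp only [mem_accepts_detFA, decide_eq_true_eq, foldl_step]
  constructor
  · rintro ⟨u, -, h⟩
    have hb : ∀ t, (u.map Fin.val).getD t 0 < 2 := by
      intro t
      rcases lt_or_ge t (u.map Fin.val).length with ht | ht
      · rw [List.getD_eq_getElem _ _ ht, List.getElem_map]
        exact Fin.is_lt _
      · rw [List.getD_eq_default _ _ ht]
        norm_num
    exact ⟨_, hb, fun i hi => ((hP.accept_iff i hb _).1 (h ⟨i, hi⟩)).2⟩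
  · rintro ⟨b, hb, h⟩
    refine ⟨List.ofFn fun t : Fin P.L => ⟨b t, hb t⟩, by simp, fun i => ?_⟩
    have e : ∀ t < P.L, ((List.ofFn fun t : Fin P.L => (⟨b t, hb t⟩ : Fin 2)).map
        Fin.val).getD t 0 = b t := by
      intro t ht
      rw [List.getD_eq_getElem _ _ (by simpa using ht)]
      simp
    have hb' : ∀ t, ((List.ofFn fun t : Fin P.L => (⟨b t, hb t⟩ : Fin 2)).map
        Fin.val).getD t 0 < 2 := by
      intro t
      rcases lt_or_ge t P.L with ht | ht
      · rw [e t ht]; exact hb t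
      · rw [List.getD_eq_default _ _ (by simpa using ht)]
        norm_num
    rw [hP.accept_iff i hb']
    refine ⟨by simp, fun t ht hbad => h i i.2 t ht ?_⟩
    have hWdef : P.W = P.n + 3 * P.m := rfl
    have hLdef : P.L = P.J * P.W := rfl
    have hlp : ∀ c < P.m, ∀ l < 3, P.litPos c l < P.L := by
      intro c hc l hl
      have h1 : (P.time c + 1) * P.W ≤ P.J * P.W := Nat.mul_le_mul_right _ (hP.time_lt c hc)
      rw [add_mul] at h1
      unfold litPos
      omega
    have hvp : ∀ x < P.n, P.varPos x < P.L := by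
      intro x hx
      have h1 : (P.left x + 1) * P.W ≤ P.J * P.W := Nat.mul_le_mul_right _ (hP.left_lt x hx)
      rw [add_mul] at h1
      unfold varPos
      omega
    obtain ⟨c, hc, l, hl, rfl, h'⟩ := hbad
    refine ⟨c, hc, l, hl, rfl, ?_⟩
    rcases h' with ⟨h1, h2, h3, h4⟩ | ⟨h1, h2⟩
    · beta_reduce at h2 h4
      rw [e _ (hlp c hc l hl)] at h2
      rw [e _ (hvp _ (hP.lvar_lt c hc l h1))] at h4
      exact Or.inl ⟨h1, h2, h3, h4⟩
    · refine Or.inr ⟨h1, fun ⟨l', h3, h4, h5⟩ => h2 ⟨l', h3, h4, ?_⟩⟩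
      beta_reduce
      rw [e _ (hlp c hc l' h3)]
      exact h5

end Plan

/-! ### Derived expressions -/

namespace Expr

instance (c : ℕ) : OfNat Expr c := ⟨.const c⟩
instance : Add Expr := ⟨.op .add⟩
instance : Sub Expr := ⟨.op .sub⟩
instance : Mul Expr := ⟨.op .mul⟩
instance : Div Expr := ⟨.op .div⟩
instance : Mod Expr := ⟨fun a b => a - a / b * b⟩

/-- Comparison; as for all conditions, a value other than zero means that it holds. -/
def le (a b : Expr) : Expr := 1 - (a - b)
/-- Strict comparison. -/
def lt (a b : Expr) : Expr := le (a + 1) b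
/-- Equality. -/
def eq (a b : Expr) : Expr := 1 - ((a - b) + (b - a))
/-- Conjunction. -/
def and (a b : Expr) : Expr := a * b
/-- Disjunction. -/
def or (a b : Expr) : Expr := a + b
/-- Negation. -/
def not (a : Expr) : Expr := 1 - a
/-- A call without arguments. -/
def call0 (f : Expr) : Expr := .call 0 (fun _ => 0) f
/-- A call with one argument. -/
def call1 (f a : Expr) : Expr := .call 1 (fun _ => a) f
/-- A call with two arguments. -/
def call2 (f a b : Expr) : Expr := .call 2 ![a, b] f

/-- The least `x < N` with the property `p`, or `N` if there is none. Here `d` is the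
number of variables in use, and `p` is a condition on the variable `d + 1`. -/
def find (d : ℕ) (N p : Expr) : Expr :=
  .fold N 0 (.ite p (.var (d + 1)) (.var (d + 1) + 1))

/-- The number of all `v < N` with the property `p`. Here `d` is the number of variables in
use, and `p` is a condition on the variable `d`. -/
def count (d : ℕ) (N p : Expr) : Expr :=
  .fold N 0 (.ite p (.var (d + 1) + 1) (.var (d + 1)))

/-- Two to the power of the variable `0`. -/
def pow2 : Expr := .fold (.var 0) 1 (.var 2 + .var 2)

section Eval

variable (w ρ : List ℕ) (a b c : Expr)

@[simp] theorem eval_var (i : ℕ) : (var i).eval w ρ = ρ.getD i 0 := rfl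
@[simp] theorem eval_const (i : ℕ) : (const i).eval w ρ = i := rfl
@[simp] theorem eval_zero : (0 : Expr).eval w ρ = 0 := rfl
@[simp] theorem eval_one : (1 : Expr).eval w ρ = 1 := rfl
@[simp] theorem eval_two : (2 : Expr).eval w ρ = 2 := rfl
@[simp] theorem eval_three : (3 : Expr).eval w ρ = 3 := rfl
@[simp] theorem eval_add : (a + b).eval w ρ = a.eval w ρ + b.eval w ρ := rfl
@[simp] theorem eval_sub : (a - b).eval w ρ = a.eval w ρ - b.eval w ρ := rfl
@[simp] theorem eval_mul : (a * b).eval w ρ = a.eval w ρ * b.eval w ρ := rfl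
@[simp] theorem eval_div : (a / b).eval w ρ = a.eval w ρ / b.eval w ρ := rfl
@[simp] theorem eval_mod : (a % b).eval w ρ = a.eval w ρ % b.eval w ρ := by
  change a.eval w ρ - a.eval w ρ / b.eval w ρ * b.eval w ρ = _
  rw [Nat.mod_eq_sub_div_mul]
@[simp] theorem eval_inp : (inp a).eval w ρ = w.getD (a.eval w ρ) 0 := rfl
@[simp] theorem eval_ite : (ite c a b).eval w ρ =
    if c.eval w ρ ≠ 0 then a.eval w ρ else b.eval w ρ := rfl
@[simp] theorem eval_call0 : (call0 c).eval w ρ = c.eval w [] := rfl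
@[simp] theorem eval_call1 : (call1 c a).eval w ρ = c.eval w [a.eval w ρ] := rfl
@[simp] theorem eval_call2 : (call2 c a b).eval w ρ = c.eval w [a.eval w ρ, b.eval w ρ] := rfl

@[simp] theorem eval_le : (le a b).eval w ρ = 0 ↔ ¬ a.eval w ρ ≤ b.eval w ρ := by
  change 1 - (a.eval w ρ - b.eval w ρ) = 0 ↔ _
  omega
@[simp] theorem eval_lt : (lt a b).eval w ρ = 0 ↔ ¬ a.eval w ρ < b.eval w ρ := by
  change 1 - (a.eval w ρ + 1 - b.eval w ρ) = 0 ↔ _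
  omega
@[simp] theorem eval_eq : (eq a b).eval w ρ = 0 ↔ ¬ a.eval w ρ = b.eval w ρ := by
  change 1 - ((a.eval w ρ - b.eval w ρ) + (b.eval w ρ - a.eval w ρ)) = 0 ↔ _
  omega
@[simp] theorem eval_and : (and a b).eval w ρ = 0 ↔ ¬ (a.eval w ρ ≠ 0 ∧ b.eval w ρ ≠ 0) := by
  change a.eval w ρ * b.eval w ρ = 0 ↔ _
  rw [mul_eq_zero]
  tauto
@[simp] theorem eval_or : (or a b).eval w ρ = 0 ↔ ¬ (a.eval w ρ ≠ 0 ∨ b.eval w ρ ≠ 0) := by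
  change a.eval w ρ + b.eval w ρ = 0 ↔ _
  omega
@[simp] theorem eval_not : (not a).eval w ρ = 0 ↔ a.eval w ρ ≠ 0 := by
  change 1 - a.eval w ρ = 0 ↔ _
  omega

variable {w ρ}

/-- The bounds in the definition of an iteration have no effect if the iterated values are small
enough. -/
theorem eval_fold {N a f : Expr} (g : ℕ → ℕ → ℕ) (hN : N.eval w ρ ≤ size w)
    (hf : ∀ v < N.eval w ρ, f.eval w (ρ ++ [v, iter g (a.eval w ρ) v]) =
      g v (iter g (a.eval w ρ) v))
    (hb : ∀ v < N.eval w ρ, iter g (a.eval w ρ) (v + 1) ≤ 2 ^ size w) :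
    (fold N a f).eval w ρ = iter g (a.eval w ρ) (N.eval w ρ) := by
  change iter _ _ (min _ _) = _
  rw [min_eq_left hN]
  refine iter_congr fun v hv => ?_
  rw [hf v hv]
  exact min_eq_left (hb v hv)

theorem size_le_two_pow : size w ≤ 2 ^ size w := Nat.lt_two_pow_self.le

theorem eval_find {d : ℕ} {N p : Expr} {P : ℕ → Prop} (hd : ρ.length = d)
    (hN : N.eval w ρ ≤ size w)
    (hp : ∀ v x, x < N.eval w ρ → (p.eval w (ρ ++ [v, x]) ≠ 0 ↔ P x)) :
    (find d N p).eval w ρ = search P (N.eval w ρ) := by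
  classical
  have hle : ∀ v, iter (fun _ x => if P x then x else x + 1) 0 v ≤ v := search_le P
  refine eval_fold (a := 0) (fun _ x => if P x then x else x + 1) hN (fun v hv => ?_)
    fun v hv => ?_
  · rw [eval_zero]
    have hx : iter (fun _ x => if P x then x else x + 1) 0 v < N.eval w ρ := by
      have := hle v
      omega
    generalize iter (fun _ x => if P x then x else x + 1) 0 v = x at hx ⊢
    have e : (ρ ++ [v, x]).getD (d + 1) 0 = x := by subst hd; simp
    simp only [eval_ite, eval_var, eval_add, eval_one, e, hp v x hx]
  · exact (hle (v + 1)).trans ((by omega : v + 1 ≤ size w).trans size_le_two_pow)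

theorem eval_count {d : ℕ} {N p : Expr} {P : ℕ → Prop} [DecidablePred P] (hd : ρ.length = d)
    (hN : N.eval w ρ ≤ size w)
    (hp : ∀ v x, v < N.eval w ρ → (p.eval w (ρ ++ [v, x]) ≠ 0 ↔ P v)) :
    (count d N p).eval w ρ = Nat.count P (N.eval w ρ) := by
  have hc : ∀ m, iter (fun v x => if P v then x + 1 else x) 0 m = Nat.count P m := by
    intro m
    induction m with
    | zero => simp [iter]
    | succ m ih => rw [iter, ih, Nat.count_succ]; split <;> simp
  rw [← hc]
  refine eval_fold (a := 0) (fun v x => if P v then x + 1 else x) hN (fun v hv => ?_)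
    fun v hv => ?_
  · rw [eval_zero]
    generalize iter (fun v x => if P v then x + 1 else x) 0 v = x
    have e : (ρ ++ [v, x]).getD (d + 1) 0 = x := by subst hd; simp
    simp only [eval_ite, eval_var, eval_add, eval_one, e, hp v x hv]
  · rw [eval_zero, hc]
    exact (Nat.count_le _).trans ((by omega : v + 1 ≤ size w).trans size_le_two_pow)

theorem eval_count_ne_zero {d : ℕ} {N p : Expr} {P : ℕ → Prop} (hd : ρ.length = d)
    (hN : N.eval w ρ ≤ size w)
    (hp : ∀ v x, v < N.eval w ρ → (p.eval w (ρ ++ [v, x]) ≠ 0 ↔ P v)) :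
    (count d N p).eval w ρ ≠ 0 ↔ ∃ v < N.eval w ρ, P v := by
  classical
  rw [eval_count hd hN hp, Nat.count_eq_card_filter_range, Finset.card_ne_zero]
  simp [Finset.Nonempty]

theorem eval_pow2 {e : ℕ} (he : e ≤ size w) : pow2.eval w [e] = 2 ^ e := by
  have h : ∀ m, iter (fun _ x => x + x) 1 m = 2 ^ m := by
    intro m
    induction m with
    | zero => rfl
    | succ m ih => rw [iter, ih, pow_succ]; ring
  refine (eval_fold (fun _ x => x + x) (by simpa using he) (fun v hv => by simp)
    fun v hv => ?_).trans (h _)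
  rw [eval_one, h]
  refine Nat.pow_le_pow_right (by norm_num) ?_
  have : v < e := by simpa using hv
  omega

end Eval

end Expr

/-! ### Reading lists of blocks -/

theorem getD_add_of_drop {w l : List ℕ} {p : ℕ} (h : w.drop p = l) (i : ℕ) :
    w.getD (p + i) 0 = l.getD i 0 := by
  subst h
  simp [List.getD_eq_getElem?_getD]

theorem getD_of_drop {w l : List ℕ} {p x : ℕ} (h : w.drop p = x :: l) : w.getD p 0 = x := by
  simpa using getD_add_of_drop h 0

/-- If `st` maps the position of each block to the position after this block, then iterating
it `c` times leads to the block number `c`. -/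
theorem iter_drop {α : Type*} {f : α → List ℕ} {st : ℕ → ℕ} {w rest : List ℕ} {xs : List α}
    {p : ℕ} (hp : p ≤ w.length) (h0 : w.drop p = xs.flatMap f ++ rest)
    (hst : ∀ q x r, x ∈ xs → w.drop q = f x ++ r → st q = q + (f x).length) {c : ℕ}
    (hc : c ≤ xs.length) :
    w.drop (iter (fun _ q => st q) p c) = (xs.drop c).flatMap f ++ rest ∧
      iter (fun _ q => st q) p c ≤ w.length := by
  induction c with
  | zero => exact ⟨by simpa [iter] using h0, hp⟩
  | succ c ih =>
    obtain ⟨h1, h2⟩ := ih (by omega)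
    rw [iter]
    generalize iter (fun _ q => st q) p c = q at h1 h2 ⊢
    rw [List.drop_eq_getElem_cons (l := xs) (by omega), List.flatMap_cons, List.append_assoc] at h1
    rw [hst q _ _ (List.getElem_mem _) h1]
    constructor
    · rw [← List.drop_drop, h1, List.drop_left]
    · have := congrArg List.length h1
      rw [List.length_drop, List.length_append] at this
      have h3 : 0 ≤ w.length - q := Nat.zero_le _
      omega

theorem getD_flatMap_pair {α : Type*} (f g : α → ℕ) (l : List α) (i : ℕ) :
    (l.flatMap fun x => [f x, g x]).getD (2 * i) 0 = (l.map f).getD i 0 ∧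
    (l.flatMap fun x => [f x, g x]).getD (2 * i + 1) 0 = (l.map g).getD i 0 := by
  induction l generalizing i with
  | nil => simp
  | cons x l ih =>
    cases i with
    | zero => simp
    | succ i =>
      have := ih i
      simp only [List.flatMap_cons, List.cons_append, List.nil_append, List.map_cons,
        List.getD_cons_succ, mul_add, mul_one]
      exact this

/-! ### Reading a formula with a path decomposition -/

namespace SatWord

open PathSETH.Expr

/-- The position of clause `[c]` in the input word. -/
def clauseAt : Expr := .fold (.var 0) 2 (.var 2 + 1 + 2 * .inp (.var 2))
/-- The variable of the literal `l` of the clause `c`, for `[c, l]`. -/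
def lvar : Expr := .inp (call1 clauseAt (.var 0) + (1 + 2 * .var 1))
/-- The sign of the literal `l` of the clause `c`, for `[c, l]`. -/
def sgn : Expr := .inp (call1 clauseAt (.var 0) + (1 + (2 * .var 1 + 1)))
/-- The number of bags. -/
def numBags : Expr := .inp (call1 clauseAt (.inp 1))
/-- The position of the bag `[j]` in the input word. -/
def bagAt : Expr := .fold (.var 0) (call1 clauseAt (.inp 1) + 1) (.var 2 + 1 + .inp (.var 2))
/-- Whether the bag `j` contains the variable `x`, for `[j, x]`. -/
def inBag : Expr :=
  count 2 (.inp (call1 bagAt (.var 0)))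
    (eq (.inp (call1 bagAt (.var 0) + (1 + .var 2))) (.var 1))
/-- The first bag that contains the variable `[x]`. -/
def left : Expr := find 1 numBags (call2 inBag (.var 2) (.var 0))
/-- The last bag that contains the variable `[x]`. -/
def last : Expr :=
  numBags - 1 - find 1 numBags (call2 inBag (numBags - 1 - .var 2) (.var 0))
/-- The largest size of a bag. -/
def maxBag : Expr :=
  find 0 (.inp 0) (not (count 2 numBags (lt (.var 1) (.inp (call1 bagAt (.var 2))))))
/-- The rank of the variable `[x]` by the values of `f`. -/
def rankBy (f : Expr) : Expr :=
  count 1 (.inp 0)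
    (lt (call1 f (.var 1) * .inp 0 + .var 1) (call1 f (.var 0) * .inp 0 + .var 0))
/-- The ancestor of the variable `[x]`. -/
def anc : Expr :=
  .ite (lt (call1 (rankBy left) (.var 0)) (call0 maxBag)) (.var 0)
    (find 1 (.inp 0)
      (eq (call1 (rankBy last) (.var 2)) (call1 (rankBy left) (.var 0) - call0 maxBag)))
/-- The colour of the variable `[x]`. -/
def color : Expr := call1 (rankBy left) (.fold (.inp 0) (.var 0) (call1 anc (.var 2)))
/-- The time of the clause `[c]`. -/
def time : Expr :=
  .fold (.inp (call1 clauseAt (.var 0))) 0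
    (.var 2 + (call1 left (call2 lvar (.var 0) (.var 1)) - .var 2))

variable {n : ℕ} (φ : CNF n) (B : List (List (Fin n)))

/-- The bag number `j`. -/
def bag (j : ℕ) : List ℕ := (B.getD j []).map Fin.val

/-- The largest size of a bag. -/
noncomputable def maxSize : ℕ := search (fun v => ¬ ∃ j < B.length, v < (bag B j).length) n

/-- The first bag that contains `x`. -/
noncomputable def leftEnd (x : ℕ) : ℕ := search (fun j => x ∈ bag B j) B.length

/-- The last bag that contains `x`. -/
noncomputable def lastEnd (x : ℕ) : ℕ :=
  B.length - 1 - search (fun j => x ∈ bag B (B.length - 1 - j)) B.length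

/-- The intervals of the variables, with the colours given by `slot`; the time of a clause is the
latest time when one of its variables begins to live. -/
noncomputable def plan : Plan where
  n := n
  m := φ.length
  J := B.length + 1
  left := leftEnd B
  last := lastEnd B
  slot := slot n (maxSize B) (leftEnd B) (lastEnd B)
  time c := iter (fun l x => x + (leftEnd B (((φ.getD c []).map fun l => l.1.val).getD l 0) - x)) 0
    (φ.getD c []).length
  len c := (φ.getD c []).length
  lvar c l := ((φ.getD c []).map fun l => l.1.val).getD l 0
  sgn c l := ((φ.getD c []).map fun l => if l.2 then 1 else 0).getD l 0

/-- The block of a clause in the input word. -/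
def encC (C : List (Fin n × Bool)) : List ℕ :=
  C.length :: C.flatMap fun l => [l.1.val, if l.2 then 1 else 0]

/-- The block of a bag in the input word. -/
def encB (X : List (Fin n)) : List ℕ := X.length :: X.map Fin.val

theorem encodeSAT_eq : encodeSAT φ B =
    n :: φ.length :: (φ.flatMap encC ++ (B.length :: B.flatMap encB)) := by
  simp only [encodeSAT, List.cons_append, List.nil_append, List.append_assoc]
  rfl

theorem getD_zero : (encodeSAT φ B).getD 0 0 = n := by simp [encodeSAT_eq]
theorem getD_one : (encodeSAT φ B).getD 1 0 = φ.length := by simp [encodeSAT_eq]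

theorem n_le_size : n ≤ size (encodeSAT φ B) := by
  have := getD_le_size (encodeSAT φ B) 0
  rwa [getD_zero] at this

theorem m_le_size : φ.length ≤ size (encodeSAT φ B) := by
  have := getD_le_size (encodeSAT φ B) 1
  rwa [getD_one] at this

theorem length_le_size (w : List ℕ) : w.length ≤ size w := Nat.le_add_right _ _

theorem length_flatMap_pair {α : Type*} (f g : α → ℕ) (l : List α) :
    (l.flatMap fun x => [f x, g x]).length = 2 * l.length := by
  induction l with
  | nil => rfl
  | cons x l ih => rw [List.flatMap_cons, List.length_append, ih, List.length_cons]; simp; ring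

theorem eval_clauseAt {c : ℕ} (hc : c ≤ φ.length) :
    (encodeSAT φ B).drop (clauseAt.eval (encodeSAT φ B) [c]) =
      (φ.drop c).flatMap encC ++ (B.length :: B.flatMap encB) ∧
    clauseAt.eval (encodeSAT φ B) [c] ≤ (encodeSAT φ B).length := by
  set w := encodeSAT φ B with hw
  have key := fun c (hc : c ≤ φ.length) => iter_drop (f := encC)
    (st := fun q => q + 1 + 2 * w.getD q 0) (w := w)
    (rest := B.length :: B.flatMap encB) (xs := φ) (p := 2) (by simp [hw, encodeSAT_eq])
    (by simp [hw, encodeSAT_eq]) (fun q x r _ h => by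
      have : w.getD q 0 = x.length := getD_of_drop h
      rw [this, encC, List.length_cons, length_flatMap_pair]; ring) (c := c) hc
  have e : clauseAt.eval w [c] = iter (fun _ q => q + 1 + 2 * w.getD q 0) 2 c := by
    refine eval_fold (fun _ q => q + 1 + 2 * w.getD q 0) ?_ (fun v hv => by simp) fun v hv => ?_
    · simpa using hc.trans (m_le_size φ B)
    · have hv' : v < c := by simpa using hv
      exact ((key (v + 1) (by omega)).2.trans (length_le_size w)).trans size_le_two_pow
  rw [e]
  exact key c hc

variable {φ} in
theorem plan_len {c : ℕ} (hc : c < φ.length) : (plan φ B).len c = φ[c].length := by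
  change (φ.getD c []).length = _
  rw [List.getD_eq_getElem _ _ hc]

variable {φ} in
theorem plan_lvar {c : ℕ} (hc : c < φ.length) (l : ℕ) :
    (plan φ B).lvar c l = (φ[c].map fun l => l.1.val).getD l 0 := by
  change ((φ.getD c []).map _).getD l 0 = _
  rw [List.getD_eq_getElem _ _ hc]

variable {φ} in
theorem plan_sgn {c : ℕ} (hc : c < φ.length) (l : ℕ) :
    (plan φ B).sgn c l = (φ[c].map fun l => if l.2 then 1 else 0).getD l 0 := by
  change ((φ.getD c []).map _).getD l 0 = _
  rw [List.getD_eq_getElem _ _ hc]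

theorem eval_len {c : ℕ} (hc : c < φ.length) :
    (encodeSAT φ B).getD (clauseAt.eval (encodeSAT φ B) [c]) 0 = (plan φ B).len c := by
  obtain ⟨h, -⟩ := eval_clauseAt φ B hc.le
  rw [List.drop_eq_getElem_cons hc] at h
  simp only [List.flatMap_cons, encC, List.cons_append] at h
  rw [getD_of_drop h, plan_len B hc]

theorem eval_lvar {c l : ℕ} (hc : c < φ.length) (hl : l < (plan φ B).len c) :
    lvar.eval (encodeSAT φ B) [c, l] = (plan φ B).lvar c l := by
  obtain ⟨h, -⟩ := eval_clauseAt φ B hc.le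
  have hl' : l < φ[c].length := by rwa [plan_len B hc] at hl
  rw [List.drop_eq_getElem_cons hc] at h
  simp only [List.flatMap_cons, encC, List.cons_append] at h
  have h1 := getD_add_of_drop h (1 + 2 * l)
  rw [add_comm 1, List.getD_cons_succ, List.getD_append _ _ _ _ (by
    rw [List.length_append, length_flatMap_pair]; omega), List.getD_append _ _ _ _ (by
    rw [length_flatMap_pair]; omega), (getD_flatMap_pair _ _ _ _).1] at h1
  simp only [lvar, eval_inp, eval_add, eval_call1, eval_var, eval_one, eval_mul, eval_two,
    List.getD_cons_zero, List.getD_cons_succ]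
  rw [add_comm 1, h1, plan_lvar B hc]

theorem eval_sgn {c l : ℕ} (hc : c < φ.length) (hl : l < (plan φ B).len c) :
    sgn.eval (encodeSAT φ B) [c, l] = (plan φ B).sgn c l := by
  obtain ⟨h, -⟩ := eval_clauseAt φ B hc.le
  have hl' : l < φ[c].length := by rwa [plan_len B hc] at hl
  rw [List.drop_eq_getElem_cons hc] at h
  simp only [List.flatMap_cons, encC, List.cons_append] at h
  have h1 := getD_add_of_drop h (1 + (2 * l + 1))
  rw [add_comm 1, List.getD_cons_succ, List.getD_append _ _ _ _ (by
    rw [List.length_append, length_flatMap_pair]; omega), List.getD_append _ _ _ _ (by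
    rw [length_flatMap_pair]; omega), (getD_flatMap_pair _ _ _ _).2] at h1
  simp only [sgn, eval_inp, eval_add, eval_call1, eval_var, eval_one, eval_mul, eval_two,
    List.getD_cons_zero, List.getD_cons_succ]
  rw [add_comm 1 (2 * l + 1), h1, plan_sgn B hc]

theorem eval_numBags (ρ : List ℕ) : numBags.eval (encodeSAT φ B) ρ = B.length := by
  obtain ⟨h, -⟩ := eval_clauseAt φ B le_rfl
  rw [List.drop_length, List.flatMap_nil, List.nil_append] at h
  simp only [numBags, eval_inp, eval_call1, eval_one, getD_one]
  exact getD_of_drop h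

theorem B_le_size : B.length ≤ size (encodeSAT φ B) := by
  rw [← eval_numBags φ B []]
  exact getD_le_size _ _

theorem eval_bagAt {j : ℕ} (hj : j < B.length) (i : ℕ) :
    (encodeSAT φ B).getD (bagAt.eval (encodeSAT φ B) [j]) 0 = (bag B j).length ∧
    (i < (bag B j).length → (encodeSAT φ B).getD (bagAt.eval (encodeSAT φ B) [j] + (1 + i)) 0 =
      (bag B j).getD i 0) := by
  set w := encodeSAT φ B with hw
  obtain ⟨h, h'⟩ := eval_clauseAt φ B le_rfl
  rw [← hw] at h h'
  rw [List.drop_length, List.flatMap_nil, List.nil_append] at h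
  have h1 : w.drop (clauseAt.eval w [φ.length] + 1) = B.flatMap encB ++ [] := by
    rw [← List.drop_drop, h]; simp
  have h2 : clauseAt.eval w [φ.length] + 1 ≤ w.length := by
    have := congrArg List.length h
    rw [List.length_drop, List.length_cons] at this
    omega
  have key := fun c (hc : c ≤ B.length) => iter_drop (f := encB)
    (st := fun q => q + 1 + w.getD q 0) (w := w) (rest := []) (xs := B) h2 h1
    (fun q x r _ h => by
      have : w.getD q 0 = x.length := getD_of_drop h
      rw [this, encB, List.length_cons, List.length_map]; ring) (c := c) hc
  have e0 : (call1 clauseAt (.inp 1) + 1).eval w [j] = clauseAt.eval w [φ.length] + 1 := by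
    simp [hw, encodeSAT_eq]
  have e : bagAt.eval w [j] =
      iter (fun _ q => q + 1 + w.getD q 0) (clauseAt.eval w [φ.length] + 1) j := by
    rw [← e0]
    refine eval_fold (fun _ q => q + 1 + w.getD q 0) ?_ (fun v hv => by simp) fun v hv => ?_
    · simpa using hj.le.trans (B_le_size φ B)
    · have hv' : v < j := by simpa using hv
      rw [e0]
      exact ((key (v + 1) (by omega)).2.trans (length_le_size w)).trans size_le_two_pow
  have h3 := (key j hj.le).1
  rw [← e, List.drop_eq_getElem_cons hj, List.flatMap_cons, encB, List.cons_append,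
    List.cons_append] at h3
  have hb : bag B j = B[j].map Fin.val := by rw [bag, List.getD_eq_getElem _ _ hj]
  constructor
  · rw [getD_of_drop h3, hb, List.length_map]
  · intro hi
    rw [getD_add_of_drop h3, add_comm 1, List.getD_cons_succ, List.append_assoc,
      List.getD_append _ _ _ _ (by rwa [← hb]), hb]

theorem eval_inBag {j : ℕ} (hj : j < B.length) (x : ℕ) :
    inBag.eval (encodeSAT φ B) [j, x] ≠ 0 ↔ x ∈ bag B j := by
  have hN := (eval_bagAt φ B hj 0).1
  rw [inBag, eval_count_ne_zero (d := 2) (ρ := [j, x]) (P := fun v => (bag B j).getD v 0 = x) rfl]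
  · simp only [eval_inp, eval_call1, eval_var, List.getD_cons_zero]
    rw [hN, List.mem_iff_getElem]
    constructor
    · rintro ⟨v, hv, h⟩
      rw [List.getD_eq_getElem _ _ hv] at h
      exact ⟨v, hv, h⟩
    · rintro ⟨v, hv, h⟩
      exact ⟨v, hv, by rw [List.getD_eq_getElem _ _ hv]; exact h⟩
  · exact getD_le_size _ _
  · intro v y hv
    simp only [eval_inp, eval_call1, eval_var, List.getD_cons_zero] at hv
    rw [hN] at hv
    simp only [List.cons_append, List.nil_append, ne_eq, eval_eq, eval_inp, eval_add, eval_call1,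
      eval_var, eval_one, List.getD_cons_zero, List.getD_cons_succ, not_not]
    rw [(eval_bagAt φ B hj v).2 hv]

theorem eval_left (x : ℕ) : left.eval (encodeSAT φ B) [x] = leftEnd B x := by
  rw [left, eval_find (d := 1) (ρ := [x]) (P := fun j => x ∈ bag B j) rfl]
  · rw [eval_numBags]; rfl
  · rw [eval_numBags]; exact B_le_size φ B
  · intro v j hj
    rw [eval_numBags] at hj
    simpa using eval_inBag φ B hj x

theorem eval_last (x : ℕ) : last.eval (encodeSAT φ B) [x] = lastEnd B x := by
  simp only [last, eval_sub, eval_numBags, eval_one]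
  rw [eval_find (d := 1) (ρ := [x]) (P := fun j => x ∈ bag B (B.length - 1 - j)) rfl]
  · rw [eval_numBags]; rfl
  · rw [eval_numBags]; exact B_le_size φ B
  · intro v j hj
    rw [eval_numBags] at hj
    have : B.length - 1 - j < B.length := by omega
    simpa [eval_numBags] using eval_inBag φ B this x

theorem eval_maxBag : maxBag.eval (encodeSAT φ B) [] = maxSize B := by
  rw [maxBag, eval_find (d := 0) (ρ := []) (P := fun v => ¬ ∃ j < B.length, v < (bag B j).length) rfl]
  · simp only [eval_inp, eval_zero, getD_zero]; rfl
  · exact getD_le_size _ _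
  · intro v x hx
    rw [ne_eq, eval_not, not_iff_not, List.nil_append,
      eval_count_ne_zero (d := 2) (ρ := [v, x]) (P := fun j => x < (bag B j).length) rfl]
    · rw [eval_numBags]
    · rw [eval_numBags]; exact B_le_size φ B
    · intro j y hj
      rw [eval_numBags] at hj
      simp only [List.cons_append, List.nil_append, ne_eq, eval_lt, eval_inp, eval_call1, eval_var,
        List.getD_cons_zero, List.getD_cons_succ, not_not]
      rw [(eval_bagAt φ B hj 0).1]

theorem eval_rankBy {f : Expr} {g : ℕ → ℕ} (hf : ∀ x, f.eval (encodeSAT φ B) [x] = g x) (x : ℕ) :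
    (rankBy f).eval (encodeSAT φ B) [x] = rank n g x := by
  rw [rankBy, eval_count (d := 1) (ρ := [x]) (P := fun y => g y * n + y < g x * n + x) rfl]
  · simp only [eval_inp, eval_zero, getD_zero]; rfl
  · exact getD_le_size _ _
  · intro v y _
    simp only [List.cons_append, List.nil_append, ne_eq, eval_lt, eval_add, eval_mul, eval_inp,
      eval_zero, getD_zero, eval_call1, eval_var, List.getD_cons_zero, List.getD_cons_succ, not_not,
      hf]

theorem eval_rankBy_left (x : ℕ) :
    (rankBy left).eval (encodeSAT φ B) [x] = rank n (leftEnd B) x :=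
  eval_rankBy φ B (eval_left φ B) x

theorem eval_rankBy_last (x : ℕ) :
    (rankBy last).eval (encodeSAT φ B) [x] = rank n (lastEnd B) x :=
  eval_rankBy φ B (eval_last φ B) x

theorem eval_anc (x : ℕ) :
    anc.eval (encodeSAT φ B) [x] = ancestor n (maxSize B) (leftEnd B) (lastEnd B) x := by
  rw [anc, eval_ite, eval_find (d := 1) (ρ := [x])
    (P := fun y => rank n (lastEnd B) y = rank n (leftEnd B) x - maxSize B) rfl]
  · simp only [ne_eq, eval_lt, eval_call1, eval_var, List.getD_cons_zero, eval_call0, eval_maxBag,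
      eval_rankBy_left, not_not, eval_inp, eval_zero, getD_zero]
    rfl
  · exact getD_le_size _ _
  · intro v y _
    simp only [List.cons_append, List.nil_append, ne_eq, eval_eq, eval_call1, eval_var, eval_sub,
      eval_call0, eval_maxBag, List.getD_cons_zero, List.getD_cons_succ, not_not,
      eval_rankBy_left, eval_rankBy_last]

theorem ancestor_le {W : ℕ} {f g : ℕ → ℕ} {x b : ℕ} (hx : x ≤ b) (hb : n ≤ b) :
    ancestor n W f g x ≤ b := by
  unfold ancestor
  split
  · exact hx
  · exact (search_le _ _).trans hb

theorem eval_color {x : ℕ} (hx : x < n) :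
    color.eval (encodeSAT φ B) [x] = (plan φ B).slot x := by
  have hs := n_le_size φ B
  simp only [color, eval_call1, eval_rankBy_left]
  rw [eval_fold (fun _ z => ancestor n (maxSize B) (leftEnd B) (lastEnd B) z)]
  · simp only [eval_inp, eval_zero, getD_zero]
    rfl
  · exact getD_le_size _ _
  · intro v _
    simp only [List.cons_append, List.nil_append, eval_call1, eval_var, eval_anc,
      List.getD_cons_zero, List.getD_cons_succ]
  · intro v _
    refine le_trans ?_ size_le_two_pow
    generalize v + 1 = m
    induction m with
    | zero => simp only [iter, eval_var, List.getD_cons_zero]; omega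
    | succ m ih => exact ancestor_le ih hs

theorem leftEnd_le (x : ℕ) : leftEnd B x ≤ B.length := search_le _ _

theorem eval_time {c : ℕ} (hc : c < φ.length) :
    time.eval (encodeSAT φ B) [c] = (plan φ B).time c := by
  have hlen := eval_len φ B hc
  rw [time, eval_fold (fun l x => x + (leftEnd B ((plan φ B).lvar c l) - x))]
  · simp only [eval_inp, eval_call1, eval_var, List.getD_cons_zero]
    rw [hlen]
    rfl
  · exact getD_le_size _ _
  · intro l hl
    simp only [eval_inp, eval_call1, eval_var, List.getD_cons_zero] at hl
    rw [hlen] at hl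
    simp only [List.cons_append, List.nil_append, eval_add, eval_sub, eval_call1, eval_call2,
      eval_var, List.getD_cons_zero, List.getD_cons_succ, eval_lvar φ B hc hl, eval_left]
  · intro v _
    refine le_trans ?_ size_le_two_pow
    refine le_trans ?_ (B_le_size φ B)
    generalize v + 1 = m
    induction m with
    | zero => exact Nat.zero_le _
    | succ m ih =>
      rw [iter]
      have := leftEnd_le B ((plan φ B).lvar c m)
      omega

end SatWord

/-! ### From satisfiability to the intersection of automata -/

namespace SatWord

open PathSETH.Expr

section Validity

variable {n : ℕ} {φ : CNF n} {B : List (List (Fin n))}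

theorem mem_bag {j : ℕ} (hj : j < B.length) (x : Fin n) : x.val ∈ bag B j ↔ x ∈ B[j] := by
  rw [bag, List.getD_eq_getElem _ _ hj, List.mem_map]
  constructor
  · rintro ⟨y, hy, h⟩
    rwa [← Fin.ext h]
  · exact fun h => ⟨x, h, rfl⟩

theorem bag_length_le (hB : ∀ X ∈ B, X.Nodup) (j : ℕ) : (bag B j).length ≤ n := by
  rw [bag, List.length_map]
  rcases lt_or_ge j B.length with hj | hj
  · rw [List.getD_eq_getElem _ _ hj]
    simpa using (hB _ (List.getElem_mem hj)).length_le_card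
  · rw [List.getD_eq_default _ _ hj]
    exact Nat.zero_le _

theorem bag_length_le_maxSize (hB : ∀ X ∈ B, X.Nodup) {j : ℕ} (hj : j < B.length) :
    (bag B j).length ≤ maxSize B := by
  have h : ¬ ∃ j < B.length, maxSize B < (bag B j).length := by
    rcases (search_spec (fun v => ¬ ∃ j < B.length, v < (bag B j).length) n).2 with h | h
    · rw [maxSize, h]
      rintro ⟨j, -, hj⟩
      have := bag_length_le hB j
      omega
    · exact h.2
  by_contra hc
  exact h ⟨j, hj, by omega⟩

theorem le_foldr_max {l : List ℕ} {x : ℕ} (hx : x ∈ l) : x ≤ l.foldr max 0 := by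
  induction l with
  | nil => simp at hx
  | cons y l ih =>
    rcases List.mem_cons.1 hx with rfl | h
    · exact le_max_left _ _
    · exact (ih h).trans (le_max_right _ _)

theorem maxSize_le (hB : ∀ X ∈ B, X.Nodup) : maxSize B ≤ width (B.map List.toFinset) + 1 := by
  refine search_le_of ?_
  rintro ⟨j, hj, h⟩
  have h1 : B[j].toFinset.card ∈ (B.map List.toFinset).map Finset.card := by
    rw [List.map_map]
    exact List.mem_map.2 ⟨B[j], List.getElem_mem hj, rfl⟩
  have h2 := le_foldr_max h1
  rw [List.toFinset_card_of_nodup (hB _ (List.getElem_mem hj))] at h2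
  rw [bag, List.getD_eq_getElem _ _ hj, List.length_map] at h
  unfold width at h
  omega

section Interval

variable (hpd : IsPathDecomposition φ.primalGraph (B.map List.toFinset))

include hpd

theorem exists_mem_bag {x : ℕ} (hx : x < n) : ∃ j < B.length, x ∈ bag B j := by
  obtain ⟨X, hX, hxX⟩ := hpd.1 ⟨x, hx⟩
  obtain ⟨Y, hY, rfl⟩ := List.mem_map.1 hX
  obtain ⟨j, hj, rfl⟩ := List.mem_iff_getElem.1 hY
  exact ⟨j, hj, (mem_bag hj ⟨x, hx⟩).2 (List.mem_toFinset.1 hxX)⟩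

theorem leftEnd_spec {x : ℕ} (hx : x < n) :
    leftEnd B x < B.length ∧ x ∈ bag B (leftEnd B x) := by
  obtain ⟨j, hj, h⟩ := exists_mem_bag hpd hx
  exact search_found (p := fun j => x ∈ bag B j) hj h

omit hpd in
theorem leftEnd_le_of_mem {x j : ℕ} (h : x ∈ bag B j) : leftEnd B x ≤ j :=
  search_le_of (p := fun j => x ∈ bag B j) h

theorem lastEnd_spec {x : ℕ} (hx : x < n) :
    lastEnd B x < B.length ∧ x ∈ bag B (lastEnd B x) := by
  obtain ⟨j, hj, h⟩ := exists_mem_bag hpd hx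
  have := search_found (p := fun j => x ∈ bag B (B.length - 1 - j))
    (n := B.length) (v := B.length - 1 - j) (by omega)
    (by rwa [show B.length - 1 - (B.length - 1 - j) = j by omega])
  exact ⟨by unfold lastEnd; omega, this.2⟩

omit hpd in
theorem le_lastEnd_of_mem {x j : ℕ} (hj : j < B.length) (h : x ∈ bag B j) : j ≤ lastEnd B x := by
  have := search_le_of (p := fun j => x ∈ bag B (B.length - 1 - j))
    (n := B.length) (v := B.length - 1 - j)
    (by rwa [show B.length - 1 - (B.length - 1 - j) = j by omega])
  unfold lastEnd
  omega

theorem mem_bag_of_le {x j : ℕ} (hx : x < n) (h1 : leftEnd B x ≤ j) (h2 : j ≤ lastEnd B x) :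
    x ∈ bag B j := by
  obtain ⟨hl, hl'⟩ := leftEnd_spec hpd hx
  obtain ⟨hr, hr'⟩ := lastEnd_spec hpd hx
  have hj : j < B.length := by omega
  have e : ∀ i (hi : i < B.length), x ∈ bag B i ↔
      (⟨x, hx⟩ : Fin n) ∈ (B.map List.toFinset).get ⟨i, by simpa using hi⟩ := by
    intro i hi
    rw [List.get_eq_getElem, List.getElem_map, List.mem_toFinset, ← mem_bag hi]
  rw [e j hj]
  exact hpd.2.2 ⟨leftEnd B x, by simpa using hl⟩ ⟨j, by simpa using hj⟩
    ⟨lastEnd B x, by simpa using hr⟩ h1 h2 ⟨x, hx⟩ ((e _ hl).1 hl') ((e _ hr).1 hr')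

theorem thin (hB : ∀ X ∈ B, X.Nodup) : Thin n (maxSize B) (leftEnd B) (lastEnd B) where
  le x hx := by
    obtain ⟨hl, hl'⟩ := leftEnd_spec hpd hx
    exact le_lastEnd_of_mem hl hl'
  card x hx := by
    obtain ⟨hl, -⟩ := leftEnd_spec hpd hx
    refine le_trans ?_ ((List.toFinset_card_le _).trans (bag_length_le_maxSize hB hl))
    refine Finset.card_le_card fun y hy => ?_
    simp only [Finset.mem_filter, Finset.mem_range] at hy
    exact List.mem_toFinset.2 (mem_bag_of_le hpd hy.1 hy.2.1 hy.2.2)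

end Interval

theorem iter_max_spec (f : ℕ → ℕ) (m : ℕ) :
    (∀ l < m, f l ≤ iter (fun l x => x + (f l - x)) 0 m) ∧
      (iter (fun l x => x + (f l - x)) 0 m = 0 ∨
        ∃ l < m, iter (fun l x => x + (f l - x)) 0 m = f l) := by
  induction m with
  | zero => exact ⟨fun l hl => absurd hl (Nat.not_lt_zero l), Or.inl rfl⟩
  | succ m ih =>
    obtain ⟨h1, h2⟩ := ih
    rw [iter]
    generalize iter (fun l x => x + (f l - x)) 0 m = x at h1 h2 ⊢
    refine ⟨fun l hl => ?_, ?_⟩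
    · rcases Nat.lt_succ_iff_lt_or_eq.1 hl with h | rfl
      · have := h1 l h; omega
      · omega
    · rcases le_total (f m) x with h | h
      · rw [Nat.sub_eq_zero_of_le h, add_zero]
        exact h2.imp_right fun ⟨l, hl, e⟩ => ⟨l, by omega, e⟩
      · exact Or.inr ⟨m, by omega, by omega⟩

theorem plan_lvar_eq {c l : ℕ} (hc : c < φ.length) (hl : l < φ[c].length) :
    (plan φ B).lvar c l = φ[c][l].1.val := by
  rw [plan_lvar B hc, List.getD_eq_getElem _ _ (by simpa using hl), List.getElem_map]

theorem plan_sgn_eq {c l : ℕ} (hc : c < φ.length) (hl : l < φ[c].length) :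
    (plan φ B).sgn c l = if φ[c][l].2 then 1 else 0 := by
  rw [plan_sgn B hc, List.getD_eq_getElem _ _ (by simpa using hl), List.getElem_map]

/-- The plan of a formula with a path decomposition of its primal graph is valid. -/
theorem plan_valid (hφ : φ.IsThreeCNF) (hB : ∀ X ∈ B, X.Nodup)
    (hpd : IsPathDecomposition φ.primalGraph (B.map List.toFinset)) {k : ℕ} (hk : 0 < k) :
    (plan φ B).Valid k (maxSize B / k + 1) := by
  have hthin := thin hpd hB
  have htime : ∀ c, (plan φ B).time c =
      iter (fun l x => x + (leftEnd B ((plan φ B).lvar c l) - x)) 0 ((plan φ B).len c) :=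
    fun _ => rfl
  have hlv : ∀ c < φ.length, ∀ l < (plan φ B).len c, (plan φ B).lvar c l < n := by
    intro c hc l hl
    rw [plan_len B hc] at hl
    rw [plan_lvar_eq hc hl]
    exact Fin.is_lt _
  refine ⟨hk, ?_, ?_, ?_, hthin.le, ?_, ?_, hlv, ?_, ?_⟩
  · exact fun x hx => (leftEnd_spec hpd hx).1.trans (Nat.lt_succ_self _)
  · intro x hx
    exact Nat.lt_succ_of_le (Nat.div_le_div_right (hthin.slot_lt hx).le)
  · exact fun x hx y hy hne h => hthin.disjoint hx hy hne h
  · intro c hc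
    rw [htime]
    have hJ : (plan φ B).J = B.length + 1 := rfl
    rw [hJ]
    rcases (iter_max_spec (fun l => leftEnd B ((plan φ B).lvar c l)) _).2 with h | ⟨l, -, h⟩
    · rw [h]; omega
    · rw [h]
      have := leftEnd_le B ((plan φ B).lvar c l)
      omega
  · intro c hc
    rw [plan_len B hc]
    exact hφ _ (List.getElem_mem hc)
  · intro c hc l hl
    rw [htime]
    exact (iter_max_spec (fun l => leftEnd B ((plan φ B).lvar c l)) _).1 l hl
  · intro c hc l hl
    rw [htime]
    rcases (iter_max_spec (fun l => leftEnd B ((plan φ B).lvar c l)) _).2 with h | ⟨l', hl', h⟩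
    · rw [h]; exact Nat.zero_le _
    · rw [h]
      -- two variables of a clause share a bag
      have hx := hlv c hc l hl
      have hx' := hlv c hc l' hl'
      change leftEnd B ((plan φ B).lvar c l') ≤ lastEnd B ((plan φ B).lvar c l)
      by_cases he : (plan φ B).lvar c l = (plan φ B).lvar c l'
      · rw [he]
        exact hthin.le _ hx'
      · rw [plan_len B hc] at hl hl'
        rw [plan_lvar_eq hc hl] at he ⊢
        rw [plan_lvar_eq hc hl'] at he ⊢
        have hadj : φ.primalGraph.Adj φ[c][l].1 φ[c][l'].1 :=
          ⟨fun e => he (congrArg Fin.val e), φ[c], List.getElem_mem hc,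
            ⟨_, List.getElem_mem hl, rfl⟩, ⟨_, List.getElem_mem hl', rfl⟩⟩
        obtain ⟨X, hX, h1, h2⟩ := hpd.2.1 _ _ hadj
        obtain ⟨Y, hY, rfl⟩ := List.mem_map.1 hX
        obtain ⟨j, hj, rfl⟩ := List.mem_iff_getElem.1 hY
        exact (leftEnd_le_of_mem ((mem_bag hj _).2 (List.mem_toFinset.1 h2))).trans
          (le_lastEnd_of_mem hj ((mem_bag hj _).2 (List.mem_toFinset.1 h1)))

theorem plan_sat : (plan φ B).Sat ↔ φ.Satisfiable := by
  constructor
  · rintro ⟨σ, hσ, h⟩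
    refine ⟨fun x => decide (σ x = 1), fun C hC => ?_⟩
    obtain ⟨c, hc, rfl⟩ := List.mem_iff_getElem.1 hC
    obtain ⟨l, hl, e⟩ := h c hc
    rw [plan_len B hc] at hl
    rw [plan_lvar_eq hc hl, plan_sgn_eq hc hl] at e
    refine ⟨_, List.getElem_mem hl, ?_⟩
    simp only [e]
    cases φ[c][l].2 <;> simp
  · rintro ⟨σ, h⟩
    refine ⟨fun x => if hx : x < n then (if σ ⟨x, hx⟩ then 1 else 0) else 0, fun x => ?_,
      fun c hc => ?_⟩
    · simp only
      split
      · split <;> norm_num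
      · norm_num
    · obtain ⟨l, hl, e⟩ := h _ (List.getElem_mem hc)
      obtain ⟨i, hi, rfl⟩ := List.mem_iff_getElem.1 hl
      refine ⟨i, by rwa [plan_len B hc], ?_⟩
      rw [plan_lvar_eq hc hi, plan_sgn_eq hc hi]
      simp [e]

end Validity

/-! ### Writing the automata -/

/-- The number of letters per time. -/
def wordW : Expr := .inp 0 + 3 * .inp 1
/-- The number of letters altogether. -/
def wordL : Expr := (numBags + 1) * wordW
/-- Two to the power of the number of memory cells of an automaton, out of `k`. -/
def memSize (k : ℕ) : Expr := call1 pow2 (call0 maxBag / .const k + 1)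
/-- The rejecting state. -/
def deadState (k : ℕ) : Expr := (wordL + 1) * memSize k * 2
/-- Replace a binary digit, for `[x, b, a]`. -/
def setBitE : Expr :=
  .var 0 / call1 pow2 (.var 1 + 1) * call1 pow2 (.var 1 + 1) + .var 2 * call1 pow2 (.var 1) +
    .var 0 % call1 pow2 (.var 1)

/-- The new flag, for `[i, q, a, p, mem, r, j, c, l]`. -/
def flagE : Expr :=
  .ite (and (eq (call1 time (.var 7)) (.var 6))
      (and (lt (.var 8) (.inp (call1 clauseAt (.var 7)))) (eq (.var 2) 1)))
    1 (.ite (eq (.var 8) 0) 0 (.var 1 % 2))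

/-- A transition for the letter of a literal, for `[i, q, a, p, mem, r, j, c, l]`. -/
def stepLit (k : ℕ) : Expr :=
  .ite (or
      (and (eq (call1 time (.var 7)) (.var 6))
        (and (lt (.var 8) (.inp (call1 clauseAt (.var 7))))
          (and (eq (.var 2) 1)
            (and (eq (call1 color (call2 lvar (.var 7) (.var 8)) % .const k) (.var 0))
              (not (eq (.var 4 / call1 pow2 (call1 color (call2 lvar (.var 7) (.var 8)) / .const k)
                % 2) (call2 sgn (.var 7) (.var 8))))))))
      (and (eq (call1 time (.var 7)) (.var 6)) (and (eq (.var 8) 2) (eq flagE 0))))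
    (deadState k)
    (((.var 3 + 1) * memSize k + .var 4) * 2 + flagE)

/-- A transition, for `[i, q, a, p, mem, r, j]`. -/
def stepMid (k : ℕ) : Expr :=
  .ite (lt (.var 5) (.inp 0))
    (((.var 3 + 1) * memSize k +
      .ite (and (eq (call1 left (.var 5)) (.var 6)) (eq (call1 color (.var 5) % .const k) (.var 0)))
        (.call 3 ![.var 4, call1 color (.var 5) / .const k, .var 2] setBitE) (.var 4)) * 2 +
      .var 1 % 2)
    (.call 9 ![.var 0, .var 1, .var 2, .var 3, .var 4, .var 5, .var 6, (.var 5 - .inp 0) / 3,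
      (.var 5 - .inp 0) % 3] (stepLit k))

/-- The transition function, for `[i, q, a]`. -/
def stepE (k : ℕ) : Expr :=
  .ite (le wordL (.var 1 / 2 / memSize k)) (deadState k)
    (.call 7 ![.var 0, .var 1, .var 2, .var 1 / 2 / memSize k, .var 1 / 2 % memSize k,
      .var 1 / 2 / memSize k % wordW, .var 1 / 2 / memSize k / wordW] (stepMid k))

/-- The emitter that writes the automata. -/
def automata (k : ℕ) : Emitter :=
  .seq (.emit (.const k)) <| .seq (.emit 2) <| .seq (.emit (deadState k + 1)) <|
  .seq (.emit (wordL + 1)) <|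
  .loop (.const k) 0 <|
    .seq (.loop (deadState k + 1)
      (.ite (eq (.var 1 / 2 / memSize k) wordL) 1 0) .nop) <|
    .seq (.emit (2 * (deadState k + 1))) <|
    .loop (deadState k + 1) (.var 1) <|
      .seq (.emit 0) <| .seq (.emit (.call 3 ![.var 0, .var 1, 0] (stepE k))) <|
      .seq (.emit (.var 1)) <| .seq (.emit 1) (.emit (.call 3 ![.var 0, .var 1, 1] (stepE k)))

section Write

variable {n : ℕ} {φ : CNF n} {B : List (List (Fin n))} {k : ℕ}

theorem eval_wordL (ρ : List ℕ) : wordL.eval (encodeSAT φ B) ρ = (plan φ B).L := by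
  simp only [wordL, wordW, eval_mul, eval_add, eval_numBags, eval_one, eval_inp, eval_three,
    eval_zero, getD_zero, getD_one]
  rfl

theorem eval_wordW (ρ : List ℕ) : wordW.eval (encodeSAT φ B) ρ = (plan φ B).W := by
  simp only [wordW, eval_mul, eval_add, eval_one, eval_inp, eval_three,
    eval_zero, getD_zero, getD_one]
  rfl

theorem maxSize_le_n : maxSize B ≤ n := search_le _ _

theorem g_le_size : maxSize B / k + 1 ≤ size (encodeSAT φ B) := by
  have h1 : maxSize B / k ≤ n := (Nat.div_le_self _ _).trans maxSize_le_n
  have h2 : 1 ≤ (encodeSAT φ B).length := by simp [encodeSAT_eq]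
  have h3 : n ≤ (encodeSAT φ B).sum :=
    List.single_le_sum (fun _ _ => Nat.zero_le _) n (by simp [encodeSAT_eq])
  unfold size
  omega

theorem eval_memSize (ρ : List ℕ) :
    (memSize k).eval (encodeSAT φ B) ρ = 2 ^ (maxSize B / k + 1) := by
  simp only [memSize, eval_call1, eval_add, eval_div, eval_call0, eval_maxBag, eval_const, eval_one]
  exact eval_pow2 g_le_size

theorem eval_deadState (ρ : List ℕ) :
    (deadState k).eval (encodeSAT φ B) ρ = (plan φ B).dead (maxSize B / k + 1) := by
  simp only [deadState, eval_mul, eval_add, eval_wordL, eval_memSize, eval_one, eval_two]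
  rfl

theorem eval_setBitE {w : List ℕ} {x b a : ℕ} (hb : b + 1 ≤ size w) :
    setBitE.eval w [x, b, a] = setBit x b a := by
  simp only [setBitE, eval_add, eval_mul, eval_div, eval_mod, eval_call1, eval_var, eval_one,
    List.getD_cons_zero, List.getD_cons_succ, eval_pow2 hb,
    eval_pow2 ((Nat.le_succ b).trans hb)]
  rfl

theorem eval_call {w ρ : List ℕ} {m : ℕ} {args : Fin m → Expr} {f : Expr} :
    (Expr.call m args f).eval w ρ = f.eval w (List.ofFn fun i => (args i).eval w ρ) := rfl

theorem eval_stepE (hP : (plan φ B).Valid k (maxSize B / k + 1)) (i q a : ℕ) :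
    (stepE k).eval (encodeSAT φ B) [i, q, a] =
      (plan φ B).step k (maxSize B / k + 1) i q a := by
  have ewL := eval_wordL (φ := φ) (B := B)
  have ewW := eval_wordW (φ := φ) (B := B)
  have emS := eval_memSize (φ := φ) (B := B) (k := k)
  have edS := eval_deadState (φ := φ) (B := B) (k := k)
  have elft := eval_left φ B
  have ecol := fun x hx => eval_color φ B (x := x) hx
  have etm := fun c hc => eval_time φ B (c := c) hc
  have eln := fun c hc => eval_len φ B (c := c) hc
  have elv := fun c l hc hl => eval_lvar φ B (c := c) (l := l) hc hl
  have esg := fun c l hc hl => eval_sgn φ B (c := c) (l := l) hc hl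
  have egd := getD_zero φ B
  have hgs := g_le_size (φ := φ) (B := B) (k := k)
  have hWdef : (plan φ B).W = n + 3 * φ.length := rfl
  have hleft : leftEnd B = (plan φ B).left := rfl
  generalize encodeSAT φ B = w at *
  generalize maxSize B / k + 1 = g at *
  rw [hleft] at elft
  have hPn : (plan φ B).n = n := rfl
  have hPm : (plan φ B).m = φ.length := rfl
  generalize plan φ B = P at *
  unfold Plan.step
  simp only [stepE, eval_ite, ne_eq, eval_le, not_not, ewL, eval_div, eval_var,
    eval_two, emS, edS, List.getD_cons_zero, List.getD_cons_succ]
  by_cases hL : P.L ≤ q / 2 / 2 ^ g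
  · rw [if_pos hL, if_pos hL]
  rw [if_neg hL, if_neg hL]
  have hW : 0 < P.W := by
    by_contra h
    have h0 : P.W = 0 := by omega
    simp [Plan.L, h0] at hL
  simp only [eval_call, List.ofFn_succ, List.ofFn_zero, Matrix.cons_val_zero, Matrix.cons_val_succ,
    eval_div, eval_mod, eval_var, eval_two, emS, ewW, List.getD_cons_zero,
    List.getD_cons_succ]
  set p := q / 2 / 2 ^ g with hp
  set mem := q / 2 % 2 ^ g with hmem
  set r := p % P.W with hr
  set j := p / P.W with hj
  have hrW : r < P.W := Nat.mod_lt _ hW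
  simp only [stepMid, eval_ite, ne_eq, eval_lt, not_not, eval_var, eval_inp, eval_zero,
    List.getD_cons_zero, List.getD_cons_succ, egd]
  rw [hPn]
  by_cases hrn : r < n
  · rw [if_pos hrn, if_pos hrn]
    have hs := hP.slot_lt r (by omega)
    simp only [eval_add, eval_mul, eval_ite, ne_eq, eval_and, eval_eq, not_not, eval_call1,
      eval_mod, eval_const, eval_var, eval_one, eval_two, emS, elft, eval_call,
      List.ofFn_succ, List.ofFn_zero, Matrix.cons_val_zero, Matrix.cons_val_succ, eval_div,
      List.getD_cons_zero, List.getD_cons_succ, ecol r hrn]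
    rw [eval_setBitE (hs.trans_le hgs)]
    rfl
  · rw [if_neg hrn, if_neg hrn]
    simp only [eval_call, List.ofFn_succ, List.ofFn_zero, Matrix.cons_val_zero,
      Matrix.cons_val_succ, eval_var, eval_sub, eval_div, eval_mod, eval_inp, eval_zero, eval_three,
      List.getD_cons_zero, List.getD_cons_succ, egd]
    set c := (r - n) / 3 with hc
    set l := (r - n) % 3 with hl
    have hcm : c < φ.length := by omega
    have hflag : flagE.eval w [i, q, a, p, mem, r, j, c, l] =
        if P.time c = j ∧ l < P.len c ∧ a = 1 then 1 else if l = 0 then 0 else q % 2 := by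
      simp only [flagE, eval_ite, ne_eq, eval_and, eval_eq, eval_lt, not_not, eval_call1, eval_var,
        eval_inp, eval_one, eval_zero, eval_mod, eval_two, List.getD_cons_zero,
        List.getD_cons_succ, etm c hcm, eln c hcm]
    set fl := (if P.time c = j ∧ l < P.len c ∧ a = 1 then 1 else if l = 0 then 0 else q % 2)
    simp only [stepLit, eval_ite, ne_eq, eval_or, eval_and, eval_eq, eval_lt, eval_not, not_not,
      eval_call1, eval_call2, eval_var, eval_inp, eval_one, eval_zero, eval_mod, eval_two,
      eval_div, eval_const, eval_add, eval_mul, List.getD_cons_zero, List.getD_cons_succ,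
      etm c hcm, eln c hcm, edS, emS, hflag]
    refine if_congr (or_congr ?_ Iff.rfl) rfl rfl
    refine and_congr_right fun _ => and_congr_right fun hlen => and_congr_right fun _ => ?_
    have hlv : P.lvar c l < n := by
      have := hP.lvar_lt c (by omega) l hlen
      omega
    rw [elv c l hcm hlen, esg c l hcm hlen, ecol _ hlv]
    rw [eval_pow2 ((hP.slot_lt _ (by omega)).le.trans hgs)]

theorem flatMap_finRange {N : ℕ} (f : ℕ → List ℕ) :
    (List.finRange N).flatMap (fun q => f q.val) = (List.range N).flatMap f := by
  rw [← List.map_coe_finRange_eq_range, List.flatMap_map]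

/-- The emitter writes the automata of the plan. -/
theorem automata_out (hP : (plan φ B).Valid k (maxSize B / k + 1)) :
    (automata k).out (encodeSAT φ B) [] =
      encodeFAs ((plan φ B).L + 1) (fun i : Fin k => hP.fa i) := by
  set N := (plan φ B).dead (maxSize B / k + 1) + 1 with hN
  have hfa : ∀ i : Fin k, (hP.fa i).encode =
      0 :: ((List.range N).map (fun q => if q / 2 / 2 ^ (maxSize B / k + 1) = (plan φ B).L
        then 1 else 0) ++ (2 * N :: (List.range N).flatMap fun q =>
          [q, 0, (plan φ B).step k (maxSize B / k + 1) i q 0,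
            q, 1, (plan φ B).step k (maxSize B / k + 1) i q 1])) := by
    intro i
    have h1 : ∀ l : List (Fin N), (l.flatMap fun q => ([(q, 0, ⟨_, hP.step_lt (i := i) (q := q)
        (a := 0) (by norm_num)⟩), (q, 1, ⟨_, hP.step_lt (i := i) (q := q) (a := 1)
          (by norm_num)⟩)] : List (Fin N × Fin 2 × Fin N))).length = 2 * l.length := by
      intro l
      induction l with
      | nil => rfl
      | cons x l ih => rw [List.flatMap_cons, List.length_append, ih]; simp; ring
    unfold FA.encode Plan.Valid.fa detFA
    simp only [List.cons_append, List.nil_append, List.cons.injEq, true_and, List.append_assoc]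
    congr 1
    · rw [← List.map_coe_finRange_eq_range, List.map_map, List.ofFn_eq_map]
      refine List.map_congr_left fun q _ => ?_
      simp
    · rw [h1, List.length_finRange]
      congr 1
      rw [List.flatMap_assoc, ← flatMap_finRange]
      rfl
  unfold encodeFAs
  have hmap : List.ofFn (fun i : Fin k => hP.fa i) =
      (List.finRange k).map (fun i : Fin k => hP.fa i) := List.ofFn_eq_map
  rw [hmap, List.flatMap_map]
  simp only [hfa]
  rw [flatMap_finRange (fun i => 0 :: ((List.range N).map
    (fun q => if q / 2 / 2 ^ (maxSize B / k + 1) = (plan φ B).L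
        then 1 else 0) ++ (2 * N :: (List.range N).flatMap fun q =>
          [q, 0, (plan φ B).step k (maxSize B / k + 1) i q 0,
            q, 1, (plan φ B).step k (maxSize B / k + 1) i q 1])))]
  simp only [automata, Emitter.out, eval_const, eval_zero, eval_one, eval_two, eval_add, eval_mul,
    eval_wordL, eval_deadState, eval_ite, eval_eq, ne_eq, not_not, eval_div, eval_var, eval_memSize,
    eval_call, List.ofFn_succ, List.ofFn_zero, Matrix.cons_val_zero, Matrix.cons_val_succ,
    List.nil_append, List.cons_append, List.getD_cons_zero, List.getD_cons_succ,
    eval_stepE hP, ← hN, List.map_eq_flatMap]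

end Write

end SatWord

/-! ### Running times -/

theorem Program.DecidesWithin.mono {P : Program} {w : List ℕ} {Yes : Prop} {T T' : ℝ}
    (h : P.DecidesWithin w Yes T) (hT : T ≤ T') : P.DecidesWithin w Yes T' := by
  obtain ⟨S, t, h1, h2, h3⟩ := h
  exact ⟨S, t, h1, h2.trans hT, h3⟩

theorem eval_le_mul_pow (p : Polynomial ℕ) {x : ℕ} (hx : 1 ≤ x) :
    p.eval x ≤ p.eval 1 * x ^ p.natDegree := by
  rw [Polynomial.eval_eq_sum_range, Polynomial.eval_eq_sum_range, Finset.sum_mul]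
  refine Finset.sum_le_sum fun i hi => ?_
  rw [one_pow, mul_one]
  exact Nat.mul_le_mul_left _ (Nat.pow_le_pow_right hx (by have := Finset.mem_range.1 hi; omega))

theorem size_le {w : List ℕ} {b : ℕ} (h : ∀ x ∈ w, x ≤ b) : size w ≤ w.length + w.length * b := by
  unfold size
  have := List.sum_le_card_nsmul w b h
  rw [smul_eq_mul] at this
  omega

theorem length_flatMap_le {α : Type*} {f : α → List ℕ} {l : List α} {b : ℕ}
    (h : ∀ x ∈ l, (f x).length ≤ b) : (l.flatMap f).length ≤ l.length * b := by
  induction l with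
  | nil => simp
  | cons x l ih =>
    rw [List.flatMap_cons, List.length_append, List.length_cons, add_mul, one_mul]
    have h1 := h x (by simp)
    have h2 := ih fun y hy => h y (by simp [hy])
    omega

theorem length_le_length_flatMap {α : Type*} {f : α → List ℕ} {l : List α} {x : α} (hx : x ∈ l) :
    (f x).length ≤ (l.flatMap f).length := by
  obtain ⟨a, b, rfl⟩ := List.append_of_mem hx
  simp only [List.flatMap_append, List.flatMap_cons, List.length_append]
  omega

theorem length_encode {s n : ℕ} (M : FA s n) : M.encode.length = n + 2 + 3 * M.arcs.length := by
  have h : ∀ l : List (Fin n × Fin s × Fin n),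
      (l.flatMap fun e => [e.1.val, e.2.1.val, e.2.2.val]).length = 3 * l.length := by
    intro l
    induction l with
    | nil => rfl
    | cons x l ih => rw [List.flatMap_cons, List.length_append, ih]; simp; ring
  simp only [FA.encode, List.length_append, h, List.length_ofFn, List.length_singleton]
  omega

theorem length_encodeFAs_le {k s n : ℕ} (ℓ : ℕ) (M : Fin k → FA s n) {A : ℕ}
    (hA : ∀ i, (M i).arcs.length ≤ A) :
    (encodeFAs ℓ M).length ≤ 4 + k * (n + 2 + 3 * A) := by
  have h : ∀ m ∈ List.ofFn M, m.encode.length ≤ n + 2 + 3 * A := by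
    intro m hm
    obtain ⟨i, rfl⟩ := List.mem_ofFn.1 hm
    rw [length_encode]
    have := hA i
    omega
  have := length_flatMap_le h
  rw [List.length_ofFn] at this
  simp only [encodeFAs, List.length_append, List.length_cons, List.length_nil]
  omega

theorem length_detFA_arcs {N start : ℕ} {hs : start < N} {acc : ℕ → Bool} {δ : ℕ → ℕ → ℕ}
    {hδ : ∀ q < N, ∀ a < 2, δ q a < N} : (detFA N start hs acc δ hδ).arcs.length = 2 * N := by
  unfold detFA
  have : ∀ (l : List (Fin N)) (f g : Fin N → Fin N × Fin 2 × Fin N),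
      (l.flatMap fun q => [f q, g q]).length = 2 * l.length := by
    intro l f g
    induction l with
    | nil => rfl
    | cons x l ih => rw [List.flatMap_cons, List.length_append, ih]; simp; ring
  rw [this, List.length_finRange]

section SatSize

variable {n : ℕ} (φ : CNF n) (B : List (List (Fin n)))

theorem bounds_encodeSAT : φ.length + B.length + 3 ≤ (encodeSAT φ B).length ∧
    ∀ x ∈ encodeSAT φ B, x ≤ sizeSAT φ B := by
  have h1 : φ.length ≤ (φ.flatMap SatWord.encC).length := by
    induction φ with
    | nil => simp
    | cons C φ ih => simp [SatWord.encC] at ih ⊢; omega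
  have h2 : B.length ≤ (B.flatMap SatWord.encB).length := by
    induction B with
    | nil => simp
    | cons C φ ih => simp [SatWord.encB] at ih ⊢; omega
  have hl : (encodeSAT φ B).length = (φ.flatMap SatWord.encC).length +
      (B.flatMap SatWord.encB).length + 3 := by
    simp only [SatWord.encodeSAT_eq, List.length_cons, List.length_append]; omega
  refine ⟨by omega, fun x hx => ?_⟩
  have hS : sizeSAT φ B = n + (encodeSAT φ B).length := rfl
  simp only [SatWord.encodeSAT_eq, List.mem_cons, List.mem_append, List.mem_flatMap] at hx
  rcases hx with rfl | rfl | ⟨C, hC, hx⟩ | rfl | ⟨X, hX, hx⟩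
  · omega
  · omega
  · have h3 := length_le_length_flatMap (f := SatWord.encC) hC
    simp only [SatWord.encC, List.mem_cons, List.mem_flatMap, List.not_mem_nil, or_false] at hx
    have h4 : C.length ≤ (SatWord.encC C).length := by
      simp only [SatWord.encC, List.length_cons, SatWord.length_flatMap_pair]; omega
    rcases hx with rfl | ⟨l, -, rfl | rfl⟩
    · omega
    · have := l.1.2; omega
    · split <;> omega
  · omega
  · have h3 := length_le_length_flatMap (f := SatWord.encB) hX
    simp only [SatWord.encB, List.mem_cons, List.mem_map] at hx
    have h4 : X.length ≤ (SatWord.encB X).length := by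
      simp [SatWord.encB]
    rcases hx with rfl | ⟨l, -, rfl⟩
    · omega
    · have := l.2; omega

theorem size_encodeSAT_le : size (encodeSAT φ B) ≤ 2 * sizeSAT φ B ^ 2 := by
  have h := size_le (bounds_encodeSAT φ B).2
  have h1 : (encodeSAT φ B).length ≤ sizeSAT φ B := Nat.le_add_left _ _
  have h2 : (encodeSAT φ B).length * sizeSAT φ B ≤ sizeSAT φ B * sizeSAT φ B :=
    Nat.mul_le_mul_right _ h1
  nlinarith

end SatSize

open SatWord in
/-- An algorithm for the intersection of `k` automata that is faster than `n ^ k` decides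
satisfiability faster than `2 ^ pw`: the `k` automata of a plan have about `2 ^ (pw / k)`
states. -/
theorem not_PPSETH_of_dfa {ε c K : ℝ} {k : ℕ} (hε : 0 < ε) (hk : 1 < k) {P : Program}
    (h : ∀ (n ℓ : ℕ), 1 ≤ ℓ → ∀ M : Fin k → FA 2 n, (∀ i, (M i).IsDFA) →
      P.DecidesWithin (encodeFAs ℓ M) (IntersectionNonempty ℓ M)
        (K * (n : ℝ) ^ ((k : ℝ) - ε) * (ℓ : ℝ) ^ c)) : ¬ PPSETH := by
  obtain ⟨p, hp⟩ := (automata k).reduction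
  obtain ⟨R, hR⟩ := hp P
  set ε₁ := min ε 1 with hε₁
  have hε₁0 : 0 < ε₁ := lt_min hε one_pos
  have hε₁1 : ε₁ ≤ 1 := min_le_right _ _
  have hk2 : (2 : ℝ) ≤ k := by exact_mod_cast hk
  have hk0 : (0 : ℝ) < k := by linarith
  set b : ℝ := 2 ^ (1 - ε₁ / k) with hb
  have hb0 : 0 < b := by positivity
  have hb2 : b < 2 := by
    rw [hb]
    conv_rhs => rw [← Real.rpow_one 2]
    have : 0 < ε₁ / k := by positivity
    exact Real.rpow_lt_rpow_of_exponent_lt (by norm_num) (by linarith)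
  set K' := max K 0 with hK'
  have hK'0 : 0 ≤ K' := le_max_right _ _
  set c' := ⌈c⌉₊ with hc'
  set d := p.natDegree with hd
  intro hPP
  refine hPP (2 - b) (by linarith) (by linarith)
    ⟨R, K' * 64 ^ k * 4 ^ c' + p.eval 1 * 2 ^ d * (14 * k * 64), 2 * k + 2 * c' + 2 * d + 2, ?_⟩
  intro n φ B hφ hB hpd
  have hP := plan_valid hφ hB hpd (k := k) (by omega)
  have hdec := h _ ((plan φ B).L + 1) (by omega) (fun i : Fin k => hP.fa i) fun i => detFA_isDFA
  rw [hP.intersectionNonempty_iff, plan_sat, ← automata_out hP] at hdec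
  refine (hR _ _ _ hdec).mono ?_
  rw [automata_out hP, show (2 : ℝ) - (2 - b) = b by ring]
  set pw := width (B.map List.toFinset) with hpw
  set S := sizeSAT φ B with hS
  set g := maxSize B / k + 1 with hg
  set L := (plan φ B).L with hL
  set N := (plan φ B).dead g + 1 with hN
  -- the length of the strings and the number of states
  obtain ⟨hlen, -⟩ := bounds_encodeSAT φ B
  have hSdef : S = n + (encodeSAT φ B).length := rfl
  have hS1 : 1 ≤ S := by omega
  have hL4 : L + 1 ≤ 4 * S ^ 2 := by
    have h1 : L = (B.length + 1) * (n + 3 * φ.length) := rfl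
    have h2 : (B.length + 1) * (n + 3 * φ.length) ≤ S * (3 * S) :=
      Nat.mul_le_mul (by omega) (by omega)
    nlinarith
  set y : ℝ := 2 ^ ((pw : ℝ) / k) with hy
  have hy1 : 1 ≤ y := Real.one_le_rpow (by norm_num) (by positivity)
  have h2g : (2 : ℝ) ^ g ≤ 4 * y := by
    have h1 : ((maxSize B / k : ℕ) : ℝ) ≤ (pw : ℝ) / k + 1 := by
      refine Nat.cast_div_le.trans ?_
      have h2 : (maxSize B : ℝ) ≤ pw + 1 := by exact_mod_cast maxSize_le hB
      rw [div_add_one hk0.ne']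
      gcongr
      linarith
    calc (2 : ℝ) ^ g = 2 ^ ((g : ℕ) : ℝ) := (Real.rpow_natCast _ _).symm
      _ ≤ 2 ^ ((pw : ℝ) / k + 2) := by
        refine Real.rpow_le_rpow_of_exponent_le (by norm_num) ?_
        rw [hg]; push_cast; linarith
      _ = 4 * y := by
        rw [Real.rpow_add (by norm_num), ← hy]
        norm_num [mul_comm]
  have hNy : (N : ℝ) ≤ 64 * S ^ 2 * y := by
    have h1 : (N : ℝ) = ((L + 1 : ℕ) : ℝ) * 2 ^ g * 2 + 1 := by
      rw [hN, Plan.dead, ← hL]; push_cast; ring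
    have h2 : ((L + 1 : ℕ) : ℝ) ≤ 4 * S ^ 2 := by exact_mod_cast hL4
    have h3 : ((L + 1 : ℕ) : ℝ) * 2 ^ g ≤ 4 * S ^ 2 * (4 * y) :=
      mul_le_mul h2 h2g (by positivity) (by positivity)
    have h4 : (1 : ℝ) ≤ (S : ℝ) ^ 2 * y := by
      have : (1 : ℝ) ≤ S := by exact_mod_cast hS1
      nlinarith [one_le_pow₀ this (n := 2)]
    rw [h1]; nlinarith
  have hN1 : (1 : ℝ) ≤ N := by
    have : 1 ≤ N := by omega
    exact_mod_cast this
  have hS1' : (1 : ℝ) ≤ S := by exact_mod_cast hS1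
  -- the two parts of the running time
  have hyb : y ^ ((k : ℝ) - ε₁) = b ^ pw := by
    rw [hy, hb, ← Real.rpow_mul (by norm_num), ← Real.rpow_natCast, ← Real.rpow_mul (by norm_num)]
    congr 1
    field_simp
  have hyb' : y ≤ b ^ pw := by
    rw [← hyb]
    conv_lhs => rw [← Real.rpow_one y]
    exact Real.rpow_le_rpow_of_exponent_le hy1 (by linarith)
  have hT1 : K * (N : ℝ) ^ ((k : ℝ) - ε) * ((L + 1 : ℕ) : ℝ) ^ c ≤
      K' * ((64 ^ k * S ^ (2 * k)) * b ^ pw) * (4 ^ c' * S ^ (2 * c')) := by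
    have h1 : (N : ℝ) ^ ((k : ℝ) - ε) ≤ (64 ^ k * S ^ (2 * k)) * b ^ pw := by
      calc (N : ℝ) ^ ((k : ℝ) - ε) ≤ (N : ℝ) ^ ((k : ℝ) - ε₁) :=
            Real.rpow_le_rpow_of_exponent_le hN1 (by linarith [min_le_left ε 1])
        _ ≤ (64 * S ^ 2 * y) ^ ((k : ℝ) - ε₁) :=
            Real.rpow_le_rpow (by linarith) hNy (by linarith)
        _ = (64 * (S : ℝ) ^ 2) ^ ((k : ℝ) - ε₁) * b ^ pw := by
            rw [Real.mul_rpow (by positivity) (by positivity), hyb]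
        _ ≤ (64 * (S : ℝ) ^ 2) ^ (k : ℝ) * b ^ pw := by
            refine mul_le_mul_of_nonneg_right (Real.rpow_le_rpow_of_exponent_le ?_ (by linarith))
              (by positivity)
            nlinarith
        _ = (64 ^ k * S ^ (2 * k)) * b ^ pw := by
            rw [Real.rpow_natCast, mul_pow, ← pow_mul]
    have h2 : ((L + 1 : ℕ) : ℝ) ^ c ≤ 4 ^ c' * S ^ (2 * c') := by
      have hL1 : (1 : ℝ) ≤ ((L + 1 : ℕ) : ℝ) := by exact_mod_cast Nat.le_add_left 1 L
      calc ((L + 1 : ℕ) : ℝ) ^ c ≤ ((L + 1 : ℕ) : ℝ) ^ (c' : ℝ) :=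
            Real.rpow_le_rpow_of_exponent_le hL1 (Nat.le_ceil c)
        _ = ((L + 1 : ℕ) : ℝ) ^ c' := Real.rpow_natCast _ _
        _ ≤ (4 * (S : ℝ) ^ 2) ^ c' := by
            refine pow_le_pow_left₀ (by linarith) ?_ _
            exact_mod_cast hL4
        _ = 4 ^ c' * S ^ (2 * c') := by rw [mul_pow, ← pow_mul]
    have h3 : (0 : ℝ) ≤ (N : ℝ) ^ ((k : ℝ) - ε) := Real.rpow_nonneg (by linarith) _
    have h4 : (0 : ℝ) ≤ ((L + 1 : ℕ) : ℝ) ^ c := Real.rpow_nonneg (Nat.cast_nonneg _) _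
    refine mul_le_mul ?_ h2 h4 (by positivity)
    exact (mul_le_mul_of_nonneg_right (le_max_left K 0) h3).trans
      (mul_le_mul_of_nonneg_left h1 hK'0)
  have hT2 : ((p.eval (size (encodeSAT φ B)) : ℕ) : ℝ) *
      (1 + ((encodeFAs (L + 1) (fun i : Fin k => hP.fa i)).length : ℝ)) ≤
      (p.eval 1 * 2 ^ d * S ^ (2 * d)) * (14 * k * (64 * S ^ 2 * b ^ pw)) := by
    have h1 : ((p.eval (size (encodeSAT φ B)) : ℕ) : ℝ) ≤ p.eval 1 * 2 ^ d * S ^ (2 * d) := by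
      have hsz : 1 ≤ size (encodeSAT φ B) := by
        have := length_le_size (encodeSAT φ B)
        omega
      have h2 := (eval_le_mul_pow p hsz).trans (Nat.mul_le_mul_left (p.eval 1)
        (Nat.pow_le_pow_left (size_encodeSAT_le φ B) d))
      rw [mul_pow, ← pow_mul, ← mul_assoc] at h2
      exact_mod_cast h2
    have h3 := length_encodeFAs_le (L + 1) (fun i : Fin k => hP.fa i) (A := 2 * N)
      fun i => (length_detFA_arcs).le
    have h4 : (1 : ℝ) + ((encodeFAs (L + 1) (fun i : Fin k => hP.fa i)).length : ℝ) ≤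
        14 * k * N := by
      have h5 : ((encodeFAs (L + 1) (fun i : Fin k => hP.fa i)).length : ℝ) ≤
          4 + k * (N + 2 + 3 * (2 * N)) := by exact_mod_cast h3
      have h6 : (k : ℝ) ≤ k * N := le_mul_of_one_le_right (by linarith) hN1
      nlinarith
    refine mul_le_mul h1 (h4.trans ?_) (by positivity) (by positivity)
    refine mul_le_mul_of_nonneg_left (hNy.trans ?_) (by positivity)
    exact mul_le_mul_of_nonneg_left hyb' (by positivity)
  refine (add_le_add hT1 hT2).trans ?_
  have e1 : (S : ℝ) ^ (2 * k) * S ^ (2 * c') ≤ S ^ (2 * k + 2 * c' + 2 * d + 2) := by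
    rw [← pow_add]
    exact pow_le_pow_right₀ hS1' (by omega)
  have e2 : (S : ℝ) ^ (2 * d) * S ^ 2 ≤ S ^ (2 * k + 2 * c' + 2 * d + 2) := by
    rw [← pow_add]
    exact pow_le_pow_right₀ hS1' (by omega)
  calc K' * ((64 ^ k * (S : ℝ) ^ (2 * k)) * b ^ pw) * (4 ^ c' * S ^ (2 * c')) +
        (p.eval 1 * 2 ^ d * S ^ (2 * d)) * (14 * k * (64 * S ^ 2 * b ^ pw))
      = (K' * 64 ^ k * 4 ^ c') * b ^ pw * ((S : ℝ) ^ (2 * k) * S ^ (2 * c')) +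
        (p.eval 1 * 2 ^ d * (14 * k * 64)) * b ^ pw * ((S : ℝ) ^ (2 * d) * S ^ 2) := by ring
    _ ≤ (K' * 64 ^ k * 4 ^ c') * b ^ pw * S ^ (2 * k + 2 * c' + 2 * d + 2) +
        (p.eval 1 * 2 ^ d * (14 * k * 64)) * b ^ pw * S ^ (2 * k + 2 * c' + 2 * d + 2) := by
      gcongr
    _ = _ := by ring

/-! ### A formula for the runs of several automata -/

/-- The choices that describe simultaneous runs of `k` automata: in each round `t ≤ ℓ` each
automaton `i` picks one of `E` options. Option `e` leads from the state `src i e` to the state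
`tgt i e` reading `letter i e`, and it may be picked only if `ok t i e`. States are numbers with
`L` bits, and a letter counts only if it is less than `s`. -/
structure Tableau where
  (k s L E ℓ : ℕ)
  (src letter tgt : ℕ → ℕ → ℕ)
  ok : ℕ → ℕ → ℕ → Bool

namespace Tableau

variable (D : Tableau)

/-- The number of triples of a round, an automaton and an option. They are numbered in this
lexicographic order, so that the triple `p` belongs to the pair `p / E` of a round and an
automaton. -/
def T : ℕ := (D.ℓ + 1) * D.k * D.E
/-- The number of the variables for bits of states. -/
def NX : ℕ := (D.ℓ + 2) * D.k * D.L
/-- The number of the variables for letters. -/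
def NA : ℕ := (D.ℓ + 1) * D.s
/-- The variable that tells whether no option before `p` has been picked. -/
def U (p : ℕ) : ℕ := D.NX + D.NA + p
/-- The variable that tells whether `p` is picked. -/
def V (p : ℕ) : ℕ := D.NX + D.NA + (D.T + 1) + p
/-- The number of variables. -/
def N : ℕ := D.NX + D.NA + (D.T + 1) + D.T

/-- These clauses, for all options of a pair of a round and an automaton, say that at least one
option is picked. The literals that do not make sense for the first and for the last option are
replaced by copies of the literal in the middle. -/
def pick (p : ℕ) : List (ℕ × Bool) :=
  [if p % D.E = 0 then (D.V p, true) else (D.U p, false), (D.V p, true),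
    if p % D.E + 1 = D.E then (D.V p, true) else (D.U (p + 1), true)]

/-- The clauses for `p`: if it is picked then it is permitted, it leads from the state written in
the variables of the present round to the state written in those of the next round, and it reads
the letter of the present round. -/
def clauses (p : ℕ) : List (List (ℕ × Bool)) :=
  D.pick p :: [(D.V p, false), (D.V p, D.ok (p / D.E / D.k) (p / D.E % D.k) (p % D.E))] ::
    (((List.range D.L).map fun b =>
        [(D.V p, false), (p / D.E * D.L + b, (D.src (p / D.E % D.k) (p % D.E)).testBit b)]) ++
      ((List.range D.s).map fun a =>
        [(D.V p, false), (D.NX + (p / D.E / D.k * D.s + a),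
          decide (a = D.letter (p / D.E % D.k) (p % D.E)))]) ++
      ((List.range D.L).map fun b =>
        [(D.V p, false),
          ((p / D.E + D.k) * D.L + b, (D.tgt (p / D.E % D.k) (p % D.E)).testBit b)]))

/-- The bag for `p`: the states of all automata at the present stage of the simulation, and the
new state of the automaton that moves; the letter; the picking of the option. -/
def bag (p : ℕ) : List ℕ :=
  ((List.range ((D.k + 1) * D.L)).map fun x => p / D.E * D.L + x) ++
    ((List.range D.s).map fun a => D.NX + (p / D.E / D.k * D.s + a)) ++
    [D.U p, D.U (p + 1), D.V p]

variable {D}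

theorem mem_clauses {p : ℕ} {C : List (ℕ × Bool)} : C ∈ D.clauses p ↔
    C = D.pick p ∨
    C = [(D.V p, false), (D.V p, D.ok (p / D.E / D.k) (p / D.E % D.k) (p % D.E))] ∨
    (∃ b < D.L, C =
      [(D.V p, false), (p / D.E * D.L + b, (D.src (p / D.E % D.k) (p % D.E)).testBit b)]) ∨
    (∃ a < D.s, C = [(D.V p, false), (D.NX + (p / D.E / D.k * D.s + a),
          decide (a = D.letter (p / D.E % D.k) (p % D.E)))]) ∨
    (∃ b < D.L, C = [(D.V p, false),
          ((p / D.E + D.k) * D.L + b, (D.tgt (p / D.E % D.k) (p % D.E)).testBit b)]) := by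
  simp only [clauses, List.mem_cons, List.mem_append, List.mem_map, List.mem_range, or_assoc,
    eq_comm (b := C)]

/-- The bag for `p` consists of an interval in each of the four groups of variables. -/
theorem mem_bag {p x : ℕ} : x ∈ D.bag p ↔
    (p / D.E * D.L ≤ x ∧ x < p / D.E * D.L + (D.k + 1) * D.L) ∨
    (D.NX + p / D.E / D.k * D.s ≤ x ∧ x < D.NX + p / D.E / D.k * D.s + D.s) ∨
    (D.U p ≤ x ∧ x ≤ D.U (p + 1)) ∨ x = D.V p := by
  have h : ∀ m c, (∃ a < m, c + a = x) ↔ c ≤ x ∧ x < c + m := fun m c =>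
    ⟨fun ⟨a, h, e⟩ => by omega, fun h => ⟨x - c, by omega, by omega⟩⟩
  simp only [bag, List.mem_append, List.mem_map, List.mem_range, List.mem_cons, List.not_mem_nil,
    or_false, ← add_assoc, h, U, V]
  omega

theorem length_clauses (p : ℕ) : (D.clauses p).length = 2 + 2 * D.L + D.s := by
  simp [clauses]; omega

theorem length_bag (p : ℕ) : (D.bag p).length = (D.k + 1) * D.L + D.s + 3 := by
  simp [bag]; omega

theorem length_le_three {p : ℕ} {C : List (ℕ × Bool)} (hC : C ∈ D.clauses p) : C.length ≤ 3 := by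
  rw [mem_clauses] at hC
  rcases hC with rfl | rfl | ⟨b, -, rfl⟩ | ⟨b, -, rfl⟩ | ⟨b, -, rfl⟩ <;> simp [pick]

theorem block_lt {p : ℕ} (hp : p < D.T) : p / D.E < (D.ℓ + 1) * D.k := by
  exact Nat.div_lt_of_lt_mul (by rw [mul_comm]; exact hp)

theorem round_lt {p : ℕ} (hp : p < D.T) : p / D.E / D.k < D.ℓ + 1 :=
  Nat.div_lt_of_lt_mul (by rw [mul_comm]; exact block_lt hp)

theorem window_le {p : ℕ} (hp : p < D.T) : p / D.E * D.L + (D.k + 1) * D.L ≤ D.NX := by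
  rw [← add_mul, NX]
  refine Nat.mul_le_mul_right _ ?_
  have := block_lt hp
  linarith [add_mul (D.ℓ + 1) 1 D.k]

theorem letters_le {p : ℕ} (hp : p < D.T) : p / D.E / D.k * D.s + D.s ≤ D.NA := by
  have := Nat.mul_le_mul_right D.s (round_lt hp)
  rwa [Nat.succ_mul] at this

theorem bag_lt {p x : ℕ} (hp : p < D.T) (hx : x ∈ D.bag p) : x < D.N := by
  have h1 := window_le hp
  have h2 := letters_le hp
  rw [mem_bag] at hx
  simp only [N, U, V] at *
  omega

theorem mem_bag_of_mem_clauses {p : ℕ} {C : List (ℕ × Bool)} (hC : C ∈ D.clauses p)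
    {l : ℕ × Bool} (hl : l ∈ C) : l.1 ∈ D.bag p := by
  rw [mem_clauses] at hC
  rw [mem_bag]
  have e : (D.k + 1) * D.L = D.k * D.L + D.L := Nat.succ_mul _ _
  have e' := add_mul (p / D.E) D.k D.L
  rcases hC with rfl | rfl | ⟨b, hb, rfl⟩ | ⟨b, hb, rfl⟩ | ⟨b, hb, rfl⟩
  · simp only [pick, List.mem_cons, List.not_mem_nil, or_false] at hl
    rcases hl with rfl | rfl | rfl
    · split <;> simp [U]
    · simp
    · split <;> simp [U]
  all_goals
    simp only [List.mem_cons, List.not_mem_nil, or_false] at hl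
    rcases hl with rfl | rfl
    · simp
    · first | simp; done | (simp only []; omega)

theorem bag_nodup {p : ℕ} (hp : p < D.T) : (D.bag p).Nodup := by
  have h1 := window_le hp
  have h2 := letters_le hp
  have hinj : ∀ c : ℕ, Function.Injective fun x => c + x := fun c => add_right_injective c
  simp only [bag, ← add_assoc]
  refine List.Nodup.append (List.Nodup.append (List.nodup_range.map (hinj _))
    (List.nodup_range.map (hinj _)) ?_) ?_ ?_
  · intro x hx hy
    simp only [List.mem_map, List.mem_range] at hx hy
    obtain ⟨a, ha, rfl⟩ := hx
    obtain ⟨b, hb, e⟩ := hy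
    omega
  · simp [U, V]; omega
  · intro x hx hy
    simp only [List.mem_append, List.mem_map, List.mem_range, List.mem_cons, List.not_mem_nil,
      or_false, U, V] at hx hy
    rcases hx with ⟨a, ha, rfl⟩ | ⟨a, ha, rfl⟩ <;> omega

/-- Each of the four groups of variables is met by the bags in an interval that moves to the
right. -/
theorem bag_convex {p q r x : ℕ} (hpq : p ≤ q) (hqr : q ≤ r) (hr : r < D.T) (hxp : x ∈ D.bag p)
    (hxr : x ∈ D.bag r) : x ∈ D.bag q := by
  have m1 : ∀ {a b : ℕ}, a ≤ b → a / D.E * D.L ≤ b / D.E * D.L := fun h =>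
    Nat.mul_le_mul_right _ (Nat.div_le_div_right h)
  have m2 : ∀ {a b : ℕ}, a ≤ b → a / D.E / D.k * D.s ≤ b / D.E / D.k * D.s := fun h =>
    Nat.mul_le_mul_right _ (Nat.div_le_div_right (Nat.div_le_div_right h))
  have a1 := m1 hpq
  have a2 := m1 hqr
  have b1 := m2 hpq
  have b2 := m2 hqr
  have h1 := window_le hr
  have h2 := letters_le hr
  rw [mem_bag] at hxp hxr ⊢
  simp only [U, V] at *
  omega

theorem exists_mem_bag (hk : 0 < D.k) (hE : 0 < D.E) {x : ℕ} (hx : x < D.N) :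
    ∃ p < D.T, x ∈ D.bag p := by
  have hT : 0 < D.T := Nat.mul_pos (Nat.mul_pos (Nat.succ_pos _) hk) hE
  by_cases h1 : x < D.NX
  · have hL : 0 < D.L := Nat.pos_of_ne_zero fun h => by simp [NX, h] at h1
    have hj : x / D.L < (D.ℓ + 2) * D.k := Nat.div_lt_of_lt_mul (by rw [mul_comm]; exact h1)
    have e2 : (D.ℓ + 2) * D.k = (D.ℓ + 1) * D.k + D.k := Nat.succ_mul _ _
    have hpos : 0 < (D.ℓ + 1) * D.k := Nat.mul_pos (Nat.succ_pos _) hk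
    obtain ⟨j, hj1, hj2, hj3⟩ : ∃ j < (D.ℓ + 1) * D.k, j ≤ x / D.L ∧ x / D.L < j + (D.k + 1) := by
      by_cases h : x / D.L < (D.ℓ + 1) * D.k
      · exact ⟨_, h, le_rfl, by omega⟩
      · exact ⟨(D.ℓ + 1) * D.k - 1, by omega, by omega, by omega⟩
    refine ⟨j * D.E, Nat.mul_lt_mul_of_pos_right hj1 hE, mem_bag.2 (Or.inl ?_)⟩
    rw [Nat.mul_div_cancel _ hE, ← add_mul]
    exact ⟨(Nat.mul_le_mul_right _ hj2).trans (Nat.div_mul_le_self _ _),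
      (Nat.div_lt_iff_lt_mul hL).1 hj3⟩
  by_cases h2 : x < D.NX + D.NA
  · have hs : 0 < D.s := Nat.pos_of_ne_zero fun h => by simp [NA, h] at h2; omega
    have ht : (x - D.NX) / D.s < D.ℓ + 1 :=
      Nat.div_lt_of_lt_mul (by rw [mul_comm]; change _ < D.NA; omega)
    refine ⟨(x - D.NX) / D.s * D.k * D.E,
      Nat.mul_lt_mul_of_pos_right (Nat.mul_lt_mul_of_pos_right ht hk) hE,
      mem_bag.2 (Or.inr (Or.inl ?_))⟩
    rw [Nat.mul_div_cancel _ hE, Nat.mul_div_cancel _ hk]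
    have := Nat.div_mul_le_self (x - D.NX) D.s
    have := Nat.lt_div_mul_add (a := x - D.NX) hs
    omega
  by_cases h3 : x < D.NX + D.NA + D.T
  · exact ⟨x - (D.NX + D.NA), by omega, mem_bag.2 (by simp only [U]; omega)⟩
  by_cases h4 : x = D.NX + D.NA + D.T
  · exact ⟨D.T - 1, by omega, mem_bag.2 (by simp only [U]; omega)⟩
  · refine ⟨x - (D.NX + D.NA + (D.T + 1)), ?_, mem_bag.2 (by simp only [V]; omega)⟩
    simp only [N] at hx
    omega

theorem N_pos : 0 < D.N := by simp only [N]; omega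

variable (D)

/-- A number as a variable; the reduction modulo `N` has no effect. -/
def toFin (x : ℕ) : Fin D.N := ⟨x % D.N, Nat.mod_lt _ N_pos⟩

/-- The formula. -/
def formula : CNF D.N :=
  (List.range D.T).flatMap fun p => (D.clauses p).map fun C => C.map fun l => (D.toFin l.1, l.2)

/-- The path decomposition of the formula. -/
def bags : List (List (Fin D.N)) := (List.range D.T).map fun p => (D.bag p).map D.toFin

variable {D}

theorem toFin_val {x : ℕ} (hx : x < D.N) : (D.toFin x).val = x := Nat.mod_eq_of_lt hx

theorem mem_bags_iff {p : ℕ} (hp : p < D.T) (x : Fin D.N) :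
    x ∈ (D.bag p).map D.toFin ↔ x.val ∈ D.bag p := by
  rw [List.mem_map]
  constructor
  · rintro ⟨y, hy, rfl⟩
    rwa [toFin_val (bag_lt hp hy)]
  · exact fun h => ⟨_, h, Fin.ext (toFin_val x.2)⟩

theorem isThreeCNF_formula : D.formula.IsThreeCNF := by
  intro C hC
  simp only [formula, List.mem_flatMap, List.mem_map] at hC
  obtain ⟨p, -, C', hC', rfl⟩ := hC
  simpa using length_le_three hC'

theorem bags_nodup : ∀ X ∈ D.bags, X.Nodup := by
  intro X hX
  simp only [bags, List.mem_map, List.mem_range] at hX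
  obtain ⟨p, hp, rfl⟩ := hX
  refine (bag_nodup hp).map_on fun x hx y hy h => ?_
  rw [← toFin_val (bag_lt hp hx), ← toFin_val (bag_lt hp hy), h]

theorem isPathDecomposition_bags (hk : 0 < D.k) (hE : 0 < D.E) :
    IsPathDecomposition D.formula.primalGraph (D.bags.map List.toFinset) := by
  have hmem : ∀ p (hp : p < D.T) (x : Fin D.N),
      x ∈ ((D.bag p).map D.toFin).toFinset ↔ x.val ∈ D.bag p := fun p hp x => by
    rw [List.mem_toFinset, mem_bags_iff hp]
  have hin : ∀ p < D.T, ((D.bag p).map D.toFin).toFinset ∈ D.bags.map List.toFinset :=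
    fun p hp => List.mem_map_of_mem (List.mem_map_of_mem (List.mem_range.2 hp))
  refine ⟨fun x => ?_, fun x y hxy => ?_, ?_⟩
  · obtain ⟨p, hp, h⟩ := exists_mem_bag hk hE x.2
    exact ⟨_, hin p hp, (hmem p hp x).2 h⟩
  · obtain ⟨-, C, hC, ⟨l, hl, rfl⟩, ⟨l', hl', rfl⟩⟩ := hxy
    simp only [formula, List.mem_flatMap, List.mem_map, List.mem_range] at hC
    obtain ⟨p, hp, C', hC', rfl⟩ := hC
    rw [List.mem_map] at hl hl'
    obtain ⟨m, hm, rfl⟩ := hl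
    obtain ⟨m', hm', rfl⟩ := hl'
    refine ⟨_, hin p hp, ?_, ?_⟩ <;>
    · rw [List.mem_toFinset]
      exact List.mem_map_of_mem (mem_bag_of_mem_clauses hC' ‹_›)
  · rintro ⟨i, hi⟩ ⟨j, hj⟩ ⟨r, hr⟩ hij hjr x
    simp only [bags, List.length_map, List.length_range] at hi hj hr
    simp only [List.get_eq_getElem, bags, List.getElem_map, List.getElem_range]
    rw [hmem _ hi, hmem _ hj, hmem _ hr]
    exact bag_convex hij hjr hr

theorem width_bags_le : width (D.bags.map List.toFinset) ≤ (D.k + 1) * D.L + D.s + 2 := by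
  have : ((D.bags.map List.toFinset).map Finset.card).foldr max 0 ≤ (D.k + 1) * D.L + D.s + 3 := by
    have h : ∀ l : List ℕ, (∀ x ∈ l, x ≤ (D.k + 1) * D.L + D.s + 3) →
        l.foldr max 0 ≤ (D.k + 1) * D.L + D.s + 3 := by
      intro l
      induction l with
      | nil => simp
      | cons a l ih =>
        intro h
        rw [List.foldr_cons]
        exact max_le (h a (by simp)) (ih fun x hx => h x (by simp [hx]))
    refine h _ fun x hx => ?_
    simp only [bags, List.mem_map] at hx
    obtain ⟨_, ⟨_, ⟨p, -, rfl⟩, rfl⟩, rfl⟩ := hx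
    refine (List.toFinset_card_le _).trans ?_
    rw [List.length_map, length_bag]
  rw [width]
  omega

theorem satisfiable_formula : D.formula.Satisfiable ↔
    ∃ σ : ℕ → Bool, ∀ p < D.T, ∀ C ∈ D.clauses p, ∃ l ∈ C, σ l.1 = l.2 := by
  constructor
  · rintro ⟨σ, h⟩
    refine ⟨fun x => σ (D.toFin x), fun p hp C hC => ?_⟩
    obtain ⟨l, hl, e⟩ := h (C.map fun l => (D.toFin l.1, l.2)) (by
      simp only [formula, List.mem_flatMap, List.mem_range]
      exact ⟨p, hp, List.mem_map_of_mem hC⟩)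
    obtain ⟨m, hm, rfl⟩ := List.mem_map.1 hl
    exact ⟨m, hm, e⟩
  · rintro ⟨σ, h⟩
    refine ⟨fun x => σ x.val, fun C hC => ?_⟩
    simp only [formula, List.mem_flatMap, List.mem_map, List.mem_range] at hC
    obtain ⟨p, hp, C', hC', rfl⟩ := hC
    obtain ⟨l, hl, e⟩ := h p hp C' hC'
    refine ⟨_, List.mem_map_of_mem hl, ?_⟩
    change σ (D.toFin l.1).val = l.2
    rwa [toFin_val (bag_lt hp (mem_bag_of_mem_clauses hC' hl))]

/-- The formula says that in every round every automaton picks a permitted option, `f j` for the pair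
`j` of a round and an automaton, which fits to the bits `x` of the states and to the letters `a` in
unary. -/
theorem formula_satisfiable_iff (hE : 0 < D.E) : D.formula.Satisfiable ↔
    ∃ (x a : ℕ → Bool) (f : ℕ → ℕ), ∀ j < (D.ℓ + 1) * D.k, f j < D.E ∧
      D.ok (j / D.k) (j % D.k) (f j) = true ∧
      (∀ b < D.L, x (j * D.L + b) = (D.src (j % D.k) (f j)).testBit b) ∧
      (∀ c < D.s, a (j / D.k * D.s + c) = decide (c = D.letter (j % D.k) (f j))) ∧
      (∀ b < D.L, x ((j + D.k) * D.L + b) = (D.tgt (j % D.k) (f j)).testBit b) := by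
  rw [satisfiable_formula]
  constructor
  · rintro ⟨σ, h⟩
    have key : ∀ j < (D.ℓ + 1) * D.k, ∃ e < D.E, σ (D.V (j * D.E + e)) = true := by
      intro j hj
      by_contra! hno
      have hlt : ∀ e < D.E, j * D.E + e < D.T := fun e he => by
        have := Nat.mul_le_mul_right D.E hj
        rw [Nat.succ_mul] at this
        exact lt_of_lt_of_le (by omega) this
      -- the last clause of the chain contradicts the variable that the others push along the chain
      have hU : ∀ e < D.E, e + 1 ≠ D.E ∧ σ (D.U (j * D.E + e + 1)) = true := by
        intro e
        induction e with
        | zero =>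
          intro he
          have := h _ (hlt 0 he) _ (mem_clauses.2 (Or.inl rfl))
          have hV := Bool.eq_false_of_not_eq_true (hno 0 he)
          simp only [add_zero] at hV this ⊢
          simp only [pick, Nat.mul_mod_left, if_true, zero_add, List.mem_cons,
            List.not_mem_nil, or_false, exists_eq_or_imp, exists_eq_left, hV, Bool.false_eq_true, false_or] at this
          split at this
          · simp [hV] at this
          · exact ⟨by omega, this⟩
        | succ e ih =>
          intro he
          have hU := (ih (by omega)).2
          have := h _ (hlt _ he) _ (mem_clauses.2 (Or.inl rfl))
          have hV := Bool.eq_false_of_not_eq_true (hno _ he)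
          simp only [pick, Nat.mul_add_mod_self_right, Nat.mod_eq_of_lt he, Nat.succ_ne_zero,
            if_false, List.mem_cons,
            List.not_mem_nil, or_false, exists_eq_or_imp, exists_eq_left, hV, Bool.false_eq_true, false_or] at this
          rw [← add_assoc] at this ⊢
          rw [hU] at this
          split at this
          · simp [show σ (D.V (j * D.E + e + 1)) = false from hV] at this
          · exact ⟨by omega, by simpa using this⟩
      exact (hU (D.E - 1) (by omega)).1 (by omega)
    choose! f hf hV using key
    refine ⟨σ, fun y => σ (D.NX + y), f, fun j hj => ?_⟩
    have hp : j * D.E + f j < D.T := by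
      have := Nat.mul_le_mul_right D.E hj
      rw [Nat.succ_mul] at this
      exact lt_of_lt_of_le (Nat.add_lt_add_left (hf j hj) _) this
    have e1 : (j * D.E + f j) / D.E = j := by
      rw [mul_comm, Nat.mul_add_div hE, Nat.div_eq_of_lt (hf j hj), add_zero]
    have e2 : (j * D.E + f j) % D.E = f j := by
      rw [Nat.mul_add_mod_self_right, Nat.mod_eq_of_lt (hf j hj)]
    have hV' := hV j hj
    have hC := fun C hC => h _ hp C (mem_clauses.2 hC)
    rw [e1, e2] at hC
    have two : ∀ (y : ℕ) (v : Bool), (∃ l ∈ [(D.V (j * D.E + f j), false), (y, v)],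
        σ l.1 = l.2) → σ y = v := by
      intro y v
      simp [hV']
    refine ⟨hf j hj, ?_, fun b hb => two _ _ (hC _ (Or.inr (Or.inr (Or.inl ⟨b, hb, rfl⟩)))),
      fun c hc => two _ _ (hC _ (Or.inr (Or.inr (Or.inr (Or.inl ⟨c, hc, rfl⟩))))),
      fun b hb => two _ _ (hC _ (Or.inr (Or.inr (Or.inr (Or.inr ⟨b, hb, rfl⟩)))))⟩
    exact (two _ _ (hC _ (Or.inr (Or.inl rfl)))).symm.trans hV'
  · rintro ⟨x, a, f, h⟩
    -- the four cases are the four groups of variables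
    refine ⟨fun y => if y < D.NX then x y else if y < D.NX + D.NA then a (y - D.NX) else
      if y ≤ D.NX + D.NA + D.T then
        decide ((y - (D.NX + D.NA)) % D.E ≤ f ((y - (D.NX + D.NA)) / D.E)) else
        decide ((y - (D.NX + D.NA + (D.T + 1))) % D.E = f ((y - (D.NX + D.NA + (D.T + 1))) / D.E)),
      fun p hp => ?_⟩
    generalize hσ : (fun y => if y < D.NX then x y else if y < D.NX + D.NA then a (y - D.NX) else
      if y ≤ D.NX + D.NA + D.T then
        decide ((y - (D.NX + D.NA)) % D.E ≤ f ((y - (D.NX + D.NA)) / D.E)) else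
        decide ((y - (D.NX + D.NA + (D.T + 1))) % D.E =
          f ((y - (D.NX + D.NA + (D.T + 1))) / D.E))) = σ
    have hX : ∀ y < D.NX, σ y = x y := fun y hy => by rw [← hσ]; exact if_pos hy
    have hA : ∀ y < D.NA, σ (D.NX + y) = a y := fun y hy => by
      rw [← hσ]
      simp only [Nat.add_sub_cancel_left]
      rw [if_neg (by omega), if_pos (by omega)]
    have hU : ∀ q ≤ D.T, σ (D.U q) = decide (q % D.E ≤ f (q / D.E)) := fun q hq => by
      rw [← hσ]
      simp only [U, Nat.add_sub_cancel_left]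
      rw [if_neg (by omega), if_neg (by omega), if_pos (by omega)]
    have hV : ∀ q, σ (D.V q) = decide (q % D.E = f (q / D.E)) := fun q => by
      rw [← hσ]
      simp only [V, Nat.add_sub_cancel_left]
      rw [if_neg (by omega), if_neg (by omega), if_neg (by omega)]
    have h1 := window_le hp
    have h2 := letters_le hp
    obtain ⟨g1, g2, g3, g4, g5⟩ := h _ (block_lt hp)
    have e : (D.k + 1) * D.L = D.k * D.L + D.L := Nat.succ_mul _ _
    have e' := add_mul (p / D.E) D.k D.L
    have hmod := Nat.mod_lt p hE
    intro C hC
    rw [mem_clauses] at hC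
    by_cases hpf : p % D.E = f (p / D.E)
    · have hVp : σ (D.V p) = true := by rw [hV]; simpa using hpf
      rcases hC with rfl | rfl | ⟨b, hb, rfl⟩ | ⟨c, hc, rfl⟩ | ⟨b, hb, rfl⟩
      · exact ⟨(D.V p, true), by simp [pick], hVp⟩
      · refine ⟨_, List.mem_cons_of_mem _ (List.mem_singleton_self _), ?_⟩
        simp only [hVp, hpf, g2]
      · refine ⟨_, List.mem_cons_of_mem _ (List.mem_singleton_self _), ?_⟩
        simp only [hpf, ← g3 b hb]
        exact hX _ (by omega)
      · refine ⟨_, List.mem_cons_of_mem _ (List.mem_singleton_self _), ?_⟩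
        simp only [hpf, ← g4 c hc]
        exact hA _ (by omega)
      · refine ⟨_, List.mem_cons_of_mem _ (List.mem_singleton_self _), ?_⟩
        simp only [hpf, ← g5 b hb]
        exact hX _ (by omega)
    · have hVp : σ (D.V p) = false := by rw [hV]; simpa using hpf
      rcases hC with rfl | rfl | ⟨b, hb, rfl⟩ | ⟨c, hc, rfl⟩ | ⟨b, hb, rfl⟩
      · by_cases hle : p % D.E ≤ f (p / D.E)
        · have hne : p % D.E + 1 ≠ D.E := by omega
          refine ⟨(D.U (p + 1), true), by simp [pick, hne], ?_⟩
          have hlt : p % D.E + 1 < D.E := by omega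
          have ep : p + 1 = D.E * (p / D.E) + (p % D.E + 1) := by
            have := Nat.div_add_mod p D.E
            omega
          change σ (D.U (p + 1)) = true
          rw [hU _ hp, Nat.succ_eq_add_one, ep, Nat.mul_add_mod, Nat.mod_eq_of_lt hlt, Nat.mul_add_div hE,
            Nat.div_eq_of_lt hlt, add_zero]
          exact decide_eq_true (by omega)
        · have hne : p % D.E ≠ 0 := by omega
          refine ⟨(D.U p, false), by simp [pick, hne], ?_⟩
          rw [hU _ hp.le]
          exact decide_eq_false hle
      all_goals exact ⟨_, List.mem_cons_self, hVp⟩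

end Tableau

/-! ### The formula of a family of automata -/

namespace FA

variable {k s n : ℕ}

/-- The options of an automaton in a round, as a source state, a letter and a target state: to use
an arc, or to stay in a state without reading a letter. The latter is written with the number `s`
in place of a letter. The options of the second kind begin with the number `n * s * n`, which is
an upper bound for the number of arcs. -/
def option (M : FA s n) (e : ℕ) : ℕ × ℕ × ℕ :=
  if h : e < M.arcs.length then (M.arcs[e].1.val, M.arcs[e].2.1.val, M.arcs[e].2.2.val)
  else (e - n * s * n, s, e - n * s * n)

/-- An option must exist; in round `0` it must begin in the initial state, and in round `ℓ` it must
be to stay in an accepting state. -/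
def Permitted (M : FA s n) (ℓ t e : ℕ) : Prop :=
  (e < M.arcs.length ∨ n * s * n ≤ e) ∧ (t ≠ 0 ∨ (M.option e).1 = M.start) ∧
    (t ≠ ℓ ∨ (n * s * n ≤ e ∧ ∃ h : (M.option e).1 < n, M.accept ⟨_, h⟩ = true))

open Classical in
/-- The tableau of a family of automata. -/
noncomputable def tableau (ℓ L : ℕ) (M : Fin k → FA s n) : Tableau where
  k := k
  s := s
  L := L
  E := n * s * n + n
  ℓ := ℓ
  src i e := if h : i < k then ((M ⟨i, h⟩).option e).1 else 0
  letter i e := if h : i < k then ((M ⟨i, h⟩).option e).2.1 else 0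
  tgt i e := if h : i < k then ((M ⟨i, h⟩).option e).2.2 else 0
  ok t i e := decide (∃ h : i < k, (M ⟨i, h⟩).Permitted ℓ t e)

theorem length_arcs_le (M : FA s n) : M.arcs.length ≤ n * s * n := by
  simpa [mul_assoc] using M.nodup.length_le_card

theorem option_arc {M : FA s n} {e : ℕ} (h : e < M.arcs.length) :
    M.option e = (M.arcs[e].1.val, M.arcs[e].2.1.val, M.arcs[e].2.2.val) := dif_pos h

theorem option_stay (M : FA s n) (q : ℕ) : M.option (n * s * n + q) = (q, s, q) := by
  have := M.length_arcs_le
  rw [option, dif_neg (by omega), Nat.add_sub_cancel_left]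

theorem exists_run (M : FA s n) (w : List (Fin s)) {q : Fin n} (h : q ∈ M.toNFA.eval w) :
    ∃ r : ℕ → Fin n, r 0 = M.start ∧ r w.length = q ∧
      ∀ t (ht : t < w.length), (r t, w[t], r (t + 1)) ∈ M.arcs := by
  induction w using List.reverseRecOn generalizing q with
  | nil => exact ⟨fun _ => q, h, rfl, by simp⟩
  | append_singleton w a ih =>
    rw [NFA.eval_append_singleton, NFA.mem_stepSet] at h
    obtain ⟨p, hp, hpq⟩ := h
    obtain ⟨r, h0, h1, h2⟩ := ih hp
    refine ⟨Function.update r (w.length + 1) q, ?_, by simp, fun t ht => ?_⟩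
    · rw [Function.update_of_ne (by omega), h0]
    · rw [List.length_append, List.length_singleton] at ht
      rw [Function.update_of_ne (by omega)]
      rcases Nat.lt_succ_iff_lt_or_eq.1 ht with ht | rfl
      · rw [Function.update_of_ne (by omega), List.getElem_append_left ht]
        exact h2 t ht
      · have hpq' : (p, a, q) ∈ M.arcs := hpq
        simpa [h1] using hpq'

/-- A run on a string is continued by staying in its last state. -/
theorem exists_option_of_run (M : FA s n) {w : List (Fin s)} {r : ℕ → Fin n}
    (hr : ∀ t (ht : t < w.length), (r t, w[t], r (t + 1)) ∈ M.arcs) (t : ℕ) :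
    ∃ e < n * s * n + n, M.option e = ((r (min t w.length)).val,
      if h : t < w.length then w[t].val else s, (r (min (t + 1) w.length)).val) ∧
      (e < M.arcs.length ∨ n * s * n ≤ e) ∧ (w.length ≤ t → n * s * n ≤ e) := by
  by_cases ht : t < w.length
  · obtain ⟨e, he, h⟩ := List.mem_iff_getElem.1 (hr t ht)
    have := M.length_arcs_le
    refine ⟨e, by omega, ?_, Or.inl he, by omega⟩
    rw [option_arc he, h, dif_pos ht, min_eq_left ht.le, min_eq_left ht]
  · refine ⟨n * s * n + (r w.length).val, by have := (r w.length).2; omega, ?_,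
      Or.inr (Nat.le_add_right _ _), fun _ => Nat.le_add_right _ _⟩
    rw [option_stay, dif_neg ht, min_eq_right (by omega), min_eq_right (by omega)]

theorem option_lt (M : FA s n) {e : ℕ} (he : e < n * s * n + n)
    (h : e < M.arcs.length ∨ n * s * n ≤ e) :
    (M.option e).1 < n ∧ (M.option e).2.1 ≤ s ∧ (M.option e).2.2 < n := by
  rcases h with h | h
  · rw [option_arc h]
    exact ⟨Fin.is_lt _, (Fin.is_lt _).le, Fin.is_lt _⟩
  · obtain ⟨q, rfl⟩ := Nat.exists_eq_add_of_le h
    rw [option_stay]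
    exact ⟨by simpa using he, le_rfl, by simpa using he⟩

/-- Following a permitted option keeps the state reachable. -/
theorem eval_option (M : FA s n) {e : ℕ} (he : e < n * s * n + n)
    (h : e < M.arcs.length ∨ n * s * n ≤ e) {w : List (Fin s)} {q r : Fin n} {a : ℕ}
    (hq : q ∈ M.toNFA.eval w) (ho : M.option e = (q.val, a, r.val)) :
    r ∈ M.toNFA.eval (w ++ if h : a < s then [⟨a, h⟩] else []) := by
  rcases h with h | h
  · rw [option_arc h, Prod.mk.injEq, Prod.mk.injEq] at ho
    obtain ⟨h1, h2, h3⟩ := ho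
    subst h2
    rw [dif_pos (Fin.is_lt _), NFA.eval_append_singleton, NFA.mem_stepSet]
    refine ⟨q, hq, ?_⟩
    change (q, _, r) ∈ M.arcs
    rw [← Fin.ext h1, ← Fin.ext h3]
    exact List.getElem_mem h
  · obtain ⟨p, rfl⟩ := Nat.exists_eq_add_of_le h
    rw [option_stay, Prod.mk.injEq, Prod.mk.injEq] at ho
    obtain ⟨h1, rfl, h3⟩ := ho
    rw [dif_neg (lt_irrefl _), List.append_nil, ← Fin.ext (h1.symm.trans h3)]
    exact hq

open Classical in
/-- The rounds in which the automata stay may be anywhere. As the variables for letters are shared,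
all automata stay in the same rounds, and the letters of the other rounds form a common string. -/
theorem tableau_satisfiable_iff {ℓ L : ℕ} {M : Fin k → FA s n} (hk : 0 < k) (hn : 0 < n)
    (hL : n ≤ 2 ^ L) :
    (tableau ℓ L M).formula.Satisfiable ↔ IntersectionNonempty ℓ M := by
  rw [Tableau.formula_satisfiable_iff (by change 0 < n * s * n + n; omega)]
  change (∃ (x a : ℕ → Bool) (f : ℕ → ℕ), ∀ j < (ℓ + 1) * k, f j < n * s * n + n ∧
      decide (∃ h : j % k < k, (M ⟨j % k, h⟩).Permitted ℓ (j / k) (f j)) = true ∧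
      (∀ b < L, x (j * L + b) =
        (if h : j % k < k then ((M ⟨j % k, h⟩).option (f j)).1 else 0).testBit b) ∧
      (∀ c < s, a (j / k * s + c) =
        decide (c = if h : j % k < k then ((M ⟨j % k, h⟩).option (f j)).2.1 else 0)) ∧
      (∀ b < L, x ((j + k) * L + b) =
        (if h : j % k < k then ((M ⟨j % k, h⟩).option (f j)).2.2 else 0).testBit b)) ↔ _
  constructor
  · rintro ⟨x, a, f, h⟩
    have H : ∀ t ≤ ℓ, ∀ i : Fin k, f (t * k + i) < n * s * n + n ∧
        (M i).Permitted ℓ t (f (t * k + i)) ∧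
        (∀ b < L, x ((t * k + i) * L + b) = ((M i).option (f (t * k + i))).1.testBit b) ∧
        (∀ c < s, a (t * s + c) = decide (c = ((M i).option (f (t * k + i))).2.1)) ∧
        (∀ b < L, x (((t + 1) * k + i) * L + b) =
          ((M i).option (f (t * k + i))).2.2.testBit b) := by
      intro t ht i
      have hlt : t * k + i < (ℓ + 1) * k := by
        have := Nat.mul_le_mul_right k (by omega : t + 1 ≤ ℓ + 1)
        have := i.2
        have := add_mul t 1 k
        omega
      have e1 : (t * k + i) / k = t := by
        rw [mul_comm, Nat.mul_add_div hk, Nat.div_eq_of_lt i.2, add_zero]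
      have e2 : (t * k + i) % k = i := by rw [Nat.mul_add_mod_self_right, Nat.mod_eq_of_lt i.2]
      have := h _ hlt
      simp only [e1, e2, Fin.is_lt, dif_pos, Fin.eta, exists_true_left, decide_eq_true_eq] at this
      have e3 : (t + 1) * k + i = t * k + i + k := by rw [Nat.succ_mul]; omega
      rw [e3]
      exact this
    clear h
    have hlt := fun t ht i => (M i).option_lt (H t ht i).1 (H t ht i).2.1.1
    have hnext : ∀ t < ℓ, ∀ i : Fin k,
        ((M i).option (f ((t + 1) * k + i))).1 = ((M i).option (f (t * k + i))).2.2 := by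
      intro t ht i
      refine Nat.eq_of_testBit_eq fun b => ?_
      by_cases hb : b < L
      · rw [← (H t ht.le i).2.2.2.2 b hb, ← (H (t + 1) ht i).2.2.1 b hb]
      · have hb' := hL.trans (Nat.pow_le_pow_right (by norm_num : 0 < 2) (not_lt.1 hb))
        rw [Nat.testBit_lt_two_pow ((hlt (t + 1) ht i).1.trans_le hb'),
          Nat.testBit_lt_two_pow ((hlt t ht.le i).2.2.trans_le hb')]
    -- the variables for letters are shared, and a letter is determined by its unary representation
    have hletter : ∀ t ≤ ℓ, ∀ i i' : Fin k,
        ((M i).option (f (t * k + i))).2.1 = ((M i').option (f (t * k + i'))).2.1 := by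
      intro t ht
      have key : ∀ i i' : Fin k, ((M i).option (f (t * k + i))).2.1 < s →
          ((M i).option (f (t * k + i))).2.1 = ((M i').option (f (t * k + i'))).2.1 := by
        intro i i' hi
        have := (H t ht i).2.2.2.1 _ hi
        rw [(H t ht i').2.2.2.1 _ hi] at this
        simpa using this
      intro i i'
      have h1 := (hlt t ht i).2.1
      have h2 := (hlt t ht i').2.1
      rcases h1.lt_or_eq with h | h
      · exact key i i' h
      rcases h2.lt_or_eq with h' | h'
      · exact (key i' i h').symm
      · rw [h, h']
    let i₀ : Fin k := ⟨0, hk⟩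
    let c : ℕ → ℕ := fun t => ((M i₀).option (f (t * k + i₀))).2.1
    let u : ℕ → List (Fin s) := Nat.rec [] fun t u => u ++ if h : c t < s then [⟨c t, h⟩] else []
    have hu : ∀ t, (u t).length ≤ t := by
      intro t
      induction t with
      | zero => exact le_rfl
      | succ t ih =>
        change (u t ++ if h : c t < s then [(⟨c t, h⟩ : Fin s)] else []).length ≤ t + 1
        rw [List.length_append]
        split <;> simp <;> omega
    have hrun : ∀ i : Fin k, ∀ t (ht : t ≤ ℓ),
        (⟨((M i).option (f (t * k + i))).1, (hlt t ht i).1⟩ : Fin n) ∈ (M i).toNFA.eval (u t) := by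
      intro i t
      induction t with
      | zero =>
        intro ht
        change _ = _
        exact Fin.ext ((H 0 ht i).2.1.2.1.resolve_left (not_not.2 rfl))
      | succ t ih =>
        intro ht
        have := ih (by omega)
        refine (M i).eval_option (H t (by omega) i).1 (H t (by omega) i).2.1.1 this ?_
        simp only [hnext t ht i, c, ← hletter t (by omega) i i₀]
    refine ⟨u ℓ, hu ℓ, fun i => ?_⟩
    rw [NFA.mem_accepts]
    refine ⟨⟨((M i).option (f (ℓ * k + i))).1, (hlt ℓ le_rfl i).1⟩, ?_, hrun i ℓ le_rfl⟩
    exact ((H ℓ le_rfl i).2.1.2.2.resolve_left (not_not.2 rfl)).2.2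
  · rintro ⟨w, hw, hacc⟩
    have hr : ∀ i, ∃ r : ℕ → Fin n, r 0 = (M i).start ∧ (M i).accept (r w.length) = true ∧
        ∀ t (ht : t < w.length), (r t, w[t], r (t + 1)) ∈ (M i).arcs := by
      intro i
      have := hacc i
      rw [NFA.mem_accepts] at this
      obtain ⟨q, hq, h⟩ := this
      obtain ⟨r, h0, rfl, h2⟩ := (M i).exists_run w h
      exact ⟨r, h0, hq, h2⟩
    choose r hr0 hr1 hr2 using hr
    choose e he ho hx hp using fun i t => (M i).exists_option_of_run (hr2 i) t
    have hmod := fun j => Nat.mod_lt j hk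
    refine ⟨fun m => (r ⟨m / L % k, hmod _⟩ (min (m / L / k) w.length)).val.testBit (m % L),
      fun m => decide (m % s = if h : m / s < w.length then w[m / s].val else s),
      fun j => e ⟨j % k, hmod _⟩ (j / k), fun j hj => ⟨he _ _, ?_, ?_, ?_, ?_⟩⟩
    · refine decide_eq_true (Exists.intro (hmod j) ⟨hx _ _, ?_, ?_⟩)
      · rw [or_iff_not_imp_left, not_not]
        intro h
        rw [ho, h, Nat.zero_min, hr0]
      · rw [or_iff_not_imp_left, not_not]
        intro h
        refine ⟨hp _ _ (by omega), ?_⟩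
        simp only [ho, h, min_eq_right hw, Fin.is_lt, Fin.eta, exists_true_left, hr1]
    · intro b hb
      have hL0 : 0 < L := by omega
      have e1 : (j * L + b) / L = j := by
        rw [mul_comm, Nat.mul_add_div hL0, Nat.div_eq_of_lt hb, add_zero]
      have e2 : (j * L + b) % L = b := by rw [Nat.mul_add_mod_self_right, Nat.mod_eq_of_lt hb]
      rw [dif_pos (hmod j), ho]
      simp only [e1, e2]
    · intro c hc
      have hs0 : 0 < s := by omega
      have e1 : (j / k * s + c) / s = j / k := by
        rw [mul_comm, Nat.mul_add_div hs0, Nat.div_eq_of_lt hc, add_zero]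
      have e2 : (j / k * s + c) % s = c := by rw [Nat.mul_add_mod_self_right, Nat.mod_eq_of_lt hc]
      rw [dif_pos (hmod j), ho]
      simp only [e1, e2]
    · intro b hb
      have hL0 : 0 < L := by omega
      have e1 : ((j + k) * L + b) / L = j + k := by
        rw [mul_comm, Nat.mul_add_div hL0, Nat.div_eq_of_lt hb, add_zero]
      have e2 : ((j + k) * L + b) % L = b := by
        rw [Nat.mul_add_mod_self_right, Nat.mod_eq_of_lt hb]
      rw [dif_pos (hmod j), ho]
      simp only [e1, e2, Nat.add_div_right _ hk, Nat.add_mod_right]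

end FA

/-! ### Writing the formula of a family of automata -/

theorem getD_flatMap_triple {α : Type*} (f g h : α → ℕ) (l : List α) (r : List ℕ) {i : ℕ}
    (hi : i < l.length) :
    ((l.flatMap fun x => [f x, g x, h x]) ++ r).getD (3 * i) 0 = f l[i] ∧
    ((l.flatMap fun x => [f x, g x, h x]) ++ r).getD (3 * i + 1) 0 = g l[i] ∧
    ((l.flatMap fun x => [f x, g x, h x]) ++ r).getD (3 * i + 2) 0 = h l[i] := by
  induction l generalizing i with
  | nil => simp at hi
  | cons x l ih =>
    cases i with
    | zero => simp
    | succ i =>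
      have := ih (i := i) (by simpa using hi)
      simp only [List.flatMap_cons, List.cons_append, List.nil_append, mul_add, mul_one,
        List.getElem_cons_succ]
      exact this

theorem getD_append_add (l r : List ℕ) {m : ℕ} (hm : l.length = m) (i : ℕ) :
    (l ++ r).getD (m + i) 0 = r.getD i 0 := by
  subst hm
  rw [List.getD_append_right _ _ _ _ (Nat.le_add_right _ _), Nat.add_sub_cancel_left]

namespace FA

variable {s n : ℕ} (M : FA s n) (r : List ℕ)

theorem encode_append : M.encode ++ r = M.start.val ::
    (List.ofFn (fun q => if M.accept q then 1 else 0) ++ (M.arcs.length ::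
      ((M.arcs.flatMap fun e => [e.1.val, e.2.1.val, e.2.2.val]) ++ r))) := by
  simp [encode]

theorem encode_getD_start : (M.encode ++ r).getD 0 0 = M.start := by
  rw [encode_append, List.getD_cons_zero]

theorem encode_getD_accept {q : ℕ} (hq : q < n) :
    (M.encode ++ r).getD (1 + q) 0 = if M.accept ⟨q, hq⟩ then 1 else 0 := by
  rw [encode_append, add_comm, List.getD_cons_succ, List.getD_append _ _ _ _ (by simpa using hq),
    List.getD_eq_getElem _ _ (by simpa using hq), List.getElem_ofFn]

theorem encode_getD_length : (M.encode ++ r).getD (1 + n) 0 = M.arcs.length := by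
  rw [encode_append, add_comm, List.getD_cons_succ]
  exact getD_append_add _ _ (List.length_ofFn) 0

theorem encode_getD_arcs (i : ℕ) : (M.encode ++ r).getD (2 + n + i) 0 =
    ((M.arcs.flatMap fun e => [e.1.val, e.2.1.val, e.2.2.val]) ++ r).getD i 0 := by
  rw [encode_append, show 2 + n + i = n + (i + 1) + 1 by ring, List.getD_cons_succ,
    getD_append_add _ _ (List.length_ofFn), List.getD_cons_succ]

end FA

/-- Emit several numbers. -/
def Emitter.emits : List Expr → Emitter
  | [] => .nop
  | e :: l => .seq (.emit e) (emits l)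

@[simp] theorem Emitter.out_emits (w ρ : List ℕ) (l : List Expr) :
    (emits l).out w ρ = l.map fun e => e.eval w ρ := by
  induction l with
  | nil => rfl
  | cons e l ih => exact congrArg (e.eval w ρ :: ·) ih

namespace FAWord

open PathSETH.Expr

/-- The number of bits of a state. -/
def bitsE : Expr := call0 (find 0 (.inp 2) (le (.inp 2) (call1 pow2 (.var 1))))
/-- The position of the automaton `[i]` in the input word. -/
def autAt : Expr := .fold (.var 0) 4 (.var 2 + (2 + .inp 2 + 3 * .inp (.var 2 + (1 + .inp 2))))
/-- The initial state of the automaton `[i]`. -/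
def startE : Expr := .inp (call1 autAt (.var 0))
/-- Whether the state `q` of the automaton `i` is accepting, for `[i, q]`. -/
def acceptE : Expr := .inp (call1 autAt (.var 0) + (1 + .var 1))
/-- The number of arcs of the automaton `[i]`. -/
def numArcs : Expr := .inp (call1 autAt (.var 0) + (1 + .inp 2))
/-- The bound for the number of arcs of an automaton. -/
def arcBound : Expr := .inp 2 * .inp 1 * .inp 2
/-- The number of options. -/
def optE : Expr := arcBound + .inp 2
/-- The number of triples of a round, an automaton and an option. -/
def TE : Expr := (.inp 3 + 1) * .inp 0 * optE
/-- The number of the variables for bits of states. -/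
def NXE : Expr := (.inp 3 + 2) * .inp 0 * bitsE
/-- The number of the variables for letters. -/
def NAE : Expr := (.inp 3 + 1) * .inp 1
/-- The variable that tells whether no option before `p` has been picked. -/
def UE (p : Expr) : Expr := NXE + NAE + p
/-- The variable that tells whether `p` is picked. -/
def VE (p : Expr) : Expr := NXE + NAE + (TE + 1) + p
/-- The source state of the option `e` of the automaton `i`, for `[i, e]`. -/
def srcE : Expr :=
  .ite (lt (.var 1) (call1 numArcs (.var 0)))
    (.inp (call1 autAt (.var 0) + (2 + .inp 2 + 3 * .var 1))) (.var 1 - arcBound)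
/-- The letter of the option `e` of the automaton `i`, for `[i, e]`. -/
def letterE : Expr :=
  .ite (lt (.var 1) (call1 numArcs (.var 0)))
    (.inp (call1 autAt (.var 0) + (2 + .inp 2 + (3 * .var 1 + 1)))) (.inp 1)
/-- The target state of the option `e` of the automaton `i`, for `[i, e]`. -/
def tgtE : Expr :=
  .ite (lt (.var 1) (call1 numArcs (.var 0)))
    (.inp (call1 autAt (.var 0) + (2 + .inp 2 + (3 * .var 1 + 2)))) (.var 1 - arcBound)
/-- Whether the option `e` of the automaton `i` is permitted in the round `t`, for `[t, i, e]`. -/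
def okE : Expr :=
  .ite (and (or (lt (.var 2) (call1 numArcs (.var 1))) (le arcBound (.var 2)))
    (and (or (.var 0) (eq (call2 srcE (.var 1) (.var 2)) (call1 startE (.var 1))))
      (or (not (eq (.var 0) (.inp 3)))
        (and (le arcBound (.var 2)) (and (lt (call2 srcE (.var 1) (.var 2)) (.inp 2))
          (call2 acceptE (.var 1) (call2 srcE (.var 1) (.var 2)))))))) 1 0
/-- The pair of a round and an automaton to which `[p]` belongs. -/
def pairE : Expr := .var 0 / optE
/-- The round to which `[p]` belongs. -/
def roundE : Expr := pairE / .inp 0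
/-- The automaton to which `[p]` belongs. -/
def autE : Expr := pairE % .inp 0
/-- The option to which `[p]` belongs. -/
def choiceE : Expr := .var 0 % optE
/-- The binary digit number `b` of `x`. -/
def bitE (x b : Expr) : Expr := .ite (eq (x / call1 pow2 b % 2) 1) 1 0

/-- The emitter that writes the formula and its path decomposition. -/
def formulaWord : Emitter :=
  .seq (.emits [NXE + NAE + (TE + 1) + TE, TE * (2 + 2 * bitsE + .inp 1)]) <|
  .seq (.loop TE 3 <|
    .seq (.emits [.ite (eq choiceE 0) (VE (.var 0)) (UE (.var 0)), .ite (eq choiceE 0) 1 0,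
      VE (.var 0), 1, .ite (eq (choiceE + 1) optE) (VE (.var 0)) (UE (.var 0 + 1)), 1,
      2, VE (.var 0), 0, VE (.var 0), .call 3 ![roundE, autE, choiceE] okE]) <|
    .seq (.loop bitsE 2 <| .emits [VE (.var 0), 0, pairE * bitsE + .var 1,
      bitE (call2 srcE autE choiceE) (.var 1)]) <|
    .seq (.loop (.inp 1) 2 <| .emits [VE (.var 0), 0, NXE + (roundE * .inp 1 + .var 1),
      .ite (eq (.var 1) (call2 letterE autE choiceE)) 1 0]) <|
    .loop bitsE 2 <| .emits [VE (.var 0), 0, (pairE + .inp 0) * bitsE + .var 1,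
      bitE (call2 tgtE autE choiceE) (.var 1)]) <|
  .seq (.emit TE) <|
  .loop TE ((.inp 0 + 1) * bitsE + .inp 1 + 3) <|
    .seq (.loop ((.inp 0 + 1) * bitsE) (pairE * bitsE + .var 1) .nop) <|
    .seq (.loop (.inp 1) (NXE + (roundE * .inp 1 + .var 1)) .nop) <|
    .emits [UE (.var 0), UE (.var 0 + 1), VE (.var 0)]

variable {k s n ℓ : ℕ} {M : Fin k → FA s n}

/-- The number of bits of a state: the logarithm of `n`, rounded up. -/
noncomputable def bits (n : ℕ) : ℕ := search (fun v => n ≤ 2 ^ v) n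

theorem le_two_pow_bits (n : ℕ) : n ≤ 2 ^ bits n := by
  rcases (search_spec (fun v => n ≤ 2 ^ v) n).2 with h | h
  · change n ≤ 2 ^ search _ n
    rw [h]
    exact Nat.lt_two_pow_self.le
  · exact h.2

theorem two_pow_bits_le (hn : 1 ≤ n) : 2 ^ bits n ≤ 2 * n := by
  have h := (search_spec (fun v => n ≤ 2 ^ v) n).1
  change ∀ v < bits n, _ at h
  cases hb : bits n with
  | zero => simp; omega
  | succ b =>
    have := h b (by omega)
    rw [pow_succ]
    omega

theorem bits_le : bits n ≤ n := search_le _ _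

theorem encodeFAs_eq : encodeFAs ℓ M = [k, s, n, ℓ] ++ (List.ofFn M).flatMap FA.encode := rfl

theorem getD_k : (encodeFAs ℓ M).getD 0 0 = k := rfl
theorem getD_s : (encodeFAs ℓ M).getD 1 0 = s := rfl
theorem getD_n : (encodeFAs ℓ M).getD 2 0 = n := rfl
theorem getD_l : (encodeFAs ℓ M).getD 3 0 = ℓ := rfl

theorem n_le_size : n ≤ size (encodeFAs ℓ M) := getD_le_size (encodeFAs ℓ M) 2

theorem eval_bitsE (ρ : List ℕ) : bitsE.eval (encodeFAs ℓ M) ρ = bits n := by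
  rw [bitsE, eval_call0, eval_find (d := 0) (ρ := []) (P := fun v => n ≤ 2 ^ v) rfl]
  · rfl
  · exact n_le_size
  · intro v x hx
    have hx' : x < n := hx
    have h2 : pow2.eval (encodeFAs ℓ M) [x] = 2 ^ x := eval_pow2 (hx'.le.trans n_le_size)
    simp only [ne_eq, eval_le, not_not, eval_inp, eval_two, eval_call1, eval_var, List.nil_append,
      List.getD_cons_zero, List.getD_cons_succ, getD_n, h2]

theorem eval_autAt {i : ℕ} (hi : i < k) : ∃ r, (encodeFAs ℓ M).drop
    (autAt.eval (encodeFAs ℓ M) [i]) = (M ⟨i, hi⟩).encode ++ r := by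
  have key := fun c (hc : c ≤ (List.ofFn M).length) => iter_drop (f := FA.encode)
    (st := fun q => q + (2 + n + 3 * (encodeFAs ℓ M).getD (q + (1 + n)) 0)) (w := encodeFAs ℓ M)
    (rest := []) (xs := List.ofFn M) (p := 4) (by simp [encodeFAs_eq])
    (by simp [encodeFAs_eq]) (fun q x r _ h => by
      rw [getD_add_of_drop h, FA.encode_getD_length, length_encode, add_comm n 2]) (c := c) hc
  have e : autAt.eval (encodeFAs ℓ M) [i] =
      iter (fun _ q => q + (2 + n + 3 * (encodeFAs ℓ M).getD (q + (1 + n)) 0)) 4 i := by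
    have h4 : (4 : Expr).eval (encodeFAs ℓ M) [i] = 4 := rfl
    refine (eval_fold (fun _ q => q + (2 + n + 3 * (encodeFAs ℓ M).getD (q + (1 + n)) 0)) ?_
      (fun v hv => rfl) fun v hv => ?_).trans ?_
    · have : k ≤ size (encodeFAs ℓ M) := getD_le_size (encodeFAs ℓ M) 0
      simpa using hi.le.trans this
    · have hv' : v < i := by simpa using hv
      rw [h4]
      exact ((key (v + 1) (by rw [List.length_ofFn]; omega)).2.trans
        (SatWord.length_le_size _)).trans size_le_two_pow
    · rw [h4]; rfl
  rw [e]
  have hi' : i < (List.ofFn M).length := by simpa using hi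
  refine ⟨((List.ofFn M).drop (i + 1)).flatMap FA.encode ++ [], ?_⟩
  rw [(key i hi'.le).1, List.drop_eq_getElem_cons hi', List.flatMap_cons, List.append_assoc,
    List.getElem_ofFn]

theorem eval_startE {i : ℕ} (hi : i < k) :
    startE.eval (encodeFAs ℓ M) [i] = (M ⟨i, hi⟩).start := by
  obtain ⟨r, hr⟩ := eval_autAt (ℓ := ℓ) (M := M) hi
  have := getD_add_of_drop hr 0
  rw [FA.encode_getD_start] at this
  exact this

theorem eval_acceptE {i q : ℕ} (hi : i < k) (hq : q < n) :
    acceptE.eval (encodeFAs ℓ M) [i, q] = if (M ⟨i, hi⟩).accept ⟨q, hq⟩ then 1 else 0 := by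
  obtain ⟨r, hr⟩ := eval_autAt (ℓ := ℓ) (M := M) hi
  have := getD_add_of_drop hr (1 + q)
  rw [FA.encode_getD_accept _ _ hq] at this
  exact this

theorem eval_numArcs {i : ℕ} (hi : i < k) :
    numArcs.eval (encodeFAs ℓ M) [i] = (M ⟨i, hi⟩).arcs.length := by
  obtain ⟨r, hr⟩ := eval_autAt (ℓ := ℓ) (M := M) hi
  have := getD_add_of_drop hr (1 + n)
  rw [FA.encode_getD_length] at this
  exact this

theorem eval_arcBound (ρ : List ℕ) : arcBound.eval (encodeFAs ℓ M) ρ = n * s * n := rfl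

theorem eval_option {i : ℕ} (hi : i < k) (e : ℕ) :
    srcE.eval (encodeFAs ℓ M) [i, e] = ((M ⟨i, hi⟩).option e).1 ∧
    letterE.eval (encodeFAs ℓ M) [i, e] = ((M ⟨i, hi⟩).option e).2.1 ∧
    tgtE.eval (encodeFAs ℓ M) [i, e] = ((M ⟨i, hi⟩).option e).2.2 := by
  obtain ⟨r, hr⟩ := eval_autAt (ℓ := ℓ) (M := M) hi
  simp only [srcE, letterE, tgtE, eval_ite, ne_eq, eval_lt, not_not, eval_var, eval_call1,
    List.getD_cons_zero, List.getD_cons_succ, eval_numArcs hi, eval_inp, eval_add, eval_mul,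
    eval_one, eval_two, eval_three, eval_sub, eval_arcBound, getD_n, getD_s, getD_add_of_drop hr,
    FA.encode_getD_arcs]
  by_cases h : e < (M ⟨i, hi⟩).arcs.length
  · obtain ⟨h1, h2, h3⟩ := getD_flatMap_triple (fun e : Fin n × Fin s × Fin n => e.1.val)
      (fun e => e.2.1.val) (fun e => e.2.2.val) (M ⟨i, hi⟩).arcs r h
    rw [if_pos h, if_pos h, if_pos h, h1, h2, h3, FA.option_arc h]
    exact ⟨rfl, rfl, rfl⟩
  · rw [if_neg h, if_neg h, if_neg h, FA.option, dif_neg h]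
    exact ⟨rfl, rfl, rfl⟩

open Classical in
theorem eval_okE {i : ℕ} (hi : i < k) (t e : ℕ) :
    okE.eval (encodeFAs ℓ M) [t, i, e] = if (M ⟨i, hi⟩).Permitted ℓ t e then 1 else 0 := by
  simp only [okE, eval_ite, ne_eq, eval_and, eval_or, eval_not, eval_lt, eval_le, eval_eq, not_not,
    eval_var, eval_call1, eval_call2, List.getD_cons_zero, List.getD_cons_succ, eval_numArcs hi,
    eval_arcBound, (eval_option hi e).1, eval_startE hi, eval_inp, eval_three, eval_two, getD_n,
    getD_l, eval_one, eval_zero]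
  refine if_congr ?_ rfl rfl
  refine and_congr_right fun _ => and_congr_right fun _ => or_congr Iff.rfl
    (and_congr_right fun _ => ?_)
  constructor
  · rintro ⟨h1, h2⟩
    rw [eval_acceptE hi h1] at h2
    exact ⟨h1, by simpa using h2⟩
  · rintro ⟨h1, h2⟩
    refine ⟨h1, ?_⟩
    rw [eval_acceptE hi h1, if_pos h2]
    exact one_ne_zero

theorem eval_bitE {w ρ : List ℕ} {x b : Expr} (hb : b.eval w ρ ≤ size w) :
    (bitE x b).eval w ρ = if (x.eval w ρ).testBit (b.eval w ρ) then 1 else 0 := by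
  simp only [bitE, eval_ite, ne_eq, eval_eq, not_not, eval_mod, eval_div, eval_call1,
    eval_pow2 hb, eval_two, eval_one, eval_zero, Nat.testBit_eq_decide_div_mod_eq,
    decide_eq_true_eq]

end FAWord

/-- The input word for the formula of a tableau. -/
theorem Tableau.encodeSAT_formula (D : Tableau) : encodeSAT D.formula D.bags =
    [D.N, D.T * (2 + 2 * D.L + D.s)] ++
      (List.range D.T).flatMap (fun p => (D.clauses p).flatMap fun C =>
        C.length :: C.flatMap fun l => [l.1, if l.2 then 1 else 0]) ++ [D.T] ++
      (List.range D.T).flatMap fun p => (D.bag p).length :: D.bag p := by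
  have h1 : D.formula.length = D.T * (2 + 2 * D.L + D.s) := by
    simp [formula, length_clauses, List.length_flatMap]
  have h2 : D.bags.length = D.T := by simp [bags]
  have h3 : ∀ p < D.T, ∀ C ∈ D.clauses p, ∀ l ∈ C, (D.toFin l.1).val = l.1 :=
    fun p hp C hC l hl => toFin_val (bag_lt hp (mem_bag_of_mem_clauses hC hl))
  have hcongr : ∀ {α β : Type} {l : List α} {f g : α → List β}, (∀ x ∈ l, f x = g x) →
      l.flatMap f = l.flatMap g := fun h => by
    rw [List.flatMap_def, List.flatMap_def, List.map_congr_left h]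
  rw [encodeSAT, h1, h2]
  refine congr (congrArg _ (congr (congrArg _ (congrArg _ ?_)) rfl)) ?_
  · rw [formula, List.flatMap_assoc]
    refine hcongr fun p hp => ?_
    rw [List.flatMap_map]
    refine hcongr fun C hC => ?_
    rw [List.length_map, List.flatMap_map]
    congr 1
    refine hcongr fun l hl => ?_
    rw [h3 p (List.mem_range.1 hp) C hC l hl]
  · rw [bags, List.flatMap_map]
    refine hcongr fun p hp => ?_
    rw [List.length_map, List.map_map]
    congr 1
    refine (List.map_congr_left fun x hx => ?_).trans (List.map_id _)
    exact toFin_val (bag_lt (List.mem_range.1 hp) hx)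

namespace FAWord

open PathSETH.Expr

variable {k s n ℓ : ℕ} {M : Fin k → FA s n}

theorem eval_optE (ρ : List ℕ) : optE.eval (encodeFAs ℓ M) ρ = n * s * n + n := rfl

theorem eval_TE (ρ : List ℕ) :
    TE.eval (encodeFAs ℓ M) ρ = (FA.tableau ℓ (bits n) M).T := rfl

theorem eval_NXE (ρ : List ℕ) :
    NXE.eval (encodeFAs ℓ M) ρ = (FA.tableau ℓ (bits n) M).NX := by
  simp only [NXE, eval_mul, eval_add, eval_bitsE, eval_inp, eval_three, eval_two, eval_zero,
    getD_k, getD_l]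
  rfl

theorem eval_NAE (ρ : List ℕ) :
    NAE.eval (encodeFAs ℓ M) ρ = (FA.tableau ℓ (bits n) M).NA := rfl

theorem eval_UE (ρ : List ℕ) (p : Expr) :
    (UE p).eval (encodeFAs ℓ M) ρ =
      (FA.tableau ℓ (bits n) M).U (p.eval (encodeFAs ℓ M) ρ) := by
  simp only [UE, eval_add, eval_NXE, eval_NAE, Tableau.U]

theorem eval_VE (ρ : List ℕ) (p : Expr) :
    (VE p).eval (encodeFAs ℓ M) ρ =
      (FA.tableau ℓ (bits n) M).V (p.eval (encodeFAs ℓ M) ρ) := by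
  simp only [VE, eval_add, eval_NXE, eval_NAE, eval_TE, eval_one, Tableau.V]

theorem flatMap_congr_range {α : Type*} {f g : ℕ → List α} {N : ℕ} (h : ∀ x < N, f x = g x) :
    (List.range N).flatMap f = (List.range N).flatMap g := by
  rw [List.flatMap_def, List.flatMap_def,
    List.map_congr_left fun x hx => h x (List.mem_range.1 hx)]

/-- The emitter is a literal transcription of the formula. -/
theorem formulaWord_out (hk : 0 < k) :
    formulaWord.out (encodeFAs ℓ M) [] =
      encodeSAT (FA.tableau ℓ (bits n) M).formula (FA.tableau ℓ (bits n) M).bags := by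
  classical
  rw [Tableau.encodeSAT_formula]
  simp only [formulaWord, Emitter.out, Emitter.out_emits, List.map_cons, List.map_nil, eval_add,
    eval_mul, eval_NXE, eval_NAE, eval_TE, eval_UE, eval_VE, eval_bitsE, eval_one, eval_two,
    eval_three, eval_zero, eval_inp, eval_var, getD_k, getD_s, pairE, roundE, autE, choiceE,
    eval_div, eval_mod, eval_optE, List.nil_append, List.cons_append, List.getD_cons_zero,
    List.getD_cons_succ, SatWord.eval_call, List.ofFn_succ, List.ofFn_zero, Matrix.cons_val_zero,
    Matrix.cons_val_succ, eval_ite, ne_eq, eval_eq, not_not, eval_call2, ← List.map_eq_flatMap,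
    List.append_assoc]
  refine congrArg (List.cons _) (congrArg (List.cons _) (congr (congrArg _ ?_)
    (congrArg (List.cons _) ?_)))
  · refine flatMap_congr_range fun p _ => ?_
    have hi : p / (n * s * n + n) % k < k := Nat.mod_lt _ hk
    have ho := eval_option (ℓ := ℓ) (M := M) hi
    have hs : ∀ e, (FA.tableau ℓ (bits n) M).src (p / (n * s * n + n) % k) e =
        ((M ⟨_, hi⟩).option e).1 := fun e => dif_pos hi
    have hl : ∀ e, (FA.tableau ℓ (bits n) M).letter (p / (n * s * n + n) % k) e =
        ((M ⟨_, hi⟩).option e).2.1 := fun e => dif_pos hi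
    have ht : ∀ e, (FA.tableau ℓ (bits n) M).tgt (p / (n * s * n + n) % k) e =
        ((M ⟨_, hi⟩).option e).2.2 := fun e => dif_pos hi
    have hok : ∀ t e, (FA.tableau ℓ (bits n) M).ok t (p / (n * s * n + n) % k) e =
        decide ((M ⟨_, hi⟩).Permitted ℓ t e) := fun t e => by
      refine (decide_eq_decide.2 ⟨fun ⟨_, h⟩ => h, fun h => ⟨hi, h⟩⟩)
    have hE : (FA.tableau ℓ (bits n) M).E = n * s * n + n := rfl
    have hk' : (FA.tableau ℓ (bits n) M).k = k := rfl
    have hL : (FA.tableau ℓ (bits n) M).L = bits n := rfl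
    have hs' : (FA.tableau ℓ (bits n) M).s = s := rfl
    simp only [Tableau.clauses, Tableau.pick, hE, hk', hL, hs', hs, hl, ht, hok,
      List.flatMap_cons, List.flatMap_nil, List.flatMap_append, List.flatMap_map,
      List.length_cons, List.length_nil, List.cons_append, List.nil_append, List.append_assoc,
      eval_okE hi, (ho _).2.1, apply_ite Prod.fst, apply_ite Prod.snd, ite_self,
      Bool.false_eq_true, if_true, if_false, decide_eq_true_eq, zero_add, Nat.reduceAdd]
    have hbit : ∀ (x : Expr) (y c : ℕ), x.eval (encodeFAs ℓ M)
        [p / (n * s * n + n) % k, p % (n * s * n + n)] = y →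
        ((List.range (bits n)).flatMap fun v => [2, (FA.tableau ℓ (bits n) M).V p, 0, c + v,
          (bitE (call2 x (.var 0 / optE % .inp 0) (.var 0 % optE)) (.var 1)).eval
            (encodeFAs ℓ M) [p, v]]) =
        (List.range (bits n)).flatMap fun v => [2, (FA.tableau ℓ (bits n) M).V p, 0, c + v,
          if y.testBit v then 1 else 0] := fun x y c hx => by
      subst hx
      refine flatMap_congr_range fun v hv => ?_
      rw [eval_bitE]
      · simp only [eval_call2, eval_mod, eval_div, eval_optE, eval_var, eval_inp, eval_zero, getD_k,
          List.getD_cons_zero, List.getD_cons_succ]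
      · exact hv.le.trans (bits_le.trans n_le_size)
    have h01 : (if (if p % (n * s * n + n) = 0 then true else false) = true then 1 else 0) =
        if p % (n * s * n + n) = 0 then 1 else 0 := by split <;> rfl
    rw [h01, hbit _ _ _ (ho _).1, hbit _ _ _ (ho _).2.2]
  · refine flatMap_congr_range fun p _ => ?_
    rw [Tableau.length_bag, Tableau.bag]
    rw [List.append_assoc]
    rfl

end FAWord

/-! ### From formulas to automata: the running time -/

section FormulaSize

variable {k s n ℓ : ℕ} {M : Fin k → FA s n}

theorem sizeSAT_formula_le (D : Tableau) : sizeSAT D.formula D.bags ≤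
    D.N + (3 + D.T * (7 * (2 + 2 * D.L + D.s) + ((D.k + 1) * D.L + D.s + 4))) := by
  rw [sizeSAT, D.encodeSAT_formula]
  refine Nat.add_le_add_left ?_ _
  have h1 : ((List.range D.T).flatMap (fun p => (D.clauses p).flatMap fun C =>
      C.length :: C.flatMap fun l => [l.1, if l.2 then 1 else 0])).length ≤
      D.T * ((2 + 2 * D.L + D.s) * 7) := by
    refine (length_flatMap_le (b := (2 + 2 * D.L + D.s) * 7) fun p _ => ?_).trans
      (by rw [List.length_range])
    rw [← D.length_clauses p]
    refine length_flatMap_le fun C hC => ?_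
    have := Tableau.length_le_three hC
    rw [List.length_cons, SatWord.length_flatMap_pair]
    omega
  have h2 : ((List.range D.T).flatMap fun p => (D.bag p).length :: D.bag p).length ≤
      D.T * ((D.k + 1) * D.L + D.s + 4) := by
    refine (length_flatMap_le (b := (D.k + 1) * D.L + D.s + 4) fun p _ => ?_).trans
      (by rw [List.length_range])
    rw [List.length_cons, D.length_bag]
  simp only [List.length_append, List.length_cons, List.length_nil]
  rw [mul_add, mul_comm 7]
  omega

theorem sizeSAT_tableau_le (hn : 1 ≤ n) (hℓ : 1 ≤ ℓ) :
    sizeSAT (FA.tableau ℓ (FAWord.bits n) M).formula (FA.tableau ℓ (FAWord.bits n) M).bags ≤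
      (3 * k + 2 * s + 4 + 2 * (2 * (k * (s + 1))) +
        2 * (k * (s + 1)) * (8 * s + k + 33)) * (n * ℓ) ^ 4 := by
  refine (sizeSAT_formula_le _).trans ?_
  have hL : FAWord.bits n ≤ n := FAWord.bits_le
  simp only [Tableau.N, Tableau.NX, Tableau.NA, Tableau.T, FA.tableau]
  generalize FAWord.bits n = L at *
  have hnz : n ≤ n * ℓ := Nat.le_mul_of_pos_right _ hℓ
  have hℓz : ℓ ≤ n * ℓ := Nat.le_mul_of_pos_left _ hn
  generalize n * ℓ = z at *
  have hz : 1 ≤ z := hn.trans hnz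
  have hpow : ∀ i j, i ≤ j → z ^ i ≤ z ^ j := fun i j => Nat.pow_le_pow_right hz
  have hT : (ℓ + 1) * k * (n * s * n + n) ≤ 2 * (k * (s + 1)) * z ^ 3 := by
    have h1 : n * s * n + n ≤ (s + 1) * z ^ 2 := by
      have h2 : n * s * n ≤ z * s * z := by gcongr
      have h3 := hpow 1 2 (by norm_num)
      rw [pow_one] at h3
      calc _ ≤ z * s * z + z ^ 2 := by omega
        _ = _ := by ring
    calc _ ≤ (2 * z) * k * ((s + 1) * z ^ 2) := by gcongr; omega
      _ = _ := by ring
  have hNX : (ℓ + 2) * k * L ≤ 3 * k * z ^ 4 := by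
    calc _ ≤ (3 * z) * k * z := by gcongr <;> omega
      _ = 3 * k * z ^ 2 := by ring
      _ ≤ _ := Nat.mul_le_mul_left _ (hpow 2 4 (by norm_num))
  have hNA : (ℓ + 1) * s ≤ 2 * s * z ^ 4 := by
    calc _ ≤ (2 * z) * s := by gcongr; omega
      _ = 2 * s * z ^ 1 := by ring
      _ ≤ _ := Nat.mul_le_mul_left _ (hpow 1 4 (by norm_num))
  have hB : 7 * (2 + 2 * L + s) + ((k + 1) * L + s + 4) ≤ (8 * s + k + 33) * z := by
    have h1 : (k + 1) * L ≤ (k + 1) * z := by gcongr; omega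
    have h2 : s ≤ s * z := Nat.le_mul_of_pos_right _ hz
    nlinarith
  have hTB := Nat.mul_le_mul hT hB
  have hT4 : 2 * (k * (s + 1)) * z ^ 3 ≤ 2 * (k * (s + 1)) * z ^ 4 :=
    Nat.mul_le_mul_left _ (hpow 3 4 (by norm_num))
  have h1 := hpow 0 4 (by norm_num)
  rw [pow_zero] at h1
  have e : 2 * (k * (s + 1)) * z ^ 3 * ((8 * s + k + 33) * z) =
      2 * (k * (s + 1)) * (8 * s + k + 33) * z ^ 4 := by ring
  rw [e] at hTB
  simp only [add_mul (_ : ℕ) _ (z ^ 4), mul_assoc 2 (2 * (k * (s + 1)))]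
  omega

theorem le_of_mem_encodeFAs {x : ℕ} (hx : x ∈ encodeFAs ℓ M) :
    x ≤ k + s + n + ℓ + n * s * n + 1 := by
  simp only [encodeFAs, List.mem_append, List.mem_cons, List.not_mem_nil, or_false,
    List.mem_flatMap, List.mem_ofFn] at hx
  rcases hx with (rfl | rfl | rfl | rfl) | ⟨A, -, hx⟩
  any_goals omega
  have := A.length_arcs_le
  simp only [FA.encode, List.mem_append, List.mem_cons, List.not_mem_nil, or_false,
    List.mem_flatMap, List.mem_ofFn] at hx
  rcases hx with ((rfl | ⟨q, rfl⟩) | rfl) | ⟨e, -, rfl | rfl | rfl⟩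
  · omega
  · split <;> omega
  · omega
  all_goals omega

theorem size_encodeFAs_le (hn : 1 ≤ n) (hℓ : 1 ≤ ℓ) : size (encodeFAs ℓ M) ≤
    (4 + k * (3 + 3 * s)) * (k + 2 * s + 4) * (n * ℓ) ^ 4 := by
  have hlen := length_encodeFAs_le ℓ M fun i => (M i).length_arcs_le
  have hsz := size_le (w := encodeFAs ℓ M) fun x hx => le_of_mem_encodeFAs hx
  have hnz : n ≤ n * ℓ := Nat.le_mul_of_pos_right _ hℓ
  have hℓz : ℓ ≤ n * ℓ := Nat.le_mul_of_pos_left _ hn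
  generalize n * ℓ = z at *
  have hz : 1 ≤ z := hn.trans hnz
  have h2 : n * s * n ≤ s * z ^ 2 := by
    calc _ ≤ z * s * z := by gcongr
      _ = _ := by ring
  have hz2 : z ≤ z ^ 2 := Nat.le_self_pow (by norm_num) z
  have h1 : 1 ≤ z ^ 2 := hz.trans hz2
  have hlen' : (encodeFAs ℓ M).length ≤ (4 + k * (3 + 3 * s)) * z ^ 2 := by
    have h3 : n + 2 + 3 * (n * s * n) ≤ (3 + 3 * s) * z ^ 2 := by
      have e : (3 + 3 * s) * z ^ 2 = 3 * z ^ 2 + 3 * (s * z ^ 2) := by ring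
      omega
    have h4 := Nat.mul_le_mul_left k h3
    rw [add_mul, mul_assoc]
    omega
  have hb : 1 + (k + s + n + ℓ + n * s * n + 1) ≤ (k + 2 * s + 4) * z ^ 2 := by
    have h5 : k ≤ k * z ^ 2 := Nat.le_mul_of_pos_right _ h1
    have h6 : s ≤ s * z ^ 2 := Nat.le_mul_of_pos_right _ h1
    have e : (k + 2 * s + 4) * z ^ 2 = k * z ^ 2 + 2 * (s * z ^ 2) + 4 * z ^ 2 := by ring
    omega
  calc _ ≤ (encodeFAs ℓ M).length * (1 + (k + s + n + ℓ + n * s * n + 1)) := by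
        rw [mul_add, mul_one]; exact hsz
    _ ≤ ((4 + k * (3 + 3 * s)) * z ^ 2) * ((k + 2 * s + 4) * z ^ 2) := Nat.mul_le_mul hlen' hb
    _ = _ := by ring

end FormulaSize

/-- The width of the path decomposition exceeds `(k + 1) * log n` only by a constant, so an
exponential in the width with base `2 ^ (1 - δ)` is a power of `n` with an exponent that falls short
of `k + 1` by `δ * (k + 1)`. -/
theorem rpow_width_le {k s n ℓ : ℕ} {M : Fin k → FA s n} {δ : ℝ} (hδ0 : 0 < δ) (hδ1 : δ ≤ 1)
    (hn : 1 ≤ n) :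
    ((2 : ℝ) ^ (1 - δ)) ^ width ((FA.tableau ℓ (FAWord.bits n) M).bags.map List.toFinset) ≤
      2 ^ (k + s + 3) * (n : ℝ) ^ ((1 - δ) * (k + 1)) := by
  set b : ℝ := 2 ^ (1 - δ) with hb
  have hb1 : 1 ≤ b := Real.one_le_rpow (by norm_num) (by linarith)
  have hb2 : b ≤ 2 := by
    rw [hb]
    conv_rhs => rw [← Real.rpow_one 2]
    exact Real.rpow_le_rpow_of_exponent_le (by norm_num) (by linarith)
  have hw : width ((FA.tableau ℓ (FAWord.bits n) M).bags.map List.toFinset) ≤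
      (k + 1) * FAWord.bits n + s + 2 := Tableau.width_bags_le
  have hL : (2 : ℝ) ^ FAWord.bits n ≤ 2 * n := by exact_mod_cast FAWord.two_pow_bits_le hn
  generalize FAWord.bits n = L at *
  have e : b ^ ((k + 1) * L) = ((2 : ℝ) ^ L) ^ ((1 - δ) * (k + 1)) := by
    rw [hb, ← Real.rpow_natCast, ← Real.rpow_mul (by norm_num), ← Real.rpow_natCast 2 L,
      ← Real.rpow_mul (by norm_num)]
    congr 1
    push_cast
    ring
  have hexp : 0 ≤ (1 - δ) * ((k : ℝ) + 1) := mul_nonneg (by linarith) (by positivity)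
  calc b ^ _ ≤ b ^ ((k + 1) * L + s + 2) := pow_le_pow_right₀ hb1 hw
    _ = b ^ ((k + 1) * L) * b ^ (s + 2) := by rw [add_assoc, pow_add]
    _ ≤ (2 * (n : ℝ)) ^ ((1 - δ) * (k + 1)) * 2 ^ (s + 2) := by
      rw [e]
      exact mul_le_mul (Real.rpow_le_rpow (by positivity) hL hexp)
        (pow_le_pow_left₀ (by linarith) hb2 _) (by positivity) (by positivity)
    _ = 2 ^ ((1 - δ) * ((k : ℝ) + 1)) * 2 ^ (s + 2) * (n : ℝ) ^ ((1 - δ) * (k + 1)) := by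
      rw [Real.mul_rpow (by norm_num) (by positivity)]; ring
    _ ≤ 2 ^ (k + 1) * 2 ^ (s + 2) * (n : ℝ) ^ ((1 - δ) * (k + 1)) := by
      refine mul_le_mul_of_nonneg_right (mul_le_mul_of_nonneg_right ?_ (by positivity))
        (by positivity)
      rw [← Real.rpow_natCast]
      refine Real.rpow_le_rpow_of_exponent_le (by norm_num) ?_
      push_cast
      nlinarith [(Nat.cast_nonneg k : (0 : ℝ) ≤ k)]
    _ = _ := by rw [← pow_add]; congr 2; ring

/-- An algorithm that decides satisfiability faster than `2 ^ pw` decides the intersection of `k`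
automata faster than `n ^ k`: the formula of a family of automata has a path decomposition of
width about `k * log n`. The gain is linear in `k`, so for large `k` it absorbs all the factors
that are polynomial in the length of the input. -/
theorem exists_nfa_of_not_PPSETH (h : ¬ PPSETH) :
    ∃ (ε : ℝ) (k₀ : ℕ) (c : ℝ), 0 < ε ∧ 1 < k₀ ∧ 0 < c ∧
      ∃ P : Program, ∀ k : ℕ, k₀ < k → ∀ s : ℕ, ∃ K : ℝ,
        ∀ (n ℓ : ℕ), 1 ≤ ℓ → ∀ M : Fin k → FA s n,
          P.DecidesWithin (encodeFAs ℓ M) (IntersectionNonempty ℓ M)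
            (K * (n : ℝ) ^ ((1 - ε) * (k : ℝ)) * (ℓ : ℝ) ^ c) := by
  simp only [PPSETH, not_forall, not_not] at h
  obtain ⟨ε, hε0, hε2, P, K, c, hP⟩ := h
  obtain ⟨p, hp⟩ := FAWord.formulaWord.reduction
  obtain ⟨R, hR⟩ := hp P
  -- the base, at least `1`, is written as `2 ^ (1 - δ)`
  obtain ⟨δ, hδ0, hδ1, hδ⟩ : ∃ δ : ℝ, 0 < δ ∧ δ ≤ 1 ∧ 2 - ε ≤ 2 ^ (1 - δ) := by
    have hm1 : 1 ≤ max (2 - ε) 1 := le_max_right _ _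
    have hm2 : max (2 - ε) 1 < 2 := max_lt (by linarith) (by norm_num)
    have h1 : 0 ≤ Real.logb 2 (max (2 - ε) 1) := Real.logb_nonneg (by norm_num) hm1
    have h2 : Real.logb 2 (max (2 - ε) 1) < 1 := by
      rw [Real.logb_lt_iff_lt_rpow (by norm_num) (by linarith), Real.rpow_one]
      exact hm2
    refine ⟨1 - Real.logb 2 (max (2 - ε) 1), by linarith, by linarith, ?_⟩
    rw [sub_sub_cancel, Real.rpow_logb (by norm_num) (by norm_num) (by linarith)]
    exact le_max_left _ _
  set d := p.natDegree with hd
  -- the degree of all polynomial factors together; it does not depend on `k` and `s`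
  set e : ℕ := 4 * c + 4 * d + 4 with he
  refine ⟨δ / 2, ⌈2 * (1 + e) / δ⌉₊ + 2, e, by positivity, by omega, ?_, R, fun k hk s => ?_⟩
  · rw [he]; positivity
  have hk0 : 0 < k := by omega
  have hkδ : 1 + (e : ℝ) ≤ δ / 2 * k := by
    have h1 : 2 * (1 + (e : ℝ)) / δ ≤ k :=
      (Nat.le_ceil _).trans (by exact_mod_cast (by omega : ⌈2 * (1 + (e : ℝ)) / δ⌉₊ ≤ k))
    rw [div_le_iff₀ hδ0] at h1
    linarith
  obtain ⟨C, hC⟩ : ∃ C : ℕ, C = 3 * k + 2 * s + 4 + 2 * (2 * (k * (s + 1))) +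
    2 * (k * (s + 1)) * (8 * s + k + 33) := ⟨_, rfl⟩
  obtain ⟨C', hC'⟩ : ∃ C' : ℕ, C' = (4 + k * (3 + 3 * s)) * (k + 2 * s + 4) := ⟨_, rfl⟩
  set K' := max K 0 with hK'
  have hK'0 : 0 ≤ K' := le_max_right _ _
  refine ⟨K' * 2 ^ (k + s + 3) * C ^ c + p.eval 1 * C' ^ d * (1 + C), fun n ℓ hℓ M => ?_⟩
  have hn : 1 ≤ n := ((M ⟨0, hk0⟩).start.pos)
  have hS := sizeSAT_tableau_le (M := M) hn hℓ
  have hsz := size_encodeFAs_le (M := M) hn hℓ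
  rw [← hC] at hS
  rw [← hC'] at hsz
  have hdec := hP _ (FA.tableau ℓ (FAWord.bits n) M).formula (FA.tableau ℓ (FAWord.bits n) M).bags
    Tableau.isThreeCNF_formula Tableau.bags_nodup
    (Tableau.isPathDecomposition_bags hk0 (by change 0 < n * s * n + n; omega))
  rw [FA.tableau_satisfiable_iff hk0 hn (FAWord.le_two_pow_bits n), ← FAWord.formulaWord_out hk0]
    at hdec
  refine (hR _ _ _ hdec).mono ?_
  rw [FAWord.formulaWord_out hk0]
  have hW := (pow_le_pow_left₀ (by linarith) hδ _).trans
    (rpow_width_le (ℓ := ℓ) (M := M) hδ0 hδ1 hn)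
  have hlen : (encodeSAT (FA.tableau ℓ (FAWord.bits n) M).formula
      (FA.tableau ℓ (FAWord.bits n) M).bags).length ≤ C * (n * ℓ) ^ 4 :=
    (Nat.le_add_left _ _).trans hS
  have hsz1 : 1 ≤ size (encodeFAs ℓ M) := hn.trans FAWord.n_le_size
  have hpe : p.eval (size (encodeFAs ℓ M)) ≤ p.eval 1 * (C' ^ d * (n * ℓ) ^ (4 * d)) := by
    refine (eval_le_mul_pow p hsz1).trans (Nat.mul_le_mul_left _ ?_)
    rw [pow_mul, ← mul_pow]
    exact Nat.pow_le_pow_left hsz d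
  generalize width _ = w at hW ⊢
  generalize sizeSAT _ _ = S at hS ⊢
  generalize (encodeSAT _ _).length = len at hlen ⊢
  generalize p.eval (size _) = pe at hpe ⊢
  -- both parts of the running time are at most `n ^ q * (n * ℓ) ^ e` up to a constant
  have hb0 : (0 : ℝ) ≤ 2 - ε := by linarith
  have hn1 : (1 : ℝ) ≤ n := by exact_mod_cast hn
  have hℓ1 : (1 : ℝ) ≤ ℓ := by exact_mod_cast hℓ
  have hz1 : (1 : ℝ) ≤ (n : ℝ) * ℓ := by nlinarith
  set q : ℝ := (1 - δ) * (k + 1) with hq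
  have hq0 : 0 ≤ q := mul_nonneg (by linarith) (by positivity)
  have hnq : (1 : ℝ) ≤ (n : ℝ) ^ q := Real.one_le_rpow hn1 hq0
  have hS' : (S : ℝ) ≤ C * ((n : ℝ) * ℓ) ^ 4 := by exact_mod_cast hS
  have hlen' : (1 : ℝ) + len ≤ (1 + C) * ((n : ℝ) * ℓ) ^ 4 := by
    have h1 : (len : ℝ) ≤ C * ((n : ℝ) * ℓ) ^ 4 := by exact_mod_cast hlen
    have h2 := one_le_pow₀ hz1 (n := 4)
    linarith
  have hpe' : (pe : ℝ) ≤ p.eval 1 * (C' ^ d * ((n : ℝ) * ℓ) ^ (4 * d)) := by exact_mod_cast hpe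
  have hT1 : K * (2 - ε) ^ w * (S : ℝ) ^ c ≤
      K' * 2 ^ (k + s + 3) * C ^ c * ((n : ℝ) ^ q * ((n : ℝ) * ℓ) ^ e) := by
    calc K * (2 - ε) ^ w * (S : ℝ) ^ c
        ≤ K' * (2 ^ (k + s + 3) * (n : ℝ) ^ q) * (C * ((n : ℝ) * ℓ) ^ 4) ^ c := by
          refine mul_le_mul ?_ (pow_le_pow_left₀ (Nat.cast_nonneg _) hS' _) (by positivity)
            (by positivity)
          exact (mul_le_mul_of_nonneg_right (le_max_left K 0) (by positivity)).trans
            (mul_le_mul_of_nonneg_left hW hK'0)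
      _ = K' * 2 ^ (k + s + 3) * C ^ c * ((n : ℝ) ^ q * ((n : ℝ) * ℓ) ^ (4 * c)) := by
          rw [mul_pow, ← pow_mul]; ring
      _ ≤ _ := by
          refine mul_le_mul_of_nonneg_left (mul_le_mul_of_nonneg_left
            (pow_le_pow_right₀ hz1 (by omega)) (by positivity)) (by positivity)
  have hT2 : (pe : ℝ) * (1 + len) ≤
      p.eval 1 * C' ^ d * (1 + C) * ((n : ℝ) ^ q * ((n : ℝ) * ℓ) ^ e) := by
    calc (pe : ℝ) * (1 + len) ≤ p.eval 1 * (C' ^ d * ((n : ℝ) * ℓ) ^ (4 * d)) *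
          ((1 + C) * ((n : ℝ) * ℓ) ^ 4) :=
          mul_le_mul hpe' hlen' (by positivity) (by positivity)
      _ = p.eval 1 * C' ^ d * (1 + C) * (1 * ((n : ℝ) * ℓ) ^ (4 * d + 4)) := by
          rw [pow_add]; ring
      _ ≤ _ := by
          refine mul_le_mul_of_nonneg_left (mul_le_mul hnq (pow_le_pow_right₀ hz1 (by omega))
            (by positivity) (by positivity)) (by positivity)
  refine (add_le_add hT1 hT2).trans ?_
  rw [← add_mul, mul_assoc _ ((n : ℝ) ^ _) ((ℓ : ℝ) ^ _)]
  refine mul_le_mul_of_nonneg_left ?_ (by positivity)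
  rw [mul_pow, ← mul_assoc, Real.rpow_natCast, ← Real.rpow_natCast (n : ℝ) e,
    ← Real.rpow_add (by linarith)]
  refine mul_le_mul_of_nonneg_right (Real.rpow_le_rpow_of_exponent_le hn1 ?_) (by positivity)
  rw [hq]
  nlinarith

end PathSETH

theorem mainTheorem4 :
    List.TFAE [
      ¬ PathSETH.PPSETH,
      ∃ (ε : ℝ) (k : ℕ) (c : ℝ), 0 < ε ∧ 1 < k ∧ 0 < c ∧
        ∃ (P : PathSETH.Program) (K : ℝ),
          ∀ (n ℓ : ℕ), 1 ≤ ℓ → ∀ M : Fin k → PathSETH.FA 2 n, (∀ i, (M i).IsDFA) →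
            P.DecidesWithin (PathSETH.encodeFAs ℓ M) (PathSETH.IntersectionNonempty ℓ M)
              (K * (n : ℝ) ^ ((k : ℝ) - ε) * (ℓ : ℝ) ^ c),
      ∃ (ε : ℝ) (k₀ : ℕ) (c : ℝ), 0 < ε ∧ 1 < k₀ ∧ 0 < c ∧
        ∃ P : PathSETH.Program, ∀ k : ℕ, k₀ < k → ∃ K : ℝ,
          ∀ (n ℓ : ℕ), 1 ≤ ℓ → ∀ M : Fin k → PathSETH.FA 2 n,
            P.DecidesWithin (PathSETH.encodeFAs ℓ M) (PathSETH.IntersectionNonempty ℓ M)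
              (K * (n : ℝ) ^ ((1 - ε) * (k : ℝ)) * (ℓ : ℝ) ^ c),
      ∃ (ε : ℝ) (k₀ : ℕ) (c : ℝ), 0 < ε ∧ 1 < k₀ ∧ 0 < c ∧
        ∃ P : PathSETH.Program, ∀ k : ℕ, k₀ < k → ∀ s : ℕ, ∃ K : ℝ,
          ∀ (n ℓ : ℕ), 1 ≤ ℓ → ∀ M : Fin k → PathSETH.FA s n,
            P.DecidesWithin (PathSETH.encodeFAs ℓ M) (PathSETH.IntersectionNonempty ℓ M)
              (K * (n : ℝ) ^ ((1 - ε) * (k : ℝ)) * (ℓ : ℝ) ^ c)] := by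
  tfae_have 1 → 4 := PathSETH.exists_nfa_of_not_PPSETH
  tfae_have 4 → 3 := by
    rintro ⟨ε, k₀, c, hε, hk₀, hc, P, h⟩
    exact ⟨ε, k₀, c, hε, hk₀, hc, P, fun k hk => h k hk 2⟩
  tfae_have 3 → 2 := by
    rintro ⟨ε, k₀, c, hε, hk₀, hc, P, h⟩
    obtain ⟨K, hK⟩ := h (k₀ + 1) (Nat.lt_succ_self _)
    refine ⟨ε * ((k₀ + 1 : ℕ) : ℝ), k₀ + 1, c, by positivity, by omega, hc, P, K,
      fun n ℓ hℓ M _ => ?_⟩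
    have e : ((k₀ + 1 : ℕ) : ℝ) - ε * ((k₀ + 1 : ℕ) : ℝ) = (1 - ε) * ((k₀ + 1 : ℕ) : ℝ) := by ring
    rw [e]
    exact hK n ℓ hℓ M
  tfae_have 2 → 1 := by
    rintro ⟨ε, k, c, hε, hk, -, P, K, h⟩
    exact PathSETH.not_PPSETH_of_dfa hε hk h
  tfae_finish
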